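/- **Proposition.** Let $n\ge 2$. Let $\epsilon_1,\dots,\epsilon_n$ be the standard orthonormal basis of $\mathbb R^n$, let $N=\{\sum a_i\epsilon_i : a_i\in\mathbb Z,\ \sum a_i=0,\ a_i\equiv a_j \bmod n\}$, let $N_{\mathbb R}\cong\mathbb R^{n-1}$ be its real span with the induced Euclidean metric, and let $\alpha_i=(n-1)\epsilon_i-\sum_{j\ne i}\epsilon_j$. Let $N'\subset N$ be the sublattice generated by $\alpha_k-\alpha_{k+1}$, $1\le k\le n-1$. The *wonderful cell decomposition* $\mathcal{PT}^{n-1}$ of the torus $N_{\mathbb R}/N'$ is the image of the Voronoi decomposition of $N_{\mathbb R}$ determined by $N$; its cells are the images of the nonempty faces of the Voronoi cells. Let $K=K_{\mathcal{PT}}^{n-1}$ be the dual poset: the cells of $\mathcal{PT}^{n-1}$ ordered by reversed inclusion, together with a least element $\hat 0$ (the empty simplex). For a pure simplicial poset $S$ of dimension $n-1$ let $f_j$ be the number of its $j$-dimensional simplices, and define $h_j$ by $\sum_{j=0}^n h_jt^{n-j}=\sum_{j=0}^n f_{j-1}(t-1)^{n-j}$. Let $\widetilde\beta_j$ be the dimension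 of the $j$-th reduced homology of the geometric realization of $S$ with coefficients in a fixed field (an arbitrary one), and put $$h'_j=h_j+\binom nj\sum_{s=1}^{j-1}(-1)^{j-s-1}\widetilde\beta_{s-1}\quad(0\le j\le n),$$ $$h''_j=h'_j-\binom nj\widetilde\beta_{j-1}\quad(0\le j\le n-1),\qquad h''_n=h'_n.$$ Let $S(n,k)$ denote the Stirling numbers of the second kind; empty sums are zero. Then $K$ is a pure simplicial poset of dimension $n-1$, and its numbers are $$f_{k-1}=n\,(k-1)!\,S(n,k)\quad (k=1,\dots,n),\qquad f_{-1}=1;$$ $$h_l=(-1)^l\binom n{n-l}+\sum_{k=1}^l(-1)^{l-k}\binom{n-k}{n-l}\,n\,(k-1)!\,S(n,k)\quad (l=0,\dots,n);$$ $$h'_l=(-1)^l\binom n{n-l}+\sum_{k=1}^l(-1)^{l-k}\binom{n-k}{n-l}\,n\,(k-1)!\,S(n,k)+\binom nl\sum_{k=2}^{l-1}(-1)^{l-k-1}\binom{n-1}{k-1}\quad (l=0,\dots,n);$$ $$h''_l=(-1)^l\binom n{n-l}+\sum_{k=1}^l(-1)^{l-k}\binom{n-k}{n-l}\,n\,(k-1)!\,S(n,k)+\binom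 nl\sum_{k=2}^{l}(-1)^{l-k-1}\binom{n-1}{k-1}\quad (l=0,\dots,n-1),$$ and $h''_n=1$. -/

import Mathlib

noncomputable section

/-! ### Simplicial posets and their enumerative invariants -/

namespace SimplicialPoset

/-- `I` is a simplex with `k` vertices, i.e. of dimension `k - 1`: the interval below `I` is
isomorphic to the poset of all faces (including the empty one) of a simplex on `k` vertices,
that is, to the Boolean lattice of subsets of a `k`-element set. -/
def HasCard {S : Type*} [PartialOrder S] (I : S) (k : ℕ) : Prop :=
  Nonempty (Set.Iic I ≃o Finset (Fin k))

/-- A finite poset with least element in which every lower interval is the face poset of a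
simplex. -/
def IsSimplicial (S : Type*) [PartialOrder S] [OrderBot S] : Prop :=
  Finite S ∧ ∀ I : S, ∃ k : ℕ, HasCard I k

/-- All maximal simplices have exactly `n` vertices, i.e. dimension `n - 1`. -/
def IsPure (S : Type*) [PartialOrder S] (n : ℕ) : Prop :=
  ∀ I : S, IsMax I → HasCard I n

/-- `f S k` is the classical number `f_{k-1}`: the number of simplices of dimension `k - 1`. -/
def f (S : Type*) [PartialOrder S] (k : ℕ) : ℕ :=
  Nat.card {I : S // HasCard I k}

/-- The number `h_l` of a simplicial poset of dimension `n - 1`, read off as the coefficient of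
`t ^ (n - l)` in `∑_{j=0}^{n} f_{j-1} (t - 1) ^ (n - j)`. -/
def h (S : Type*) [PartialOrder S] (n l : ℕ) : ℤ :=
  (∑ j ∈ Finset.range (n + 1),
    Polynomial.C (f S j : ℤ) * (Polynomial.X - 1) ^ (n - j)).coeff (n - l)

/-! #### Reduced homology

The geometric realization of a simplicial poset `S` is triangulated by its barycentric
subdivision, whose simplices are the finite chains `I_1 < ⋯ < I_k` of nonempty simplices of `S`.
Reduced homology is computed by the augmented ordered simplicial chain complex of this
triangulation. Degrees are shifted by one: the index `k` is the number of elements of a chain, so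
index `k` is homological degree `k - 1`, and index `0` is the augmentation. -/

/-- The nonempty simplices of `S`. -/
abbrev Nonbot (S : Type*) [PartialOrder S] [OrderBot S] : Type _ := {I : S // I ≠ ⊥}

/-- Simplicial chains spanned by the strictly increasing sequences `c 0 < ⋯ < c (k - 1)`. -/
abbrev Chains (F : Type*) [Field F] (P : Type*) [PartialOrder P] (k : ℕ) : Type _ :=
  (Fin k ↪o P) →₀ F

/-- The simplicial boundary map `c ↦ ∑ i, (-1) ^ i • (c with its i-th element removed)`. -/
def boundary (F : Type*) [Field F] (P : Type*) [PartialOrder P] (k : ℕ) :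
    Chains F P (k + 1) →ₗ[F] Chains F P k :=
  Finsupp.linearCombination F fun c : Fin (k + 1) ↪o P =>
    ∑ i : Fin (k + 1),
      Finsupp.single ((Fin.succAboveOrderEmb i).trans c) ((-1 : F) ^ (i : ℕ))

/-- The cycles; in the lowest degree everything is a cycle. -/
def cycles (F : Type*) [Field F] (P : Type*) [PartialOrder P] :
    (k : ℕ) → Submodule F (Chains F P k)
  | 0 => ⊤
  | k + 1 => LinearMap.ker (boundary F P k)

/-- `reducedBetti F S k` is the reduced Betti number `β̃_{k-1}(S)` with coefficients in `F`: the
dimension of cycles modulo boundaries, the latter realized as the image of the cycles in the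
quotient of all chains by the boundaries. -/
def reducedBetti (F : Type*) [Field F] (S : Type*) [PartialOrder S] [OrderBot S] (k : ℕ) : ℕ :=
  Module.finrank F
    ((cycles F (Nonbot S) k).map (LinearMap.range (boundary F (Nonbot S) k)).mkQ)

/-- `h'_j = h_j + C(n,j) ∑_{s=1}^{j-1} (-1)^{j-s-1} β̃_{s-1}`. The exponent is written `j - s + 1`,
which has the same parity. -/
def h' (F : Type*) [Field F] (S : Type*) [PartialOrder S] [OrderBot S] (n j : ℕ) : ℤ :=
  h S n j + (n.choose j : ℤ) *
    ∑ s ∈ Finset.Icc 1 (j - 1), (-1 : ℤ) ^ (j - s + 1) * (reducedBetti F S s : ℤ)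

/-- `h''_j = h'_j - C(n,j) β̃_{j-1}` for `j ≤ n - 1`, and `h''_n = h'_n`. -/
def h'' (F : Type*) [Field F] (S : Type*) [PartialOrder S] [OrderBot S] (n j : ℕ) : ℤ :=
  if j < n then h' F S n j - (n.choose j : ℤ) * (reducedBetti F S j : ℤ) else h' F S n j

end SimplicialPoset

/-! ### The wonderful cell decomposition of the torus -/

namespace Wonderful

/-- `ℝⁿ` with the standard inner product. -/
abbrev E (n : ℕ) : Type := EuclideanSpace ℝ (Fin n)

/-- The lattice `N` of integer vectors with zero coordinate sum and with all coordinates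
congruent to each other modulo `n`. -/
def latticeN (n : ℕ) : AddSubgroup (E n) where
  carrier := {x | ∃ a : Fin n → ℤ, (∀ i, x i = (a i : ℝ)) ∧ ∑ i, a i = 0 ∧
    ∀ i j, a i ≡ a j [ZMOD n]}
  zero_mem' := ⟨0, by simp, by simp, fun _ _ => Int.ModEq.refl _⟩
  add_mem' := by
    rintro x y ⟨a, ha, ha0, ham⟩ ⟨b, hb, hb0, hbm⟩
    refine ⟨a + b, fun i => ?_, ?_, fun i j => (ham i j).add (hbm i j)⟩
    · simp [ha i, hb i]
    · simp [Finset.sum_add_distrib, ha0, hb0]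
  neg_mem' := by
    rintro x ⟨a, ha, ha0, ham⟩
    refine ⟨-a, fun i => ?_, ?_, fun i j => (ham i j).neg⟩
    · simp [ha i]
    · simp [ha0]

/-- The real span `N_ℝ` of `N`, with the inner product restricted from `ℝⁿ`. -/
abbrev NR (n : ℕ) : Submodule ℝ (E n) := Submodule.span ℝ (latticeN n : Set (E n))

/-- `N` as a subgroup of `N_ℝ`. -/
def N (n : ℕ) : AddSubgroup (NR n) := (latticeN n).comap (NR n).subtype.toAddMonoidHom

/-- The vectors `α_i = (n - 1) ε_i - ∑_{j ≠ i} ε_j`. -/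
def alpha (n : ℕ) (i : Fin n) : E n :=
  WithLp.toLp 2 fun j => if j = i then (n : ℝ) - 1 else -1

/-- The sublattice `N'` generated by `β_k = α_k - α_{k+1}`, `k = 1, …, n - 1`, as a subgroup
of `N_ℝ`. -/
def N' (n : ℕ) : AddSubgroup (NR n) :=
  (AddSubgroup.closure
    {b : E n | ∃ i j : Fin n, (i : ℕ) + 1 = (j : ℕ) ∧ b = alpha n i - alpha n j}).comap
    (NR n).subtype.toAddMonoidHom

/-- The Voronoi cell of a point `a` of the lattice `N`. -/
def voronoiCell (n : ℕ) (a : NR n) : Set (NR n) :=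
  {x | ∀ b ∈ N n, dist x a ≤ dist x b}

/-- The torus `N_ℝ / N'`. -/
abbrev Torus (n : ℕ) : Type := NR n ⧸ N' n

/-- The closed cells of the wonderful cell decomposition: the images in the torus of the nonempty
faces (of all dimensions, the whole polytope included) of the Voronoi cells of `N`. -/
def IsCell (n : ℕ) (C : Set (Torus n)) : Prop :=
  ∃ a ∈ N n, ∃ G : Set (NR n), G.Nonempty ∧ IsExposed ℝ (voronoiCell n a) G ∧
    C = (fun x : NR n => (QuotientAddGroup.mk x : Torus n)) '' G

/-- The poset of closed cells, ordered by inclusion. -/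
abbrev Cell (n : ℕ) : Type := {C : Set (Torus n) // IsCell n C}

/-- The simplicial poset dual to the wonderful decomposition: the cells ordered by reversed
inclusion, together with the least element (the empty simplex). -/
abbrev K (n : ℕ) : Type := WithBot (Cell n)ᵒᵈ

end Wonderful

end

/-! Every point of N has the form n y - (∑ y)(1, …, 1) with y an integer vector, unique up to
multiples of (1, …, 1); the points of N' are those with ∑ y = 0. Up to the factor 2n, the squared
distance from x to this point is `energy x y`, a submodular function of y, strictly so on
incomparable pairs. Hence the vectors nearest to a point form a chain invariant under adding (1, …,
1) (`isPeriodicChain_near`). Conversely, every such periodic chain is the set of nearest vectors of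
an explicit point (`near_center`). The faces of Voronoi cells are thus the periodic chains with
inclusion reversed (`exists_eq_face`, `isExposed_face`), and the nonempty simplices of K are the
periodic chains modulo translation by zero-sum vectors (`simplexOf_le_iff`).

Counting. Modulo these translations a periodic chain is given by a residue modulo n and by the order
in which the coordinates are raised in one period: an ordered partition of the coordinates into k
blocks, normalized so that coordinate 0 lies in the last one. This gives n (k-1)! S(n,k) simplices
with k vertices (`exists_chainOf`, `chainOf_injective`, `card_surjective_of_apply_zero`). Their
faces are the subchains (`hasCard_chainOf`), and a block with two elements can be split
(`exists_refinement`), which gives purity.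

Homology. The poset of periodic chains is acyclic (`acyclic_periodicChain`): finite pieces of it
retract step by step onto a cone. The group ℤ^(n-1) acts on it with quotient the nonempty simplices
of K, so its chains form a free resolution of F over the Laurent polynomial ring. The elements T_i -
1 form a regular sequence and kill the homology F, hence act null-homotopically. Dividing by one of
them replaces each Betti number by the sum of itself and its predecessor (`hrank_quotSMulTop`), so
Pascal's rule yields the binomial Betti numbers of the torus (`rank_homology`).

The formulas for h, h' and h'' follow by substitution; h''_n = 1 rests on a telescoping Stirling sum
and on the vanishing alternating sum of binomial coefficients. -/

noncomputable section

open Finsupp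

/-! ### The complex of finite lists -/

namespace ListComplex

variable (F : Type*) [Field F] {α β : Type*}

/-- Prepending `x` to every list of a chain. -/
def prep (x : α) : (List α →₀ F) →ₗ[F] (List α →₀ F) := Finsupp.lmapDomain F F (List.cons x)

/-- The alternating sum of the faces of a list. -/
def bdList : List α → (List α →₀ F)
  | [] => 0
  | x :: l => Finsupp.single l 1 - prep F x (bdList l)

/-- The boundary of a chain of lists. -/
def bd : (List α →₀ F) →ₗ[F] (List α →₀ F) := Finsupp.linearCombination F (bdList F)

/-- The map of chains induced by a map of vertices. -/
def push (f : α → β) : (List α →₀ F) →ₗ[F] (List β →₀ F) := Finsupp.lmapDomain F F (List.map f)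

variable {F}

@[simp] lemma prep_single (x : α) (l : List α) (a : F) :
    prep F x (single l a) = single (x :: l) a := by simp [prep]

@[simp] lemma push_single (f : α → β) (l : List α) (a : F) :
    push F f (single l a) = single (l.map f) a := by simp [push]

lemma bd_single (l : List α) (a : F) : bd F (single l a) = a • bdList F l := by simp [bd]

/-- The empty list carries the augmentation, so prepending a vertex is a contracting homotopy of the
whole complex. This formula drives `bd_bd`, `bd_prism` and the cone argument in
`Acyclic.of_isLeast`. -/
lemma bd_prep (x : α) (z : List α →₀ F) : bd F (prep F x z) = z - prep F x (bd F z) := by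
  induction z using Finsupp.induction_linear with
  | zero => simp
  | add a b ha hb => simp only [map_add, ha, hb]; abel
  | single l a => simp [bd_single, bdList, smul_sub]

lemma bd_bd (z : List α →₀ F) : bd F (bd F z) = 0 := by
  induction z using Finsupp.induction_linear with
  | zero => simp
  | add a b ha hb => simp [ha, hb]
  | single l a =>
    rw [bd_single, map_smul]
    suffices bd F (bdList F l) = 0 by rw [this, smul_zero]
    induction l with
    | nil => simp [bdList]
    | cons x l ih => simp [bdList, bd_prep, ih, bd_single]

lemma push_prep (f : α → β) (x : α) (z : List α →₀ F) :
    push F f (prep F x z) = prep F (f x) (push F f z) := by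
  induction z using Finsupp.induction_linear with
  | zero => simp
  | add a b ha hb => simp [ha, hb]
  | single l a => simp

lemma push_bd (f : α → β) (z : List α →₀ F) : push F f (bd F z) = bd F (push F f z) := by
  induction z using Finsupp.induction_linear with
  | zero => simp
  | add a b ha hb => simp [ha, hb]
  | single l a =>
    rw [push_single, bd_single, bd_single, map_smul]
    congr 1
    induction l with
    | nil => simp [bdList]
    | cons x l ih => simp [bdList, push_prep, ih]

/-- The part of the prism operator on a single list. -/
def prismList (F : Type*) [Field F] (f g : α → β) : List α → (List β →₀ F)
  | [] => 0
  | x :: l => single (f x :: g x :: l.map g) 1 - prep F (f x) (prismList F f g l)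

/-- The prism operator between two vertex maps. -/
def prism (F : Type*) [Field F] (f g : α → β) : (List α →₀ F) →ₗ[F] (List β →₀ F) :=
  Finsupp.linearCombination F (prismList F f g)

lemma prism_single (f g : α → β) (l : List α) (a : F) :
    prism F f g (single l a) = a • prismList F f g l := by simp [prism]

lemma prism_prep (f g : α → β) (x : α) (z : List α →₀ F) :
    prism F f g (prep F x z) =
      prep F (f x) (prep F (g x) (push F g z)) - prep F (f x) (prism F f g z) := by
  induction z using Finsupp.induction_linear with
  | zero => simp
  | add a b ha hb => simp only [map_add, ha, hb]; abel
  | single l a => simp [prism_single, prismList, smul_sub]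

/-- Two vertex maps are chain homotopic through the prism. No order is needed for the identity
itself; comparability of the maps only enters in `prism_mem`. -/
lemma bd_prism (f g : α → β) (z : List α →₀ F) :
    bd F (prism F f g z) + prism F f g (bd F z) = push F g z - push F f z := by
  induction z using Finsupp.induction_linear with
  | zero => simp
  | add a b ha hb =>
    simp only [map_add]
    rw [add_sub_add_comm, ← ha, ← hb]; abel
  | single l a =>
    have : (single l a : List α →₀ F) = a • single l 1 := by simp
    rw [this]
    simp only [map_smul, ← smul_add, ← smul_sub]
    congr 1
    clear this
    induction l with
    | nil => simp [prism_single, prismList, bd_single, bdList]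
    | cons x l ih =>
      rw [← prep_single]
      -- Only the identity for the tail is used from here on, so the tail may be any chain.
      generalize (single l 1 : List α →₀ F) = z at ih
      rw [bd_prep, map_sub, prism_prep, prism_prep, map_sub, bd_prep, bd_prep, bd_prep, ← push_bd,
        push_prep, push_prep]
      have h := congrArg (prep F (f x)) ih
      simp only [map_add, map_sub] at h ⊢
      rw [← sub_eq_zero] at h ⊢
      rw [← h]; abel

/-! ### Acyclicity -/

/-- Weakly increasing lists in `S`. -/
def weak [PartialOrder α] (S : Set α) : Set (List α) := {l | l.Pairwise (· ≤ ·) ∧ ∀ x ∈ l, x ∈ S}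

/-- Chains supported on the lists in `W`. -/
abbrev supp (F : Type*) [Field F] (W : Set (List α)) : Submodule F (List α →₀ F) :=
  Finsupp.supported F F W

lemma map_mem_supp {γ : Type*} {W : Set (List α)} {V : Set γ}
    {T : (List α →₀ F) →ₗ[F] (γ →₀ F)}
    (h : ∀ l ∈ W, T (single l 1) ∈ Finsupp.supported F F V) {z : List α →₀ F}
    (hz : z ∈ supp F W) : T z ∈ Finsupp.supported F F V := by
  have : supp F W ≤ (Finsupp.supported F F V).comap T := by
    rw [supp, Finsupp.supported_eq_span_single, Submodule.span_le]
    rintro _ ⟨l, hl, rfl⟩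
    exact h l hl
  exact this hz

lemma supp_weak_mono [PartialOrder α] {S T : Set α} (h : S ⊆ T) :
    supp F (weak S) ≤ supp F (weak T) :=
  Finsupp.supported_mono fun _ hl => ⟨hl.1, fun x hx => h (hl.2 x hx)⟩

/-- Every cycle of weakly increasing lists in `S` is the boundary of such a chain. -/
def Acyclic (F : Type*) [Field F] [PartialOrder α] (S : Set α) : Prop :=
  ∀ z ∈ supp F (weak S), bd F z = 0 → ∃ w ∈ supp F (weak S), bd F w = z

lemma bdList_mem_faces (l : List α) (R : α → α → Prop) (hl : l.Pairwise R) :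
    bdList F l ∈ supp F {l' | l'.Pairwise R ∧ ∀ x ∈ l', x ∈ l} := by
  induction l with
  | nil => exact Submodule.zero_mem _
  | cons x l ih =>
    rw [List.pairwise_cons] at hl
    refine Submodule.sub_mem _ (Finsupp.single_mem_supported _ _ ⟨hl.2, fun y hy => by simp [hy]⟩)
      (map_mem_supp (fun l' hl' => ?_) (ih hl.2))
    rw [prep_single]
    refine Finsupp.single_mem_supported _ _ ⟨List.pairwise_cons.2
      ⟨fun y hy => hl.1 y (hl'.2 y hy), hl'.1⟩, fun y hy => ?_⟩
    rcases List.mem_cons.1 hy with rfl | hy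
    · simp
    · simp [hl'.2 y hy]

variable [PartialOrder α] [PartialOrder β]

lemma push_mem {f : α → β} {S : Set α} {T : Set β} (hf : MonotoneOn f S) (hm : Set.MapsTo f S T)
    {z : List α →₀ F} (hz : z ∈ supp F (weak S)) : push F f z ∈ supp F (weak T) := by
  refine map_mem_supp (fun l hl => ?_) hz
  rw [push_single]
  refine Finsupp.single_mem_supported _ _ ⟨?_, ?_⟩
  · rw [List.pairwise_map]
    exact hl.1.imp_of_mem fun ha hb hab => hf (hl.2 _ ha) (hl.2 _ hb) hab
  · simp only [List.mem_map, forall_exists_index, and_imp, forall_apply_eq_imp_iff₂]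
    exact fun a ha => hm (hl.2 a ha)

lemma prism_mem {f g : α → β} {S : Set α} {T : Set β} (hf : MonotoneOn f S) (hg : MonotoneOn g S)
    (hfm : Set.MapsTo f S T) (hgm : Set.MapsTo g S T) (hfg : ∀ x ∈ S, f x ≤ g x)
    {z : List α →₀ F} (hz : z ∈ supp F (weak S)) : prism F f g z ∈ supp F (weak T) := by
  refine map_mem_supp (fun l hl => ?_) hz
  rw [prism_single, one_smul]
  -- The induction needs more than membership: every entry of a prism list dominates some `f x` with
  -- `x` in `l`, so that a smaller value of `f` may be prepended.
  suffices prismList F f g l ∈ supp F (weak T ∩ {l' | ∀ y ∈ l', ∃ x ∈ l, f x ≤ y}) from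
    Finsupp.supported_mono Set.inter_subset_left this
  induction l with
  | nil => exact Submodule.zero_mem _
  | cons x l ih =>
    obtain ⟨h1, h2⟩ := hl
    rw [List.pairwise_cons] at h1
    have hx : x ∈ S := h2 x (by simp)
    have h2' : ∀ y ∈ l, y ∈ S := fun y hy => h2 y (by simp [hy])
    refine Submodule.sub_mem _ (Finsupp.single_mem_supported _ _ ⟨⟨?_, ?_⟩, ?_⟩) ?_
    · have hgx : ∀ y ∈ l, g x ≤ g y := fun y hy => hg hx (h2' y hy) (h1.1 y hy)
      simp only [List.pairwise_cons, List.mem_cons, List.mem_map, forall_eq_or_imp,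
        forall_exists_index, and_imp, forall_apply_eq_imp_iff₂, List.pairwise_map]
      exact ⟨⟨hfg x hx, fun y hy => (hfg x hx).trans (hgx y hy)⟩, hgx,
        h1.2.imp_of_mem fun ha hb hab => hg (h2' _ ha) (h2' _ hb) hab⟩
    · simp only [List.mem_cons, List.mem_map, forall_eq_or_imp,
        forall_exists_index, and_imp, forall_apply_eq_imp_iff₂]
      exact ⟨hfm hx, hgm hx, fun y hy => hgm (h2' y hy)⟩
    · simp only [List.mem_cons, List.mem_map, forall_eq_or_imp, Set.mem_ofPred_eq,
        forall_exists_index, and_imp, forall_apply_eq_imp_iff₂, exists_eq_or_imp]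
      exact ⟨.inl le_rfl, .inl (hfg x hx), fun y hy => .inr ⟨y, hy, hfg y (h2' y hy)⟩⟩
    · refine map_mem_supp (fun l' hl' => ?_) (ih ⟨h1.2, h2'⟩)
      rw [prep_single]
      obtain ⟨⟨h3, h4⟩, h5⟩ := hl'
      refine Finsupp.single_mem_supported _ _ ⟨⟨List.pairwise_cons.2 ⟨fun y hy => ?_, h3⟩, ?_⟩, ?_⟩
      · obtain ⟨x', hx', hy'⟩ := h5 y hy
        exact (hf hx (h2' x' hx') (h1.1 x' hx')).trans hy'
      · simp only [List.mem_cons, forall_eq_or_imp]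
        exact ⟨hfm hx, h4⟩
      · simp only [List.mem_cons, forall_eq_or_imp, Set.mem_ofPred_eq, exists_eq_or_imp]
        exact ⟨.inl le_rfl, fun y hy => .inr (h5 y hy)⟩

/-- A monotone retraction comparable with the identity transports acyclicity. -/
lemma Acyclic.of_retraction {S T : Set α} (hST : S ⊆ T) {r : α → α} (hr : MonotoneOn r T)
    (hm : Set.MapsTo r T S) (h : (∀ x ∈ T, x ≤ r x) ∨ ∀ x ∈ T, r x ≤ x) (hS : Acyclic F S) :
    Acyclic F T := by
  intro z hz hbz
  -- The pushed cycle bounds inside `S`, and the prism between `r` and the identity makes it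
  -- homologous to `z` inside `T`. The two cases differ only in which of the maps is the smaller
  -- one.
  have hrz := push_mem hr hm hz
  obtain ⟨w, hw, hwz⟩ := hS _ hrz (by rw [← push_bd, hbz, map_zero])
  have hw' : w ∈ supp F (weak T) :=
    supp_weak_mono hST hw
  have hid : push F (id : α → α) z = z := by simp [push]
  have hmT : Set.MapsTo r T T := fun x hx => hST (hm hx)
  rcases h with h | h
  · refine ⟨w - prism F id r z, Submodule.sub_mem _ hw'
      (prism_mem monotoneOn_id hr (Set.mapsTo_id _) hmT h hz), ?_⟩
    have := bd_prism id r z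
    rw [hbz, map_zero, add_zero, hid] at this
    rw [map_sub, this, hwz, sub_sub_cancel]
  · refine ⟨w + prism F r id z, Submodule.add_mem _ hw'
      (prism_mem hr monotoneOn_id hmT (Set.mapsTo_id _) h hz), ?_⟩
    have := bd_prism r id z
    rw [hbz, map_zero, add_zero, hid] at this
    rw [map_add, this, hwz, add_sub_cancel]

/-- A cone: every cycle bounds its join with the least element. Weakly increasing lists are used
because that element may already be the first entry. -/
lemma Acyclic.of_isLeast {S : Set α} {a : α} (ha : IsLeast S a) : Acyclic F S := by
  intro z hz hbz
  refine ⟨prep F a z, ?_, by rw [bd_prep, hbz, map_zero, sub_zero]⟩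
  refine map_mem_supp (fun l hl => ?_) hz
  rw [prep_single]
  refine Finsupp.single_mem_supported _ _ ⟨List.pairwise_cons.2 ⟨fun x hx => ha.2 (hl.2 x hx), hl.1⟩,
    fun x hx => ?_⟩
  rcases List.mem_cons.1 hx with rfl | hx
  · exact ha.1
  · exact hl.2 x hx

/-- A set is acyclic if every finite subset is contained in an acyclic subset. -/
lemma Acyclic.of_finite {S : Set α}
    (h : ∀ A : Set α, A.Finite → A ⊆ S → ∃ T, A ⊆ T ∧ T ⊆ S ∧ Acyclic F T) : Acyclic F S := by
  intro z hz hbz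
  obtain ⟨T, hAT, hTS, hT⟩ := h (⋃ l ∈ z.support, {x | x ∈ l})
    (z.support.finite_toSet.biUnion fun l _ => List.finite_toSet l) (by
      intro x hx
      simp only [Set.mem_iUnion, Set.mem_ofPred_eq, exists_prop] at hx
      obtain ⟨l, hl, hx⟩ := hx
      exact (hz hl).2 x hx)
  obtain ⟨w, hw, hwz⟩ := hT z (fun l hl => ⟨(hz hl).1, fun x hx => hAT (by
    simp only [Set.mem_iUnion, Set.mem_ofPred_eq, exists_prop]; exact ⟨l, hl, hx⟩)⟩) hbz
  exact ⟨w, supp_weak_mono hTS hw, hwz⟩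

/-! ### Strictly increasing lists -/

/-- Strictly increasing lists. -/
def strict (α : Type*) [PartialOrder α] : Set (List α) := {l | l.Pairwise (· < ·)}

/-- Weakly but not strictly increasing lists. -/
def degen (α : Type*) [PartialOrder α] : Set (List α) :=
  {l | l.Pairwise (· ≤ ·) ∧ ¬ l.Pairwise (· < ·)}

/-- Degenerate lists span a subcomplex: of the faces of a list with a repeated entry, the two that
omit one of the equal neighbours cancel, and all others keep the repetition. -/
lemma bdList_degen (l : List α) (hl : l ∈ degen α) :
    bdList F l ∈ supp F (degen α ∩ {l' | ∀ x ∈ l', x ∈ l}) := by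
  induction l with
  | nil => exact Submodule.zero_mem _
  | cons x l ih =>
    obtain ⟨h1, h2⟩ := hl
    rw [List.pairwise_cons] at h1
    by_cases h3 : l.Pairwise (· < ·)
    · cases l with
      | nil => simp at h2
      | cons y l =>
        have hxy : x = y := by
          by_contra hne
          apply h2
          have hlt : x < y := lt_of_le_of_ne (h1.1 y (by simp)) hne
          rw [List.pairwise_cons] at h3 ⊢
          refine ⟨fun w hw => ?_, List.pairwise_cons.2 h3⟩
          rcases List.mem_cons.1 hw with rfl | hw
          · exact hlt
          · exact hlt.trans (h3.1 w hw)
        subst hxy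
        -- The faces omitting either copy of `x` have opposite signs.
        have : bdList F (x :: x :: l) = prep F x (prep F x (bdList F l)) := by
          simp [bdList]
        rw [this]
        have h4 := (List.pairwise_cons.1 h1.2)
        have := bdList_mem_faces (F := F) l (· ≤ ·) h4.2
        refine map_mem_supp (T := prep F x ∘ₗ prep F x) (fun l' hl' => ?_) this
        simp only [LinearMap.comp_apply, prep_single]
        refine Finsupp.single_mem_supported _ _ ⟨⟨?_, ?_⟩, fun y hy => ?_⟩
        · have : ∀ y ∈ l', x ≤ y := fun y hy => h4.1 y (hl'.2 y hy)
          simp only [List.pairwise_cons, List.mem_cons, forall_eq_or_imp]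
          exact ⟨⟨le_rfl, this⟩, this, hl'.1⟩
        · simp
        · simp only [List.mem_cons] at hy ⊢
          rcases hy with rfl | rfl | hy
          · simp
          · simp
          · simp [hl'.2 y hy]
    · refine Submodule.sub_mem _ (Finsupp.single_mem_supported _ _
        ⟨⟨h1.2, h3⟩, fun y hy => by simp [hy]⟩) (map_mem_supp (fun l' hl' => ?_) (ih ⟨h1.2, h3⟩))
      rw [prep_single]
      refine Finsupp.single_mem_supported _ _ ⟨⟨List.pairwise_cons.2
        ⟨fun y hy => h1.1 y (hl'.2 y hy), hl'.1.1⟩, fun h => hl'.1.2 (List.pairwise_cons.1 h).2⟩,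
        fun y hy => ?_⟩
      rcases List.mem_cons.1 hy with rfl | hy
      · simp
      · simp [hl'.2 y hy]

/-- Acyclicity of the complex of strictly increasing lists. -/
lemma Acyclic.strict (h : Acyclic F (Set.univ : Set α)) {z : List α →₀ F}
    (hz : z ∈ supp F (strict α)) (hbz : bd F z = 0) : ∃ w ∈ supp F (strict α), bd F w = z := by
  classical
  have hsub : ListComplex.strict α ⊆ weak Set.univ :=
    fun l hl => ⟨List.Pairwise.imp le_of_lt hl, fun _ _ => trivial⟩
  obtain ⟨w, hw, hwz⟩ := h z (Finsupp.supported_mono hsub hz) hbz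
  -- Strict and degenerate lists span subcomplexes meeting in zero; since `z` is strict, the strict
  -- part of `w` alone already bounds it.
  set w₁ := w.filter (· ∈ ListComplex.strict α) with hw₁
  set w₂ := w.filter (· ∉ ListComplex.strict α) with hw₂
  have hsum : w₁ + w₂ = w := Finsupp.filter_add_filter_not w _
  have m₁ : w₁ ∈ supp F (ListComplex.strict α) := by
    intro l hl
    rw [hw₁] at hl
    simp only [Finsupp.support_filter, Finset.coe_filter, Set.mem_ofPred_eq] at hl
    exact hl.2
  have m₂ : w₂ ∈ supp F (degen α) := by
    intro l hl
    rw [hw₂] at hl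
    simp only [Finsupp.support_filter, Finset.coe_filter, Set.mem_ofPred_eq] at hl
    exact ⟨(hw hl.1).1, hl.2⟩
  have b₁ : bd F w₁ ∈ supp F (ListComplex.strict α) := map_mem_supp (fun l hl => by
    rw [bd_single, one_smul]
    exact Finsupp.supported_mono (fun _ h => h.1) (bdList_mem_faces l _ hl)) m₁
  have b₂ : bd F w₂ ∈ supp F (degen α) := map_mem_supp (fun l hl => by
    rw [bd_single, one_smul]
    exact Finsupp.supported_mono Set.inter_subset_left (bdList_degen l hl)) m₂
  refine ⟨w₁, m₁, ?_⟩
  have heq : z - bd F w₁ = bd F w₂ := by rw [← hwz, ← hsum, map_add]; abel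
  have hmem : z - bd F w₁ ∈ supp F (ListComplex.strict α) ⊓ supp F (degen α) :=
    ⟨Submodule.sub_mem _ hz b₁, heq ▸ b₂⟩
  rw [supp, supp, ← Finsupp.supported_inter] at hmem
  have hemp : ListComplex.strict α ∩ degen α = ∅ := by
    ext l; simp only [Set.mem_inter_iff, Set.mem_empty_iff_false, iff_false]
    exact fun h => h.2.2 h.1
  rw [hemp, Finsupp.supported_empty, Submodule.mem_bot, sub_eq_zero] at hmem
  exact hmem.symm

end ListComplex

end

noncomputable section

/-! ### Periodic chains of integer vectors -/

namespace Wonderful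

/-- A nonempty chain of integer vectors that is invariant under translation by `(1, …, 1)`. -/
def IsPeriodicChain {n : ℕ} (M : Set (Fin n → ℤ)) : Prop :=
  M.Nonempty ∧ IsChain (· ≤ ·) M ∧ ∀ m, m + 1 ∈ M ↔ m ∈ M

/-- The poset of periodic chains. -/
abbrev PeriodicChain (n : ℕ) : Type := {M : Set (Fin n → ℤ) // IsPeriodicChain M}

lemma IsPeriodicChain.le_total {n : ℕ} {M : Set (Fin n → ℤ)} (hM : IsPeriodicChain M)
    {x y : Fin n → ℤ} (hx : x ∈ M) (hy : y ∈ M) : x ≤ y ∨ y ≤ x := by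
  rcases eq_or_ne x y with rfl | h
  · exact .inl le_rfl
  · exact hM.2.1 hx hy h

lemma mem_add_intCast {n : ℕ} {M : Set (Fin n → ℤ)} (h : ∀ m, m + 1 ∈ M ↔ m ∈ M)
    (m : Fin n → ℤ) (c : ℤ) : m + (c : Fin n → ℤ) ∈ M ↔ m ∈ M := by
  induction c using Int.induction_on with
  | zero => simp
  | succ i ih => rw [← ih, ← h (m + ((i : ℤ) : Fin n → ℤ))]; push_cast; rw [add_assoc]
  | pred i ih => rw [← ih, ← h (m + _)]; push_cast; rw [add_assoc, sub_add_cancel]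

lemma IsPeriodicChain.mem_add {n : ℕ} {M : Set (Fin n → ℤ)} (hM : IsPeriodicChain M)
    (m : Fin n → ℤ) (c : ℤ) : m + (c : Fin n → ℤ) ∈ M ↔ m ∈ M := mem_add_intCast hM.2.2 m c

/-- The translates of a vector by multiples of `(1, …, 1)`. -/
def orbit {n : ℕ} (p : Fin n → ℤ) : Set (Fin n → ℤ) := {x | ∃ c : ℤ, x = p + (c : Fin n → ℤ)}

lemma self_mem_orbit {n : ℕ} (p : Fin n → ℤ) : p ∈ orbit p := ⟨0, by simp⟩

lemma add_one_mem_orbit {n : ℕ} (p m : Fin n → ℤ) : m + 1 ∈ orbit p ↔ m ∈ orbit p := by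
  constructor
  · rintro ⟨c, hc⟩
    exact ⟨c - 1, by push_cast; rw [← add_sub_assoc, ← hc, add_sub_cancel_right]⟩
  · rintro ⟨c, rfl⟩
    exact ⟨c + 1, by push_cast; rw [add_assoc]⟩

lemma orbit_subset {n : ℕ} {M : Set (Fin n → ℤ)} (hM : IsPeriodicChain M) {p : Fin n → ℤ}
    (hp : p ∈ M) : orbit p ⊆ M := by
  rintro _ ⟨c, rfl⟩; exact (hM.mem_add p c).2 hp

lemma orbit_le_total {n : ℕ} (p : Fin n → ℤ) (c d : ℤ) :
    p + (c : Fin n → ℤ) ≤ p + (d : Fin n → ℤ) ∨ p + (d : Fin n → ℤ) ≤ p + (c : Fin n → ℤ) := by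
  rcases le_total c d with h | h
  · exact .inl fun i => by simpa using h
  · exact .inr fun i => by simpa using h

lemma isPeriodicChain_orbit {n : ℕ} (p : Fin n → ℤ) : IsPeriodicChain (orbit p) := by
  refine ⟨⟨p, self_mem_orbit p⟩, ?_, add_one_mem_orbit p⟩
  rintro _ ⟨c, rfl⟩ _ ⟨d, rfl⟩ _
  exact orbit_le_total p c d

/-- Adjoining a vector that is comparable with every member of a periodic chain. -/
lemma IsPeriodicChain.union_orbit {n : ℕ} {M : Set (Fin n → ℤ)} (hM : IsPeriodicChain M)
    {p : Fin n → ℤ} (hp : ∀ m ∈ M, m ≤ p ∨ p ≤ m) : IsPeriodicChain (M ∪ orbit p) := by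
  have key : ∀ m ∈ M, ∀ c : ℤ, m ≤ p + (c : Fin n → ℤ) ∨ p + (c : Fin n → ℤ) ≤ m := by
    intro m hm c
    have h1 : m + ((-c : ℤ) : Fin n → ℤ) ∈ M := (hM.mem_add m _).2 hm
    rcases hp _ h1 with h | h
    · left; intro i; have := h i; simp at this ⊢; linarith
    · right; intro i; have := h i; simp at this ⊢; linarith
  refine ⟨hM.1.mono Set.subset_union_left, ?_, fun m => ?_⟩
  · rintro x (hx | ⟨c, rfl⟩) y (hy | ⟨d, rfl⟩) hne
    · exact hM.2.1 hx hy hne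
    · exact key x hx d
    · exact (key y hy c).symm
    · exact orbit_le_total p c d
  · rw [Set.mem_union, Set.mem_union, hM.2.2, add_one_mem_orbit]

lemma IsPeriodicChain.diff_orbit {n : ℕ} {M : Set (Fin n → ℤ)} (hM : IsPeriodicChain M)
    {p q : Fin n → ℤ} (hq : q ∈ M) (hqp : q ∉ orbit p) : IsPeriodicChain (M \ orbit p) := by
  refine ⟨⟨q, hq, hqp⟩, hM.2.1.mono Set.sdiff_subset, fun m => ?_⟩
  rw [Set.mem_sdiff, Set.mem_sdiff, hM.2.2, add_one_mem_orbit]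

/-- The periodic chains whose members with vanishing initial coordinate lie in `I`. -/
def chainsIn {n : ℕ} (I : Finset (Fin (n + 1) → ℤ)) : Set (PeriodicChain (n + 1)) :=
  {M | ∀ m ∈ M.1, m 0 = 0 → m ∈ I}

lemma eq_of_mem_orbit {n : ℕ} {p q : Fin (n + 1) → ℤ} (h : q ∈ orbit p) (h0 : q 0 = p 0) :
    q = p := by
  obtain ⟨c, rfl⟩ := h
  have : c = 0 := by simpa using h0
  simp [this]

lemma IsPeriodicChain.exists_zero {n : ℕ} {M : Set (Fin (n + 1) → ℤ)} (hM : IsPeriodicChain M) :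
    ∃ m ∈ M, m 0 = 0 := by
  obtain ⟨m, hm⟩ := hM.1
  exact ⟨m + ((-m 0 : ℤ) : Fin (n + 1) → ℤ), (hM.mem_add _ _).2 hm, by simp⟩

/-- Applying an operation on sets to a periodic chain, if the result is a periodic chain. -/
def applyOp {n : ℕ} (r : Set (Fin n → ℤ) → Set (Fin n → ℤ)) (M : PeriodicChain n) :
    PeriodicChain n :=
  open Classical in if h : IsPeriodicChain (r M.1) then ⟨r M.1, h⟩ else M

lemma applyOp_val {n : ℕ} {r : Set (Fin n → ℤ) → Set (Fin n → ℤ)} {M : PeriodicChain n}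
    (h : IsPeriodicChain (r M.1)) : (applyOp r M).1 = r M.1 := by
  simp [applyOp, h]

open ListComplex

/-- A periodic chain is determined by its members with vanishing coordinate 0, one in each orbit;
here they are confined to a finite set `I` with least element `a` and closed downwards above `a`.
The induction removes a maximal `b` from `I`: every chain through `b` can first be enlarged by the
orbit of `p = a ⊔ (b - 1)` and then stripped of the orbit of `b`. Both moves are monotone and
comparable with the identity, so `Acyclic.of_retraction` applies twice. -/
lemma acyclic_chainsIn (F : Type*) [Field F] {n : ℕ} {a : Fin (n + 1) → ℤ} (ha0 : a 0 = 0) (k : ℕ) :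
    ∀ I : Finset (Fin (n + 1) → ℤ), I.card = k → a ∈ I → (∀ v ∈ I, a ≤ v) → (∀ v ∈ I, v 0 = 0) →
      (∀ v ∈ I, ∀ w, a ≤ w → w ≤ v → w ∈ I) → Acyclic F (chainsIn I) := by
  induction k with
  | zero => intro I hI ha; simp [Finset.card_eq_zero.1 hI] at ha
  | succ k ih =>
    intro I hI ha hle hV hlow
    rcases (I.erase a).eq_empty_or_nonempty with hemp | hne
    -- If `I = {a}`, then every chain in question contains the orbit of `a`, which is therefore the
    -- least one.
    · have hIa : ∀ m ∈ I, m = a := fun m hm => by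
        by_contra h
        have : m ∈ I.erase a := Finset.mem_erase.2 ⟨h, hm⟩
        simp [hemp] at this
      refine Acyclic.of_isLeast (a := ⟨orbit a, isPeriodicChain_orbit a⟩) ⟨?_, ?_⟩
      · intro m hm h0
        rw [eq_of_mem_orbit hm (by rw [h0, ha0])]; exact ha
      · intro M hM
        obtain ⟨m, hm, h0⟩ := M.2.exists_zero
        exact orbit_subset M.2 (hIa m (hM m hm h0) ▸ hm)
    · obtain ⟨b, hb⟩ := (I.erase a).exists_maximal hne
      have hba : b ≠ a := (Finset.mem_erase.1 hb.1).1
      have hbI : b ∈ I := (Finset.mem_erase.1 hb.1).2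
      have hmax : ∀ v ∈ I, b ≤ v → v = b := by
        intro v hv hbv
        rcases eq_or_ne v a with rfl | hva
        · exact absurd (le_antisymm hbv (hle b hbI)) hba
        · exact le_antisymm (hb.2 (Finset.mem_erase.2 ⟨hva, hv⟩) hbv) hbv
      -- If `M` contains `b`, it contains `b - 1`, whose coordinate 0 is negative. So each member
      -- with coordinate 0 equal to 0 lies above both `a` and `b - 1`, and below `b` by maximality:
      -- `p` is the general lower bound.
      set p : Fin (n + 1) → ℤ := a ⊔ (b - 1) with hp
      have hab : a ≤ b := hle b hbI
      have hpb : p ≤ b := sup_le hab (by intro i; simp)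
      have hb1 : b ≤ p + 1 := by
        intro i
        have : (b - 1) i ≤ p i := le_sup_right (a := a) (b := b - 1) i
        simp at this ⊢; linarith
      have hpI : p ∈ I := hlow b hbI p le_sup_left hpb
      have hp0 : p 0 = 0 := hV p hpI
      have hb0 : b 0 = 0 := hV b hbI
      have hpne : p ≠ b := by
        intro h
        apply hba
        funext i
        have : p i = b i := congrFun h i
        simp only [hp, Pi.sup_apply, Pi.sub_apply, Pi.one_apply] at this
        rcases le_total (a i) (b i - 1) with h1 | h1
        · rw [sup_eq_right.2 h1] at this; omega
        · rw [sup_eq_left.2 h1] at this; exact this.symm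
      have hpborb : p ∉ orbit b := fun h => hpne (eq_of_mem_orbit h (by rw [hp0, hb0]))
      have hbporb : b ∉ orbit p := fun h => hpne (eq_of_mem_orbit h (by rw [hp0, hb0])).symm
      have hbw : ∀ M ∈ chainsIn I, b ∈ M.1 → ∀ v ∈ M.1, v 0 = 0 → v ≤ b ∧ p ≤ v := by
        intro M hM hbM v hv hv0
        have hvI := hM v hv hv0
        refine ⟨?_, sup_le (hle v hvI) ?_⟩
        · rcases M.2.le_total hv hbM with h | h
          · exact h
          · exact (hmax v hvI h).le
        · have hb1 : b - 1 ∈ M.1 := by rwa [← M.2.2.2, sub_add_cancel]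
          rcases M.2.le_total hv hb1 with h | h
          · have := h 0; simp [hv0, hb0] at this
          · exact h
      have hcomp : ∀ M ∈ chainsIn I, b ∈ M.1 → ∀ m ∈ M.1, m ≤ p ∨ p ≤ m := by
        intro M hM hbM m hm
        obtain ⟨h1, h2⟩ := hbw M hM hbM (m + ((-m 0 : ℤ) : Fin (n + 1) → ℤ))
          ((M.2.mem_add _ _).2 hm) (by simp)
        rcases le_or_gt 0 (m 0) with h | h
        · right; intro i; have := h2 i; simp at this; linarith
        · left; intro i; have := h1 i; have h3 := hb1 i; simp at this h3; change m i ≤ p i; omega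
      set r₁ : Set (Fin (n + 1) → ℤ) → Set (Fin (n + 1) → ℤ) :=
        fun M => M ∪ {x | x ∈ orbit p ∧ b ∈ M} with hr₁
      set r₂ : Set (Fin (n + 1) → ℤ) → Set (Fin (n + 1) → ℤ) := fun M => M \ orbit b with hr₂
      have v₁ : ∀ M ∈ chainsIn I, (applyOp r₁ M).1 = r₁ M.1 := by
        intro M hM
        apply applyOp_val
        by_cases hbM : b ∈ M.1
        · have : r₁ M.1 = M.1 ∪ orbit p := by simp [hr₁, hbM]
          rw [this]; exact M.2.union_orbit (hcomp M hM hbM)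
        · have : r₁ M.1 = M.1 := by simp [hr₁, hbM]
          rw [this]; exact M.2
      -- The intermediate stage: chains through `b` that already pass through `p`, so that removing
      -- the orbit of `b` leaves a nonempty set.
      set T : Set (PeriodicChain (n + 1)) := {M ∈ chainsIn I | b ∈ M.1 → p ∈ M.1} with hT
      have v₂ : ∀ M ∈ T, (applyOp r₂ M).1 = r₂ M.1 := by
        intro M hM
        apply applyOp_val
        by_cases hbM : b ∈ M.1
        · exact M.2.diff_orbit (hM.2 hbM) hpborb
        · have : r₂ M.1 = M.1 := by
            refine Set.Subset.antisymm Set.sdiff_subset fun x hx => ⟨hx, ?_⟩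
            rintro ⟨c, rfl⟩
            exact hbM ((M.2.mem_add _ _).1 hx)
          rw [this]; exact M.2
      have h1 : Acyclic F (chainsIn (I.erase b)) := by
        refine ih _ (by rw [Finset.card_erase_of_mem hbI, hI]; rfl)
          (Finset.mem_erase.2 ⟨hba.symm, ha⟩) (fun v hv => hle v (Finset.mem_of_mem_erase hv))
          (fun v hv => hV v (Finset.mem_of_mem_erase hv)) fun v hv w haw hwv => ?_
        rw [Finset.mem_erase] at hv ⊢
        refine ⟨?_, hlow v hv.2 w haw hwv⟩
        rintro rfl
        exact hv.1 (hmax v hv.2 hwv)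
      have hsub : chainsIn (I.erase b) ⊆ T := by
        intro M hM
        refine ⟨fun m hm h0 => Finset.mem_of_mem_erase (hM m hm h0), fun hbM => ?_⟩
        have := hM b hbM hb0
        simp at this
      have h2 : Acyclic F T := by
        refine Acyclic.of_retraction hsub (r := applyOp r₂) ?_ ?_ (.inr ?_) h1
        · intro M hM M' hM' hle
          rw [← Subtype.coe_le_coe, v₂ M hM, v₂ M' hM']
          exact Set.sdiff_subset_sdiff_left hle
        · intro M hM m hm h0
          rw [v₂ M hM] at hm
          refine Finset.mem_erase.2 ⟨?_, hM.1 m hm.1 h0⟩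
          rintro rfl
          exact hm.2 (self_mem_orbit m)
        · intro M hM
          rw [← Subtype.coe_le_coe, v₂ M hM]
          exact Set.sdiff_subset
      refine Acyclic.of_retraction (Set.sep_subset _ _ : T ⊆ chainsIn I) (r := applyOp r₁) ?_ ?_
        (.inl ?_) h2
      · intro M hM M' hM' hle
        rw [← Subtype.coe_le_coe, v₁ M hM, v₁ M' hM']
        exact Set.union_subset_union hle fun x hx => ⟨hx.1, hle hx.2⟩
      · intro M hM
        refine ⟨fun m hm h0 => ?_, fun hbM => ?_⟩
        · rw [v₁ M hM] at hm
          rcases hm with hm | hm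
          · exact hM m hm h0
          · rw [eq_of_mem_orbit hm.1 (by rw [h0, hp0])]; exact hpI
        · rw [v₁ M hM] at hbM ⊢
          refine .inr ⟨self_mem_orbit p, ?_⟩
          rcases hbM with h | h
          · exact h
          · exact h.2
      · intro M hM
        rw [← Subtype.coe_le_coe, v₁ M hM]
        exact Set.subset_union_left

/-- The order complex of the poset of periodic chains is acyclic. -/
lemma acyclic_periodicChain (F : Type*) [Field F] (n : ℕ) :
    Acyclic F (Set.univ : Set (PeriodicChain (n + 1))) := by
  classical
  refine Acyclic.of_finite fun A hA _ => ?_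
  have hfin : (⋃ M ∈ A, {m | m ∈ M.1 ∧ m 0 = 0}).Finite := by
    refine hA.biUnion fun M _ => ?_
    obtain ⟨q, hq, hq0⟩ := M.2.exists_zero
    -- A member with coordinate 0 equal to that of `q` is comparable with `q - 1` and `q + 1`, and
    -- coordinate 0 decides the direction.
    refine (Set.finite_Icc (q - 1) (q + 1)).subset ?_
    rintro m ⟨hm, hm0⟩
    have hq1 : q + 1 ∈ M.1 := (M.2.2.2 q).2 hq
    have hq2 : q - 1 ∈ M.1 := by rwa [← M.2.2.2, sub_add_cancel]
    constructor
    · rcases M.2.le_total hm hq2 with h | h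
      · have := h 0; simp [hm0, hq0] at this
      · exact h
    · rcases M.2.le_total hm hq1 with h | h
      · exact h
      · have := h 0; simp [hm0, hq0] at this
  -- Inserting 0 keeps `B` nonempty even when `A` is empty.
  set B := insert (0 : Fin (n + 1) → ℤ) hfin.toFinset with hB
  have hB0 : ∀ v ∈ B, v 0 = 0 := by
    intro v hv
    rcases Finset.mem_insert.1 hv with rfl | hv
    · rfl
    · simp only [Set.Finite.mem_toFinset, Set.mem_iUnion, Set.mem_ofPred_eq] at hv
      obtain ⟨_, _, h⟩ := hv
      exact h.2
  have hBne : B.Nonempty := Finset.insert_nonempty _ _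
  set a := B.inf' hBne id with ha
  have haB : ∀ v ∈ B, a ≤ v := fun v hv => Finset.inf'_le id hv
  have ha0 : a 0 = 0 := by
    rw [ha, Finset.inf'_apply]
    exact le_antisymm ((Finset.inf'_le _ (Finset.mem_insert_self _ _)).trans (by simp))
      (Finset.le_inf' _ _ fun v hv => (hB0 v hv).ge)
  set I := B.biUnion fun v => Finset.Icc a v with hI
  have hmem : ∀ w, w ∈ I ↔ ∃ v ∈ B, a ≤ w ∧ w ≤ v := by simp [hI]
  refine ⟨chainsIn I, ?_, Set.subset_univ _,
    acyclic_chainsIn F (a := a) ha0 _ I rfl ?_ ?_ ?_ ?_⟩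
  · intro M hM m hm h0
    have : m ∈ B := Finset.mem_insert_of_mem (by
      simp only [Set.Finite.mem_toFinset, Set.mem_iUnion, Set.mem_ofPred_eq]
      exact ⟨M, hM, hm, h0⟩)
    exact (hmem m).2 ⟨m, this, haB m this, le_rfl⟩
  · exact (hmem a).2 ⟨0, Finset.mem_insert_self _ _, le_rfl, haB _ (Finset.mem_insert_self _ _)⟩
  · intro v hv
    obtain ⟨_, _, h, _⟩ := (hmem v).1 hv
    exact h
  · intro v hv
    obtain ⟨u, hu, h1, h2⟩ := (hmem v).1 hv
    exact le_antisymm ((h2 0).trans (hB0 u hu).le) (ha0.ge.trans (h1 0))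
  · intro v hv w haw hwv
    obtain ⟨u, hu, h1, h2⟩ := (hmem v).1 hv
    exact (hmem w).2 ⟨u, hu, haw, hwv.trans h2⟩

end Wonderful

end

noncomputable section

/-! ### Quotients of complexes by null-homotopic regular elements -/

namespace NullHomotopic

open LinearMap Submodule
open scoped Pointwise

universe u v w

/-- The dimension of cycles `Z` modulo boundaries `B`. -/
def hrank (F : Type*) {R M : Type*} [Field F] [CommRing R] [Algebra F R] [AddCommGroup M]
    [Module R M] [Module F M] [IsScalarTower F R M] (B Z : Submodule R M) : Cardinal :=
  Module.rank F (Z.map B.mkQ)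

variable {F : Type v} [Field F] {R : Type w} [CommRing R] [Algebra F R]

lemma rank_range_eq_of_ker_eq {A : Type*} {B C : Type u} [AddCommGroup A] [AddCommGroup B]
    [AddCommGroup C] [Module R A] [Module R B] [Module R C] [Module F B] [Module F C]
    [IsScalarTower F R B] [IsScalarTower F R C] (f : A →ₗ[R] B) (g : A →ₗ[R] C)
    (h : ker f = ker g) : Module.rank F (range f) = Module.rank F (range g) :=
  (((f.quotKerEquivRange.symm.trans (quotEquivOfEq _ _ h)).trans
    g.quotKerEquivRange).restrictScalars F).rank_eq

section Step

variable {A₃ A₂ A₁ A₀ : Type u} [AddCommGroup A₃] [AddCommGroup A₂] [AddCommGroup A₁]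
  [AddCommGroup A₀] [Module R A₃] [Module R A₂] [Module R A₁] [Module R A₀]
  [Module F A₂] [Module F A₁] [IsScalarTower F R A₂] [IsScalarTower F R A₁]

lemma mk_eq_zero_iff (r : R) (x : A₂) :
    (Submodule.Quotient.mk x : QuotSMulTop r A₂) = 0 ↔ ∃ y, r • y = x := by
  rw [Submodule.Quotient.mk_eq_zero, Submodule.mem_smul_pointwise_iff_exists]
  simp

/-- In the long exact sequence of multiplication by `r`, a null-homotopic `r` acts as zero on
homology. The sequence breaks up and the homology of the quotient is an extension of the homology at
`A₁` by that at `A₂`. If `u` is a cycle, then `d₂ (s₁ u) = r • u`, so `s₁ u` is a cycle modulo `r`;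
this splits the connecting map. -/
lemma hrank_quotSMulTop (r : R) (d₃ : A₃ →ₗ[R] A₂) (d₂ : A₂ →ₗ[R] A₁) (d₁ : A₁ →ₗ[R] A₀)
    (h₂₃ : ∀ x, d₂ (d₃ x) = 0) (h₁₂ : ∀ x, d₁ (d₂ x) = 0)
    (s₂ : A₂ →ₗ[R] A₃) (s₁ : A₁ →ₗ[R] A₂) (s₀ : A₀ →ₗ[R] A₁)
    (hs₂ : ∀ x, d₃ (s₂ x) + s₁ (d₂ x) = r • x) (hs₁ : ∀ x, d₂ (s₁ x) + s₀ (d₁ x) = r • x)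
    (r₁ : IsSMulRegular A₁ r) (r₀ : IsSMulRegular A₀ r) :
    hrank F (range (QuotSMulTop.map r d₃)) (ker (QuotSMulTop.map r d₂)) =
      hrank F (range d₃) (ker d₂) + hrank F (range d₂) (ker d₁) := by
  set mk : A₂ →ₗ[R] QuotSMulTop r A₂ := (r • (⊤ : Submodule R A₂)).mkQ with hmk
  set q := (range (QuotSMulTop.map r d₃)).mkQ with hq
  set Φ : (ker d₂ × ker d₁) →ₗ[R] (QuotSMulTop r A₂ ⧸ range (QuotSMulTop.map r d₃)) :=
    q ∘ₗ mk ∘ₗ LinearMap.coprod (ker d₂).subtype (s₁ ∘ₗ (ker d₁).subtype) with hΦ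
  set Ψ₂ : ker d₂ →ₗ[R] (ker d₂).map (range d₃).mkQ := (range d₃).mkQ.submoduleMap (ker d₂) with hΨ₂
  set Ψ₁ : ker d₁ →ₗ[R] (ker d₁).map (range d₂).mkQ := (range d₂).mkQ.submoduleMap (ker d₁) with hΨ₁
  have hΦ0 : ∀ z u, Φ (z, u) = 0 ↔ ∃ w v, z.1 + s₁ u.1 = d₃ w + r • v := by
    intro z u
    have h1 : Φ (z, u) = q (mk (z.1 + s₁ u.1)) := rfl
    rw [h1, hq, mkQ_apply, Submodule.Quotient.mk_eq_zero, mem_range]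
    constructor
    · rintro ⟨y, hy⟩
      obtain ⟨w, rfl⟩ := Submodule.Quotient.mk_surjective _ y
      rw [QuotSMulTop.map_apply_mk] at hy
      have : (Submodule.Quotient.mk (z.1 + s₁ u.1 - d₃ w) : QuotSMulTop r A₂) = 0 := by
        rw [Submodule.Quotient.mk_sub, hy, hmk, mkQ_apply, sub_self]
      obtain ⟨v, hv⟩ := (mk_eq_zero_iff r _).1 this
      exact ⟨w, v, by rw [hv]; abel⟩
    · rintro ⟨w, v, h⟩
      refine ⟨Submodule.Quotient.mk w, ?_⟩
      rw [QuotSMulTop.map_apply_mk, h, hmk, mkQ_apply, Submodule.Quotient.mk_add,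
        (mk_eq_zero_iff r (r • v)).2 ⟨v, rfl⟩, add_zero]
  have hΨ₂0 : ∀ z, Ψ₂ z = 0 ↔ ∃ w, d₃ w = z.1 := by
    intro z
    rw [← Subtype.coe_inj]
    change (range d₃).mkQ z.1 = 0 ↔ _
    rw [mkQ_apply, Submodule.Quotient.mk_eq_zero, mem_range]
  have hΨ₁0 : ∀ z, Ψ₁ z = 0 ↔ ∃ w, d₂ w = z.1 := by
    intro z
    rw [← Subtype.coe_inj]
    change (range d₂).mkQ z.1 = 0 ↔ _
    rw [mkQ_apply, Submodule.Quotient.mk_eq_zero, mem_range]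
  -- `Φ` and the projection to homology classes have the same kernel, so their images have the same
  -- dimension; one image is the homology of the quotient, the other is the direct sum.
  have hker : ker Φ = ker (Ψ₂.prodMap Ψ₁) := by
    ext ⟨⟨z, hz⟩, ⟨u, hu⟩⟩
    rw [LinearMap.mem_ker] at hz hu
    rw [LinearMap.mem_ker, LinearMap.mem_ker, hΦ0, LinearMap.prodMap_apply, Prod.mk_eq_zero,
      hΨ₂0, hΨ₁0]
    constructor
    · rintro ⟨w, v, h⟩
      dsimp only at h ⊢
      have h1 : d₂ (s₁ u) = r • u := by have := hs₁ u; rwa [hu, map_zero, add_zero] at this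
      have h2 := congrArg d₂ h
      rw [map_add, map_add, hz, zero_add, h1, h₂₃, zero_add, map_smul] at h2
      have h3 : u = d₂ v := r₁ h2
      have h4 := hs₂ v
      rw [← h3] at h4
      refine ⟨⟨w + s₂ v, ?_⟩, v, h3.symm⟩
      rw [map_add, ← add_right_cancel_iff (a := s₁ u), h, add_assoc, h4]
    · rintro ⟨⟨w, hw⟩, v, hv⟩
      dsimp only at hw hv ⊢
      have := hs₂ v
      rw [hv] at this
      refine ⟨w - s₂ v, v, ?_⟩
      rw [map_sub, hw, ← this]; abel
  have hrΨ : range (Ψ₂.prodMap Ψ₁) = ⊤ := by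
    rw [range_eq_top]
    exact Function.Surjective.prodMap (submoduleMap_surjective _ _) (submoduleMap_surjective _ _)
  have hrΦ : range Φ = (ker (QuotSMulTop.map r d₂)).map q := by
    apply le_antisymm
    · rintro _ ⟨⟨⟨z, hz⟩, ⟨u, hu⟩⟩, rfl⟩
      rw [LinearMap.mem_ker] at hz hu
      refine ⟨mk (z + s₁ u), ?_, rfl⟩
      have h1 : d₂ (s₁ u) = r • u := by have := hs₁ u; rwa [hu, map_zero, add_zero] at this
      change QuotSMulTop.map r d₂ (Submodule.Quotient.mk _) = 0
      rw [QuotSMulTop.map_apply_mk, map_add, hz, zero_add, h1, mk_eq_zero_iff]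
      exact ⟨u, rfl⟩
    · rintro _ ⟨z', hz', rfl⟩
      obtain ⟨z, rfl⟩ := Submodule.Quotient.mk_surjective _ z'
      change QuotSMulTop.map r d₂ (Submodule.Quotient.mk _) = 0 at hz'
      rw [QuotSMulTop.map_apply_mk, mk_eq_zero_iff] at hz'
      obtain ⟨u, hu⟩ := hz'
      have hu1 : d₁ u = 0 := by
        -- Since `r • u` is a boundary, `r • d₁ u` vanishes; regularity on `A₀` makes `u` a cycle.
        apply r₀
        change r • d₁ u = r • 0
        rw [← map_smul, hu, h₁₂, smul_zero]
      have h1 : d₂ (s₁ u) = r • u := by have := hs₁ u; rwa [hu1, map_zero, add_zero] at this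
      refine ⟨(⟨z - s₁ u, ?_⟩, ⟨u, hu1⟩), ?_⟩
      · rw [LinearMap.mem_ker, map_sub, h1, hu, sub_self]
      · change q (mk (z - s₁ u + s₁ u)) = _
        rw [sub_add_cancel]; rfl
  have h1 := rank_range_eq_of_ker_eq (F := F) Φ (Ψ₂.prodMap Ψ₁) hker
  rw [hrΨ, hrΦ] at h1
  have h2 := ((topEquiv (R := R)
    (M := (ker d₂).map (range d₃).mkQ × (ker d₁).map (range d₂).mkQ)).restrictScalars F).rank_eq
  rw [hrank, h1, h2, rank_prod']
  rfl

end Step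

end NullHomotopic

end

/-! ### Iteration along a regular sequence -/

noncomputable section

namespace NullHomotopic

open LinearMap Submodule
open scoped Pointwise
universe u v w
variable {F : Type v} [Field F] {R : Type w} [CommRing R] [Algebra F R]

/-- An `R`-linear null-homotopy of multiplication by `r`. -/
def IsNullHomotopic {A : ℕ → Type u} [∀ i, AddCommGroup (A i)] [∀ i, Module R (A i)]
    (d : ∀ i, A (i + 1) →ₗ[R] A i) (r : R) : Prop :=
  ∃ s : ∀ i, A i →ₗ[R] A (i + 1), (∀ x, d 0 (s 0 x) = r • x) ∧
    ∀ i x, d (i + 1) (s (i + 1) x) + s i (d i x) = r • x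

/-- Isomorphic complexes have the same Betti numbers. The first complex is linear over `R`, the
second and the isomorphisms only over `F`. -/
lemma hrank_of_ker_eq_bot {A B C A' B' C' : Type u} [AddCommGroup A] [AddCommGroup B]
    [AddCommGroup C] [Module R A] [Module R B] [Module R C] [Module F A] [Module F B] [Module F C]
    [IsScalarTower F R B] [AddCommGroup A'] [AddCommGroup B']
    [AddCommGroup C'] [Module F A'] [Module F B'] [Module F C']
    (d₂ : A →ₗ[R] B) (d₁ : B →ₗ[R] C) (e₂ : A' →ₗ[F] B') (e₁ : B' →ₗ[F] C')
    (a : A ≃ₗ[F] A') (b : B ≃ₗ[F] B') (c : C ≃ₗ[F] C') (h₂ : ∀ x, b (d₂ x) = e₂ (a x))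
    (h₁ : ∀ x, c (d₁ x) = e₁ (b x)) :
    hrank F (range d₂) (ker d₁) = hrank F (range e₂) (ker e₁) := by
  have hr : ((range d₂).restrictScalars F).map b.toLinearMap = range e₂ := by
    ext y
    constructor
    · rintro ⟨_, ⟨x, rfl⟩, rfl⟩
      exact ⟨a x, (h₂ x).symm⟩
    · rintro ⟨x, rfl⟩
      refine ⟨d₂ (a.symm x), ⟨_, rfl⟩, ?_⟩
      simp [h₂]
  set Q : (B ⧸ range d₂) ≃ₗ[F] (B' ⧸ range e₂) :=
    Submodule.Quotient.equiv ((range d₂).restrictScalars F) (range e₂) b hr with hQ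
  have hm : (((ker d₁).map (range d₂).mkQ).restrictScalars F).map Q.toLinearMap =
      (ker e₁).map (range e₂).mkQ := by
    ext y
    constructor
    · rintro ⟨_, ⟨x, hx, rfl⟩, rfl⟩
      refine ⟨b x, ?_, rfl⟩
      change e₁ (b x) = 0
      rw [← h₁, show d₁ x = 0 from hx, map_zero]
    · rintro ⟨x, hx, rfl⟩
      refine ⟨(range d₂).mkQ (b.symm x), ⟨b.symm x, ?_, rfl⟩, ?_⟩
      · change d₁ (b.symm x) = 0
        apply c.injective
        rw [h₁, b.apply_symm_apply, map_zero]
        exact hx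
      · change (range e₂).mkQ (b (b.symm x)) = _
        rw [b.apply_symm_apply]
  rw [hrank, hrank, ← hm]
  exact (Q.submoduleMap (((ker d₁).map (range d₂).mkQ).restrictScalars F)).rank_eq

/-- Induction on `rs` with the complex varying. Dividing by the first element turns the Betti
numbers `j.choose (k + 1)` into those for `j + 1`, by `hrank_quotSMulTop` and Pascal's rule, while
the remaining elements stay regular and null-homotopic. The target `E`, which is the quotient by all
of `rs` up to an `F`-isomorphism, is fixed throughout; only `π` descends. -/
theorem hrank_quotient : ∀ (rs : List R) (A : ℕ → Type u) [∀ i, AddCommGroup (A i)]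
    [∀ i, Module R (A i)] [∀ i, Module F (A i)] [∀ i, IsScalarTower F R (A i)]
    (d : ∀ i, A (i + 1) →ₗ[R] A i) (_ : ∀ i x, d i (d (i + 1) x) = 0) (j : ℕ)
    (_ : hrank F (range (d 0)) ⊤ = 1)
    (_ : ∀ k, hrank F (range (d (k + 1))) (ker (d k)) = (j.choose (k + 1) : ℕ))
    (_ : ∀ i, RingTheory.Sequence.IsWeaklyRegular (A i) rs)
    (_ : ∀ r ∈ rs, IsNullHomotopic d r)
    (E : ℕ → Type u) [∀ i, AddCommGroup (E i)] [∀ i, Module F (E i)]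
    (e : ∀ i, E (i + 1) →ₗ[F] E i) (π : ∀ i, A i →ₗ[F] E i)
    (_ : ∀ i, Function.Surjective (π i)) (_ : ∀ i x, π i (d i x) = e i (π (i + 1) x))
    (_ : ∀ i x, π i x = 0 ↔ x ∈ (Ideal.ofList rs • ⊤ : Submodule R (A i))) (k : ℕ),
    hrank F (range (e (k + 1))) (ker (e k)) = ((j + rs.length).choose (k + 1) : ℕ)
  | [], A, _, _, _, _, d, hdd, j, h0, hk, hreg, hs, E, _, _, e, π, hsurj, hcomm, hker, k => by
    have hinj : ∀ i, Function.Injective (π i) := fun i => by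
      rw [injective_iff_map_eq_zero]
      intro x hx
      rw [hker] at hx
      simpa using hx
    have eq : ∀ i, ∃ a : A i ≃ₗ[F] E i, ∀ x, a x = π i x := fun i =>
      ⟨LinearEquiv.ofBijective (π i) ⟨hinj i, hsurj i⟩, fun _ => rfl⟩
    choose a ha using eq
    rw [List.length_nil, add_zero, ← hk k]
    exact (hrank_of_ker_eq_bot _ _ _ _ (a _) (a _) (a _) (fun x => by rw [ha, ha, hcomm])
      (fun x => by rw [ha, ha, hcomm])).symm
  | r :: rs, A, _, _, _, _, d, hdd, j, h0, hk, hreg, hs, E, _, _, e, π, hsurj, hcomm, hker, k => by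
    obtain ⟨s, hs0, hs1⟩ := hs r (by simp)
    have hr : ∀ i, IsSMulRegular (A i) r := fun i =>
      ((RingTheory.Sequence.isWeaklyRegular_cons_iff (A i) r rs).1 (hreg i)).1
    have hr' : ∀ i, RingTheory.Sequence.IsWeaklyRegular (QuotSMulTop r (A i)) rs := fun i =>
      ((RingTheory.Sequence.isWeaklyRegular_cons_iff (A i) r rs).1 (hreg i)).2
    -- The zero module in degree -1 lets the step lemma cover the bottom of the complex.
    have hp0 : IsSMulRegular PUnit.{u+1} r := fun _ _ _ => rfl
    have h0' : hrank F (range (d 0)) (ker (0 : A 0 →ₗ[R] PUnit.{u+1})) = 1 := by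
      rw [LinearMap.ker_zero]; exact h0
    have hle : ∀ i, (r • (⊤ : Submodule R (A i))).restrictScalars F ≤ ker (π i) := by
      intro i x hx
      rw [LinearMap.mem_ker, hker, Ideal.ofList_cons_smul]
      exact Submodule.mem_sup_left hx
    have key := hrank_quotient rs (fun i => QuotSMulTop r (A i))
      (fun i => QuotSMulTop.map r (d i))
      (fun i x => by
        obtain ⟨x, rfl⟩ := Submodule.Quotient.mk_surjective _ x
        rw [QuotSMulTop.map_apply_mk, QuotSMulTop.map_apply_mk, hdd, Submodule.Quotient.mk_zero])
      (j + 1)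
      (by
        have := hrank_quotSMulTop (F := F) r (d 0) (0 : A 0 →ₗ[R] PUnit.{u+1})
          (0 : PUnit.{u+1} →ₗ[R] PUnit.{u+1}) (fun _ => rfl) (fun _ => rfl) (s 0) 0 0
          (by simpa using hs0) (fun _ => rfl) hp0 hp0
        rw [h0'] at this
        rw [map_zero, LinearMap.ker_zero] at this
        rw [this]
        have : hrank F (range (0 : A 0 →ₗ[R] PUnit.{u+1}))
            (ker (0 : PUnit.{u+1} →ₗ[R] PUnit.{u+1})) = 0 := by
          rw [hrank]
          have : Subsingleton (PUnit.{u+1} ⧸ range (0 : A 0 →ₗ[R] PUnit.{u+1})) :=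
            (Submodule.mkQ_surjective _).subsingleton
          exact rank_subsingleton' _ _
        rw [this, add_zero])
      (fun k => by
        cases k with
        | zero =>
          rw [hrank_quotSMulTop (F := F) r (d 1) (d 0) (0 : A 0 →ₗ[R] PUnit.{u+1})
            (fun x => hdd 0 x) (fun _ => rfl) (s 1) (s 0) 0 (hs1 0) (by simpa using hs0)
            (hr 0) hp0, h0', hk 0]
          norm_num
        | succ k =>
          rw [hrank_quotSMulTop (F := F) r (d (k + 2)) (d (k + 1)) (d k)
            (hdd (k + 1)) (hdd k) (s (k + 2)) (s (k + 1)) (s k) (hs1 (k + 1)) (hs1 k)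
            (hr _) (hr _), hk, hk, Nat.choose_succ_succ' j (k + 1)]
          push_cast
          rw [add_comm])
      hr'
      (fun r' hr' => by
        obtain ⟨t, ht0, ht1⟩ := hs r' (by simp [hr'])
        refine ⟨fun i => QuotSMulTop.map r (t i), fun x => ?_, fun i x => ?_⟩
        · obtain ⟨x, rfl⟩ := Submodule.Quotient.mk_surjective _ x
          rw [QuotSMulTop.map_apply_mk, QuotSMulTop.map_apply_mk, ht0, Submodule.Quotient.mk_smul]
        · obtain ⟨x, rfl⟩ := Submodule.Quotient.mk_surjective _ x
          rw [QuotSMulTop.map_apply_mk, QuotSMulTop.map_apply_mk, QuotSMulTop.map_apply_mk,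
            QuotSMulTop.map_apply_mk, ← Submodule.Quotient.mk_add, ht1,
            Submodule.Quotient.mk_smul])
      E e
      (fun i => ((r • (⊤ : Submodule R (A i))).restrictScalars F).liftQ (π i) (hle i))
      (fun i y => by
        obtain ⟨x, rfl⟩ := hsurj i y
        exact ⟨Submodule.Quotient.mk x, rfl⟩)
      (fun i x => by
        obtain ⟨x, rfl⟩ := Submodule.Quotient.mk_surjective _ x
        exact hcomm i x)
      (fun i x => by
        obtain ⟨x, rfl⟩ := Submodule.Quotient.mk_surjective _ x
        change π i x = 0 ↔ _
        have h1 : (Ideal.ofList rs • ⊤ : Submodule R (QuotSMulTop r (A i))) =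
            (Ideal.ofList rs • (⊤ : Submodule R (A i))).map (r • (⊤ : Submodule R (A i))).mkQ := by
          rw [Submodule.map_smul'', Submodule.map_top, Submodule.range_mkQ]
        rw [hker, Ideal.ofList_cons_smul, h1, ← Submodule.mkQ_apply, ← Submodule.mem_comap,
          Submodule.comap_map_mkQ])
      k
    rw [key, List.length_cons]
    congr 2
    omega

end NullHomotopic

end

noncomputable section

/-! ### The group algebra of a free abelian group -/

namespace GroupAlgebra

variable (F : Type*) [Field F] (m : ℕ)

/-- The Laurent polynomial algebra, as the group algebra of `ℤᵐ`. -/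
abbrev Laurent : Type _ := AddMonoidAlgebra F (Fin m → ℤ)

variable {F m}

/-- The monomials. -/
abbrev T (g : Fin m → ℤ) : Laurent F m := AddMonoidAlgebra.single g 1

lemma T_add (a b : Fin m → ℤ) : (T (a + b) : Laurent F m) = T a * T b := by
  rw [AddMonoidAlgebra.single_mul_single, one_mul]

lemma T_zero : (T 0 : Laurent F m) = 1 := rfl

variable (F m)

/-- The elements `T_i - 1`. -/
def gens : List (Laurent F m) := List.ofFn fun i : Fin m => T (Pi.single i 1) - 1

/-- The augmentation. -/
def aug : Laurent F m →ₐ[F] F := AddMonoidAlgebra.lift F F (Fin m → ℤ) 1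

variable {F m}

lemma aug_single (g : Fin m → ℤ) (a : F) : aug F m (AddMonoidAlgebra.single g a) = a := by
  simp [aug]

/-- Setting the first `i` coordinates to zero. -/
def killFirst (i : ℕ) : (Fin m → ℤ) →+ (Fin m → ℤ) where
  toFun g j := if (j : ℕ) < i then 0 else g j
  map_zero' := by ext; simp
  map_add' a b := by ext j; by_cases h : (j : ℕ) < i <;> simp [h]

lemma mem_gens_take {i : ℕ} (j : Fin m) (h : (j : ℕ) < i) :
    (T (Pi.single j 1) - 1 : Laurent F m) ∈ (gens F m).take i := by
  rw [List.mem_take_iff_getElem]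
  exact ⟨j, by simp [gens, h], by simp [gens]⟩

/-- The exponents `g` with `T g - 1` in the ideal form a subgroup, because `T (a + b) - 1 = T a * (T
b - 1) + (T a - 1)`. -/
lemma T_sub_one_mem {i : ℕ} {g : Fin m → ℤ} (hg : ∀ j : Fin m, i ≤ (j : ℕ) → g j = 0) :
    (T g - 1 : Laurent F m) ∈ Ideal.ofList ((gens F m).take i) := by
  set J := Ideal.ofList ((gens F m).take i) with hJ
  let H : AddSubgroup (Fin m → ℤ) :=
    { carrier := {g | (T g - 1 : Laurent F m) ∈ J}
      zero_mem' := by simp [T_zero]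
      add_mem' := fun {a b} ha hb => by
        have : (T (a + b) - 1 : Laurent F m) = T a * (T b - 1) + (T a - 1) := by rw [T_add]; ring
        change _ ∈ J
        rw [this]
        exact J.add_mem (J.mul_mem_left _ hb) ha
      neg_mem' := fun {a} ha => by
        have h1 : (T (-a) * T a : Laurent F m) = 1 := by rw [← T_add, neg_add_cancel, T_zero]
        have : (T (-a) - 1 : Laurent F m) = -T (-a) * (T a - 1) := by
          linear_combination h1
        change _ ∈ J
        rw [this]
        exact J.mul_mem_left _ ha }
  have hmem : ∀ j : Fin m, (Pi.single j (g j) : Fin m → ℤ) ∈ H := by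
    intro j
    rcases lt_or_ge (j : ℕ) i with h | h
    · have h1 : (Pi.single j 1 : Fin m → ℤ) ∈ H := Ideal.subset_span (mem_gens_take j h)
      have : (Pi.single j (g j) : Fin m → ℤ) = g j • Pi.single j 1 := by
        rw [← Pi.single_smul, smul_eq_mul, mul_one]
      rw [this]
      exact H.zsmul_mem h1 _
    · rw [hg j h, Pi.single_zero]; exact H.zero_mem
  have : g = ∑ j, Pi.single j (g j) := (Finset.univ_sum_single g).symm
  have h2 : g ∈ H := by rw [this]; exact H.sum_mem fun j _ => hmem j
  exact h2

lemma sub_killFirst_mem (i : ℕ) (f : Laurent F m) :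
    f - AddMonoidAlgebra.mapDomainRingHom F (killFirst i) f ∈
      Ideal.ofList ((gens F m).take i) := by
  induction f using AddMonoidAlgebra.induction_linear with
  | zero => simp
  | add a b ha hb => rw [map_add, add_sub_add_comm]; exact Ideal.add_mem _ ha hb
  | single g a =>
    have h1 : AddMonoidAlgebra.mapDomainRingHom F (killFirst i)
        (AddMonoidAlgebra.single g a : Laurent F m) =
        AddMonoidAlgebra.single (killFirst i g) a := by simp
    have h2 : (AddMonoidAlgebra.single g a - AddMonoidAlgebra.single (killFirst i g) a :
        Laurent F m) = AddMonoidAlgebra.single (killFirst i g) a * (T (g - killFirst i g) - 1) := by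
      rw [mul_sub, AddMonoidAlgebra.single_mul_single, add_sub_cancel, mul_one, mul_one]
    rw [h1, h2]
    refine Ideal.mul_mem_left _ _ (T_sub_one_mem fun j hj => ?_)
    simp [killFirst, not_lt.2 hj]

/-- The quotient by the first `i` generators embeds into the Laurent ring itself, hence is a domain;
this is the source of regularity. -/
lemma ker_killFirst (i : ℕ) (f : Laurent F m) :
    AddMonoidAlgebra.mapDomainRingHom F (killFirst i) f = 0 ↔
      f ∈ Ideal.ofList ((gens F m).take i) := by
  constructor
  · intro h
    have := sub_killFirst_mem i f
    rwa [h, sub_zero] at this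
  · intro h
    have : Ideal.ofList ((gens F m).take i) ≤
        RingHom.ker (AddMonoidAlgebra.mapDomainRingHom F (killFirst (m := m) i)) := by
      refine Ideal.span_le.2 fun x hx => ?_
      obtain ⟨j, hj, rfl⟩ := List.mem_take_iff_getElem.1 hx
      have hjm : j < m := by
        have := hj; simp [gens] at this; omega
      have hji : j < i := by omega
      rw [SetLike.mem_coe, RingHom.mem_ker]
      simp only [gens, List.getElem_ofFn, map_sub, map_one]
      have : killFirst i (Pi.single ⟨j, hjm⟩ 1 : Fin m → ℤ) = 0 := by
        funext k
        by_cases hk : (k : ℕ) < i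
        · simp [killFirst, hk]
        · have : k ≠ ⟨j, hjm⟩ := by rintro rfl; exact hk hji
          simp [killFirst, hk, this]
      simp [this, AddMonoidAlgebra.one_def]
    exact this h

lemma aug_eq_zero_iff (f : Laurent F m) : aug F m f = 0 ↔ f ∈ Ideal.ofList (gens F m) := by
  have h1 : (gens F m).take m = gens F m := List.take_of_length_le (by simp [gens])
  have h2 : AddMonoidAlgebra.mapDomainRingHom F (killFirst m) f =
      AddMonoidAlgebra.single 0 (aug F m f) := by
    induction f using AddMonoidAlgebra.induction_linear with
    | zero => simp
    | add a b ha hb => rw [map_add, ha, hb, map_add, AddMonoidAlgebra.single_add]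
    | single g a =>
      rw [aug_single]
      have : killFirst m g = 0 := by ext j; simp [killFirst]
      simp [this]
  rw [← h1, ← ker_killFirst, h2, AddMonoidAlgebra.single_eq_zero]

/-- `killFirst i` fixes the generator with index `i`, which is a nonzero element of a domain, so it
can be cancelled modulo the preceding generators. -/
lemma isWeaklyRegular_gens : RingTheory.Sequence.IsWeaklyRegular (Laurent F m) (gens F m) := by
  refine ⟨fun i hi => ?_⟩
  have him : i < m := by simpa [gens] using hi
  rw [isSMulRegular_quotient_iff_mem_of_smul_mem]
  intro f hf
  rw [smul_eq_mul, Ideal.mul_top, ← ker_killFirst] at hf ⊢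
  rw [smul_eq_mul, map_mul] at hf
  refine (mul_eq_zero.1 hf).resolve_left fun h => ?_
  have hk : killFirst i (Pi.single ⟨i, him⟩ 1 : Fin m → ℤ) = Pi.single ⟨i, him⟩ 1 := by
    funext k
    by_cases hk : (k : ℕ) < i
    · have : k ≠ ⟨i, him⟩ := by rintro rfl; exact lt_irrefl _ hk
      simp [killFirst, hk, this]
    · simp [killFirst, hk]
  simp only [gens, List.getElem_ofFn, map_sub, map_one] at h
  rw [AddMonoidAlgebra.mapDomainRingHom_apply, AddMonoidAlgebra.mapDomain_single, hk, sub_eq_zero,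
    AddMonoidAlgebra.one_def, AddMonoidAlgebra.single_left_inj one_ne_zero] at h
  have := congrFun h ⟨i, him⟩
  simp at this

/-- Weak regularity survives tensoring with a free, hence flat, module. -/
lemma isWeaklyRegular_finsupp (ι : Type*) :
    RingTheory.Sequence.IsWeaklyRegular (ι →₀ Laurent F m) (gens F m) :=
  ((TensorProduct.lid (Laurent F m) (ι →₀ Laurent F m)).isWeaklyRegular_congr (gens F m)).1
    isWeaklyRegular_gens.isWeaklyRegular_rTensor

lemma mapRange_aug_eq_zero_iff {ι : Type*} (z : ι →₀ Laurent F m) :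
    Finsupp.mapRange.linearMap (aug F m).toLinearMap z = 0 ↔
      z ∈ (Ideal.ofList (gens F m) • ⊤ : Submodule (Laurent F m) (ι →₀ Laurent F m)) := by
  constructor
  · intro h
    rw [← Finsupp.sum_single z]
    refine Submodule.sum_mem _ fun i _ => ?_
    have h1 : aug F m (z i) = 0 := by
      have := DFunLike.congr_fun h i
      simpa using this
    have : Finsupp.single i (z i) = z i • Finsupp.single i (1 : Laurent F m) := by simp
    rw [this]
    exact Submodule.smul_mem_smul ((aug_eq_zero_iff _).1 h1) trivial
  · intro h
    ext i
    refine Submodule.smul_induction_on h (fun r hr n _ => ?_) (fun x y hx hy => ?_)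
    · have := (aug_eq_zero_iff r).2 hr
      simp [this]
    · rw [map_add, Finsupp.add_apply, hx, hy]; simp

end GroupAlgebra

end

noncomputable section

/-! ### Order complexes of quotients by free abelian groups -/

/-- A poset `Q` with an action of `G` whose orbit poset is `P`, such that every element has at most
one translate above a given element. The map `sec` chooses representatives of the orbits. -/
structure PosetCover (G P Q : Type*) [AddCommGroup G] [PartialOrder P] [PartialOrder Q] where
  act : G → Q → Q
  act_add : ∀ a b q, act (a + b) q = act a (act b q)
  act_zero : ∀ q, act 0 q = q
  act_mono : ∀ a q q', q ≤ q' → act a q ≤ act a q'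
  sec : P → Q
  exists_eq : ∀ q, ∃ a p, q = act a (sec p)
  le_iff : ∀ p p', p ≤ p' ↔ ∃ a, sec p ≤ act a (sec p')
  uniq : ∀ p p' a b, sec p ≤ act a (sec p') → sec p ≤ act b (sec p') → a = b

namespace PosetCover

open ListComplex GroupAlgebra Finsupp SimplicialPoset

section Basic

variable {G P Q : Type*} [AddCommGroup G] [PartialOrder P] [PartialOrder Q] (C : PosetCover G P Q)

lemma act_le_act_iff (a b : G) (q q' : Q) : C.act a q ≤ C.act b q' ↔ q ≤ C.act (b - a) q' := by
  constructor
  · intro h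
    have := C.act_mono (-a) _ _ h
    rwa [← C.act_add, ← C.act_add, neg_add_cancel, C.act_zero, neg_add_eq_sub] at this
  · intro h
    have := C.act_mono a _ _ h
    rwa [← C.act_add, add_sub_cancel] at this

/-- The translation taking the representative of `p'` above that of `p`. -/
def shift (p p' : P) : G := open Classical in if h : p ≤ p' then ((C.le_iff p p').1 h).choose else 0

lemma le_shift {p p' : P} (h : p ≤ p') : C.sec p ≤ C.act (C.shift p p') (C.sec p') := by
  rw [shift, dif_pos h]; exact ((C.le_iff p p').1 h).choose_spec

lemma shift_eq {p p' : P} {a : G} (h : C.sec p ≤ C.act a (C.sec p')) : C.shift p p' = a :=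
  C.uniq _ _ _ _ (C.le_shift ((C.le_iff _ _).2 ⟨a, h⟩)) h

lemma shift_self (p : P) : C.shift p p = 0 := C.shift_eq (by rw [C.act_zero])

/-- Shifts form a cocycle: the composed translation also places `p''` above `p`, and by `uniq` only
one translation does. -/
lemma shift_add {p p' p'' : P} (h : p ≤ p') (h' : p' ≤ p'') :
    C.shift p p' + C.shift p' p'' = C.shift p p'' := by
  refine (C.shift_eq ?_).symm
  rw [C.act_add]
  exact (C.le_shift h).trans (C.act_mono _ _ _ (C.le_shift h'))

lemma le_of_act_le {p p' : P} {a b : G} (h : C.act a (C.sec p) ≤ C.act b (C.sec p')) : p ≤ p' :=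
  (C.le_iff _ _).2 ⟨_, (C.act_le_act_iff _ _ _ _).1 h⟩

lemma act_injective {p p' : P} {a b : G} (h : C.act a (C.sec p) = C.act b (C.sec p')) :
    a = b ∧ p = p' := by
  obtain rfl : p = p' := le_antisymm (C.le_of_act_le h.le) (C.le_of_act_le h.ge)
  refine ⟨?_, rfl⟩
  have h1 := C.shift_eq ((C.act_le_act_iff _ _ _ _).1 h.le)
  rw [C.shift_self] at h1
  exact (sub_eq_zero.1 h1.symm).symm

/-- By `uniq`, an element is never strictly below a translate of itself. Hence strict chains
upstairs project to strict chains. -/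
lemma lt_of_act_lt {p p' : P} {a b : G} (h : C.act a (C.sec p) < C.act b (C.sec p')) : p < p' := by
  refine lt_of_le_of_ne (C.le_of_act_le h.le) ?_
  rintro rfl
  have h1 := C.shift_eq ((C.act_le_act_iff _ _ _ _).1 h.le)
  rw [C.shift_self] at h1
  rw [(sub_eq_zero.1 h1.symm)] at h
  exact lt_irrefl _ h

/-- The lift of a chain of `P` starting in the given translate of the chosen representative. -/
def liftList {i : ℕ} (x : (Fin (i + 1) ↪o P) × G) : List Q :=
  List.ofFn fun j => C.act (x.2 + C.shift (x.1 0) (x.1 j)) (C.sec (x.1 j))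

lemma liftList_injective {i : ℕ} : Function.Injective (C.liftList (i := i)) := by
  rintro ⟨c, a⟩ ⟨c', a'⟩ h
  have h1 := List.ofFn_injective h
  have h2 : ∀ j, _ := fun j => C.act_injective (congrFun h1 j)
  have hc : c = c' := by ext j; exact (h2 j).2
  subst hc
  have := (h2 0).1
  simp only [C.shift_self, add_zero] at this
  rw [this]

lemma liftList_mem {i : ℕ} (x : (Fin (i + 1) ↪o P) × G) : C.liftList x ∈ strict Q := by
  obtain ⟨c, a⟩ := x
  refine List.pairwise_ofFn.2 fun j k hjk => lt_of_le_of_ne ?_ fun h => ?_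
  · rw [C.act_le_act_iff]
    have h1 : c 0 ≤ c j := c.monotone (Fin.zero_le _)
    have h2 : c j ≤ c k := c.monotone hjk.le
    have : a + C.shift (c 0) (c k) - (a + C.shift (c 0) (c j)) = C.shift (c j) (c k) := by
      rw [← C.shift_add h1 h2]; abel
    rw [this]
    exact C.le_shift h2
  · exact hjk.ne (c.injective (C.act_injective h).2)

lemma exists_liftList {i : ℕ} {l : List Q} (hl : l ∈ strict Q) (hlen : l.length = i + 1) :
    ∃ x : (Fin (i + 1) ↪o P) × G, C.liftList x = l := by
  choose a p hap using C.exists_eq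
  have hl' : ∀ j k : Fin (i + 1), j < k →
      l[(j : ℕ)]'(by omega) < l[(k : ℕ)]'(by omega) := fun j k hjk =>
    List.pairwise_iff_getElem.1 hl _ _ _ _ hjk
  set q : Fin (i + 1) → Q := fun j => l[(j : ℕ)]'(by omega) with hq
  have hmono : StrictMono fun j => p (q j) := fun j k hjk => by
    refine C.lt_of_act_lt (a := a (q j)) (b := a (q k)) ?_
    rw [← hap, ← hap]; exact hl' j k hjk
  refine ⟨(OrderEmbedding.ofStrictMono _ hmono, a (q 0)), ?_⟩
  have : l = List.ofFn q := by
    refine List.ext_getElem (by simp [hlen]) fun j h1 h2 => by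
      rw [List.getElem_ofFn]
  rw [this, liftList]
  congr 1
  funext j
  have h1 : q 0 ≤ q j := by
    rcases (Fin.zero_le j).eq_or_lt with h | h
    · rw [h]
    · exact (hl' 0 j h).le
  have h2 : C.shift (p (q 0)) (p (q j)) = a (q j) - a (q 0) := by
    refine C.shift_eq ?_
    rw [← C.act_le_act_iff, ← hap, ← hap]
    exact h1
  change C.act (a (q 0) + C.shift (p (q 0)) (p (q j))) (C.sec (p (q j))) = q j
  rw [h2, add_sub_cancel, ← hap]

end Basic

lemma bdList_ofFn (F : Type*) [Field F] {α : Type*} : ∀ (n : ℕ) (f : Fin (n + 1) → α),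
    bdList F (List.ofFn f) =
      ∑ i : Fin (n + 1), Finsupp.single (List.ofFn fun j => f (i.succAbove j)) ((-1 : F) ^ (i : ℕ))
  | 0, f => by simp [bdList]
  | n + 1, f => by
    rw [List.ofFn_succ, bdList, bdList_ofFn F n,
      Fin.sum_univ_succ (n := n + 1), map_sum, sub_eq_add_neg, ← Finset.sum_neg_distrib]
    congr 1
    · simp
    · refine Finset.sum_congr rfl fun i _ => ?_
      rw [prep_single, ← Finsupp.single_neg]
      congr 1
      · simp [List.ofFn_succ]
      · rw [Fin.val_succ, pow_succ]; ring

variable {P Q : Type*} [PartialOrder P] [PartialOrder Q] {m : ℕ}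
  (C : PosetCover (Fin m → ℤ) P Q) (F : Type*) [Field F]

/-- Chains of `P` with coefficients in the group algebra. -/
abbrev TwChains (F : Type*) [Field F] (P : Type*) [PartialOrder P] (m i : ℕ) : Type _ :=
  (Fin (i + 1) ↪o P) →₀ Laurent F m

/-- The monomial by which a face is multiplied. -/
def twist {i : ℕ} (c : Fin (i + 2) ↪o P) (j : Fin (i + 2)) : Fin m → ℤ :=
  if j = 0 then C.shift (c 0) (c 1) else 0

/-- The boundary map of the complex of `Q`, written in terms of `P` and the group algebra. -/
def twBoundary (i : ℕ) : TwChains F P m (i + 1) →ₗ[Laurent F m] TwChains F P m i :=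
  Finsupp.linearCombination (Laurent F m) fun c : Fin (i + 2) ↪o P =>
    ∑ j : Fin (i + 2), Finsupp.single ((Fin.succAboveOrderEmb j).trans c)
      (AddMonoidAlgebra.single (C.twist c j) ((-1 : F) ^ (j : ℕ)))

/-- The identification of twisted chains of `P` with chains of `Q`. -/
def toLists (i : ℕ) : TwChains F P m i →ₗ[F] (List Q →₀ F) :=
  Finsupp.lmapDomain F F C.liftList ∘ₗ (Finsupp.curryLinearEquiv F).symm.toLinearMap ∘ₗ
    Finsupp.mapRange.linearMap (AddMonoidAlgebra.coeffLinearEquiv F).toLinearMap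

lemma toLists_single (i : ℕ) (c : Fin (i + 1) ↪o P) (a : Fin m → ℤ) (x : F) :
    C.toLists F i (single c (AddMonoidAlgebra.single a x)) = single (C.liftList (c, a)) x := by
  simp [toLists, Finsupp.curryLinearEquiv]

lemma toLists_injective (i : ℕ) : Function.Injective (C.toLists F i) := by
  refine (Finsupp.mapDomain_injective C.liftList_injective).comp
    ((Finsupp.curryLinearEquiv F).symm.injective.comp ?_)
  exact Finsupp.mapRange_injective _ (map_zero _) (AddMonoidAlgebra.coeffLinearEquiv F).injective

lemma twChains_induction {i : ℕ} {p : TwChains F P m i → Prop} (z : TwChains F P m i)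
    (h0 : p 0) (hadd : ∀ x y, p x → p y → p (x + y))
    (hs : ∀ c a x, p (single c (AddMonoidAlgebra.single a x))) : p z := by
  induction z using Finsupp.induction_linear with
  | zero => exact h0
  | add x y hx hy => exact hadd x y hx hy
  | single c r =>
    induction r using AddMonoidAlgebra.induction_linear with
    | zero => simpa using h0
    | add x y hx hy => rw [Finsupp.single_add]; exact hadd _ _ hx hy
    | single a x => exact hs c a x

lemma twBoundary_single (i : ℕ) (c : Fin (i + 2) ↪o P) (a : Fin m → ℤ) (x : F) :
    C.twBoundary F i (single c (AddMonoidAlgebra.single a x)) =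
      ∑ j : Fin (i + 2), Finsupp.single ((Fin.succAboveOrderEmb j).trans c)
        (AddMonoidAlgebra.single (a + C.twist c j) (x * (-1 : F) ^ (j : ℕ))) := by
  simp [twBoundary, Finset.smul_sum, AddMonoidAlgebra.single_mul_single]

/-- A lifted chain is recorded by the translate of its first entry. Only the face omitting that
entry changes the base, by `shift (c 0) (c 1)`, which is why `twist` vanishes on all other faces. -/
lemma bd_toLists (i : ℕ) (z : TwChains F P m (i + 1)) :
    bd F (C.toLists F (i + 1) z) = C.toLists F i (C.twBoundary F i z) := by
  induction z using twChains_induction with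
  | h0 => simp
  | hadd x y hx hy => simp only [map_add, hx, hy]
  | hs c a x =>
    rw [toLists_single, bd_single, twBoundary_single, map_sum, liftList, bdList_ofFn,
      Finset.smul_sum]
    refine Finset.sum_congr rfl fun j _ => ?_
    rw [toLists_single, Finsupp.smul_single, smul_eq_mul]
    congr 1
    rw [liftList]
    congr 1
    funext k
    have h0 : ((Fin.succAboveOrderEmb j).trans c) 0 = c (j.succAbove 0) := rfl
    have hk : ((Fin.succAboveOrderEmb j).trans c) k = c (j.succAbove k) := rfl
    simp only [h0, hk, twist]
    by_cases hj : j = 0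
    · subst hj
      rw [if_pos rfl, add_assoc a]
      have h1 : c (Fin.succAbove 0 0) = c 1 := by rw [Fin.zero_succAbove, Fin.succ_zero_eq_one]
      have h2 : c 1 ≤ c (Fin.succAbove 0 k) := by
        rw [← h1]; exact c.monotone (Fin.succAbove_le_succAbove_iff.2 (Fin.zero_le _))
      rw [h1, C.shift_add (c.monotone (Fin.zero_le _)) h2]
    · rw [if_neg hj, add_zero, Fin.succAbove_ne_zero_zero hj]

/-- Reduction of the coefficients. -/
def reduce (m i : ℕ) : TwChains F P m i →ₗ[F] Chains F P (i + 1) :=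
  Finsupp.mapRange.linearMap (aug F m).toLinearMap

lemma reduce_single (i : ℕ) (c : Fin (i + 1) ↪o P) (a : Fin m → ℤ) (x : F) :
    reduce F m i (single c (AddMonoidAlgebra.single a x)) = single c x := by
  simp [reduce, aug_single]

lemma reduce_twBoundary (i : ℕ) (z : TwChains F P m (i + 1)) :
    reduce F m i (C.twBoundary F i z) = boundary F P (i + 1) (reduce F m (i + 1) z) := by
  induction z using twChains_induction with
  | h0 => simp
  | hadd x y hx hy => simp only [map_add, hx, hy]
  | hs c a x =>
    rw [twBoundary_single, map_sum, reduce_single, boundary, Finsupp.linearCombination_single,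
      Finset.smul_sum]
    exact Finset.sum_congr rfl fun j _ => by rw [reduce_single, Finsupp.smul_single, smul_eq_mul]

/-- In the lowest degree the boundary is the augmentation, which forgets translations and so factors
through `reduce`. -/
lemma bd_toLists_zero (z : TwChains F P m 0) :
    bd F (C.toLists F 0 z) =
      Finsupp.lmapDomain F F (fun _ => ([] : List Q)) (boundary F P 0 (reduce F m 0 z)) := by
  induction z using twChains_induction with
  | h0 => simp
  | hadd x y hx hy => simp only [map_add, hx, hy]
  | hs c a x =>
    rw [toLists_single, bd_single, reduce_single, boundary, Finsupp.linearCombination_single]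
    simp [liftList, bdList]

end PosetCover

end

/-! ### Homology of the quotient poset -/

noncomputable section

/-- A complex of projective modules that is exact in positive degrees is annihilated up to homotopy
by every ring element that annihilates its homology in degree zero. -/
lemma NullHomotopic.IsNullHomotopic.of_exact {R : Type*} [CommRing R] {A : ℕ → Type*}
    [∀ i, AddCommGroup (A i)] [∀ i, Module R (A i)] [∀ i, Module.Projective R (A i)]
    {d : ∀ i, A (i + 1) →ₗ[R] A i} (hdd : ∀ i x, d i (d (i + 1) x) = 0)
    (hex : ∀ i x, d i x = 0 → ∃ y, d (i + 1) y = x) {r : R} (h0 : ∀ x : A 0, ∃ y, d 0 y = r • x) :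
    NullHomotopic.IsNullHomotopic d r := by
  have lift : ∀ i (f : A i →ₗ[R] A i), (∀ x, ∃ y, d i y = f x) →
      ∃ s : A i →ₗ[R] A (i + 1), ∀ x, d i (s x) = f x := by
    intro i f hf
    obtain ⟨s, hs⟩ := Module.projective_lifting_property (d i).rangeRestrict
      (f.codRestrict (LinearMap.range (d i)) hf) (LinearMap.surjective_rangeRestrict _)
    exact ⟨s, fun x => congrArg Subtype.val (LinearMap.congr_fun hs x)⟩
  obtain ⟨s₀, hs₀⟩ := lift 0 (r • LinearMap.id) (by simpa using h0)
  -- The map `r • id - s d` takes values in cycles, hence in boundaries by exactness, and lifts by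
  -- projectivity. The condition on `s` is what makes these values cycles, so the recursion below
  -- carries it along.
  have step : ∀ i (s : A i →ₗ[R] A (i + 1)), (∀ x, d i (s (d i x)) = r • d i x) →
      ∃ t : A (i + 1) →ₗ[R] A (i + 2), ∀ x, d (i + 1) (t x) = r • x - s (d i x) := by
    intro i s hs
    exact lift (i + 1) (r • LinearMap.id - s ∘ₗ d i) fun x => hex i _ (by simp [hs])
  choose! t ht using step
  let S : ∀ i, {s : A i →ₗ[R] A (i + 1) // ∀ x, d i (s (d i x)) = r • d i x} := fun i =>
    Nat.rec ⟨s₀, fun x => by simp [hs₀]⟩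
      (fun i s => ⟨t i s.1, fun x => by rw [ht i s.1 s.2, hdd, map_zero, sub_zero]⟩) i
  refine ⟨fun i => (S i).1, hs₀, fun i x => ?_⟩
  have : d (i + 1) ((S (i + 1)).1 x) = r • x - (S i).1 (d i x) := ht i (S i).1 (S i).2 x
  rw [this, sub_add_cancel]

namespace PosetCover

open ListComplex GroupAlgebra Finsupp SimplicialPoset LinearMap

variable {P Q : Type*} [PartialOrder P] [PartialOrder Q] {m : ℕ}
  (C : PosetCover (Fin m → ℤ) P Q) (F : Type*) [Field F]

lemma bdList_mem_length {α : Type*} (l : List α) :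
    bdList F l ∈ supp F {l' | l'.length + 1 = l.length} := by
  induction l with
  | nil => exact Submodule.zero_mem _
  | cons x l ih =>
    refine Submodule.sub_mem _ (Finsupp.single_mem_supported _ _ (by simp))
      (map_mem_supp (fun l' hl' => ?_) ih)
    rw [prep_single]
    refine Finsupp.single_mem_supported _ _ ?_
    rw [Set.mem_ofPred_eq] at hl' ⊢
    simp [hl']

/-- Restricting a bounding chain to the lists of the relevant length. -/
lemma exists_homogeneous {α : Type*} [PartialOrder α] {k : ℕ} {z w : List α →₀ F}
    (hz : z ∈ supp F {l | l.length = k}) (hw : w ∈ supp F (strict α)) (hwz : bd F w = z) :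
    ∃ w' ∈ supp F (strict α ∩ {l | l.length = k + 1}), bd F w' = z := by
  classical
  set w₁ := w.filter (fun l => l.length = k + 1) with hw₁
  set w₂ := w.filter (fun l => ¬ l.length = k + 1) with hw₂
  have hsum : w₁ + w₂ = w := Finsupp.filter_add_filter_not w _
  have m₁ : w₁ ∈ supp F (strict α ∩ {l | l.length = k + 1}) := by
    intro l hl
    rw [hw₁] at hl
    simp only [Finsupp.support_filter, Finset.coe_filter, Set.mem_ofPred_eq] at hl
    exact ⟨hw hl.1, hl.2⟩
  have m₂ : w₂ ∈ supp F {l | ¬ l.length = k + 1} := by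
    intro l hl
    rw [hw₂] at hl
    simp only [Finsupp.support_filter, Finset.coe_filter, Set.mem_ofPred_eq] at hl
    exact hl.2
  have b₁ : bd F w₁ ∈ supp F {l | l.length = k} := map_mem_supp (fun l hl => by
    rw [bd_single, one_smul]
    refine Finsupp.supported_mono (fun l' h => ?_) (bdList_mem_length F l)
    have h2 : l.length = k + 1 := hl.2
    rw [Set.mem_ofPred_eq] at h ⊢
    omega) m₁
  have b₂ : bd F w₂ ∈ supp F {l | ¬ l.length = k} := map_mem_supp (fun l hl => by
    rw [bd_single, one_smul]
    refine Finsupp.supported_mono (fun l' h => ?_) (bdList_mem_length F l)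
    rw [Set.mem_ofPred_eq] at h hl ⊢
    omega) m₂
  refine ⟨w₁, m₁, ?_⟩
  have heq : z - bd F w₁ = bd F w₂ := by rw [← hwz, ← hsum, map_add]; abel
  have hmem : z - bd F w₁ ∈ supp F {l | l.length = k} ⊓ supp F {l | ¬ l.length = k} :=
    ⟨Submodule.sub_mem _ hz b₁, heq ▸ b₂⟩
  rw [supp, supp, ← Finsupp.supported_inter] at hmem
  have hemp : {l : List α | l.length = k} ∩ {l | ¬ l.length = k} = ∅ := by
    ext l; simp
  rw [hemp, Finsupp.supported_empty, Submodule.mem_bot, sub_eq_zero] at hmem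
  exact hmem.symm

lemma toLists_mem (i : ℕ) (z : TwChains F P m i) :
    C.toLists F i z ∈ supp F (strict Q ∩ {l | l.length = i + 1}) := by
  induction z using twChains_induction with
  | h0 => rw [map_zero]; exact Submodule.zero_mem _
  | hadd x y hx hy => rw [map_add]; exact Submodule.add_mem _ hx hy
  | hs c a x =>
    rw [toLists_single]
    exact Finsupp.single_mem_supported _ _ ⟨C.liftList_mem _, by simp [liftList]⟩

lemma exists_toLists (i : ℕ) {w : List Q →₀ F}
    (hw : w ∈ supp F (strict Q ∩ {l | l.length = i + 1})) : ∃ z, C.toLists F i z = w := by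
  have : supp F (strict Q ∩ {l | l.length = i + 1}) ≤ range (C.toLists F i) := by
    rw [supp, Finsupp.supported_eq_span_single, Submodule.span_le]
    rintro _ ⟨l, hl, rfl⟩
    obtain ⟨⟨c, a⟩, hx⟩ := C.exists_liftList hl.1 hl.2
    exact ⟨single c (AddMonoidAlgebra.single a 1), by rw [toLists_single, hx]⟩
  exact this hw

variable {F}

lemma exists_of_bd_eq_zero (hQ : Acyclic F (Set.univ : Set Q)) (i : ℕ) (z : TwChains F P m i)
    (hz : bd F (C.toLists F i z) = 0) : ∃ y, C.twBoundary F i y = z := by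
  have hm := C.toLists_mem F i z
  obtain ⟨w, hw, hwz⟩ := hQ.strict (Finsupp.supported_mono Set.inter_subset_left hm) hz
  obtain ⟨w', hw', hwz'⟩ := exists_homogeneous F
    (Finsupp.supported_mono Set.inter_subset_right hm) hw hwz
  obtain ⟨y, hy⟩ := C.exists_toLists F (i + 1) hw'
  exact ⟨y, C.toLists_injective F i (by rw [← bd_toLists, hy, hwz'])⟩

lemma exists_of_twBoundary_eq_zero (hQ : Acyclic F (Set.univ : Set Q)) (i : ℕ)
    (z : TwChains F P m (i + 1)) (hz : C.twBoundary F i z = 0) :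
    ∃ y, C.twBoundary F (i + 1) y = z :=
  C.exists_of_bd_eq_zero hQ _ z (by rw [bd_toLists, hz, map_zero])

lemma twBoundary_twBoundary (i : ℕ) (z : TwChains F P m (i + 2)) :
    C.twBoundary F i (C.twBoundary F (i + 1) z) = 0 :=
  C.toLists_injective F i (by rw [← bd_toLists, ← bd_toLists, bd_bd, map_zero])

lemma fin_zero_embedding_eq (c c' : Fin 0 ↪o P) : c = c' := by ext j; exact j.elim0

lemma bd_toLists_zero_eq_zero_iff (z : TwChains F P m 0) :
    bd F (C.toLists F 0 z) = 0 ↔ boundary F P 0 (reduce F m 0 z) = 0 := by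
  rw [bd_toLists_zero]
  constructor
  · intro h
    have hinj : Function.Injective
        (Finsupp.lmapDomain F F (fun _ : Fin 0 ↪o P => ([] : List Q))) :=
      Finsupp.mapDomain_injective fun c c' _ => fin_zero_embedding_eq c c'
    exact hinj (h.trans (map_zero _).symm)
  · intro h
    rw [h, map_zero]

/-- A section of the reduction of coefficients. -/
lemma reduce_surjective (i : ℕ) : Function.Surjective (reduce F (P := P) m i) :=
  Finsupp.mapRange_surjective _ (map_zero _) fun a =>
    ⟨AddMonoidAlgebra.single 0 a, by simp [aug_single]⟩

lemma reduce_smul (i : ℕ) (r : Laurent F m) (z : TwChains F P m i) :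
    reduce F m i (r • z) = aug F m r • reduce F m i z := by
  ext c
  simp [reduce]

lemma boundary_zero_single (c : Fin 1 ↪o P) (a : F) :
    boundary F P 0 (single c a) = single ((Fin.succAboveOrderEmb 0).trans c) a := by
  simp [boundary]

lemma range_boundary_zero [Nonempty P] : range (boundary F P 0) = ⊤ := by
  rw [eq_top_iff]
  intro z _
  induction z using Finsupp.induction_linear with
  | zero => exact Submodule.zero_mem _
  | add x y hx hy => exact Submodule.add_mem _ (hx trivial) (hy trivial)
  | single c a =>
    obtain ⟨p⟩ := ‹Nonempty P›
    let e : Fin 1 ↪o P := OrderEmbedding.ofStrictMono (fun _ => p) fun i j h =>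
      absurd h (by rw [Subsingleton.elim i j]; exact lt_irrefl _)
    exact ⟨single e a, by rw [boundary_zero_single]; congr 1; exact fin_zero_embedding_eq _ _⟩

-- The twisted complex is exact in positive degrees because `Q` is acyclic, and its degree-zero
-- homology is `F` with augmentation-trivial action. So each `T_i - 1` is null-homotopic, and
-- `hrank_quotient` passes to the reduction, which is the chain complex of `P`. The boundary indices
-- count chain elements: the homology here sits in degree `k + 1`.
include C in
theorem rank_homology [Nonempty P] (hQ : Acyclic F (Set.univ : Set Q)) (k : ℕ) :
    NullHomotopic.hrank F (range (boundary F P (k + 2))) (ker (boundary F P (k + 1))) =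
      (m.choose (k + 1) : ℕ) := by
  have hnull : ∀ r ∈ gens F m, NullHomotopic.IsNullHomotopic (C.twBoundary F) r := by
    intro r hr
    have har : aug F m r = 0 := (aug_eq_zero_iff r).2 (Ideal.subset_span hr)
    refine NullHomotopic.IsNullHomotopic.of_exact C.twBoundary_twBoundary
      (C.exists_of_twBoundary_eq_zero hQ) fun x => C.exists_of_bd_eq_zero hQ 0 _ ?_
    rw [bd_toLists_zero_eq_zero_iff, reduce_smul, har, zero_smul, map_zero]
  have h0 : NullHomotopic.hrank F (range (C.twBoundary F 0)) ⊤ = 1 := by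
    -- The augmentation: its kernel consists of the boundaries, so degree-zero homology is
    -- one-dimensional.
    set Φ : TwChains F P m 0 →ₗ[F] Chains F P 0 := boundary F P 0 ∘ₗ reduce F m 0 with hΦ
    have hker : (range (C.twBoundary F 0)).restrictScalars F = ker Φ := by
      ext z
      constructor
      · rintro ⟨y, rfl⟩
        rw [LinearMap.mem_ker, hΦ, LinearMap.comp_apply, ← bd_toLists_zero_eq_zero_iff C,
          ← bd_toLists, bd_bd]
      · intro hz
        obtain ⟨y, hy⟩ := C.exists_of_bd_eq_zero hQ 0 z ((bd_toLists_zero_eq_zero_iff C z).2 hz)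
        exact ⟨y, hy⟩
    have hsurj : Function.Surjective Φ :=
      (LinearMap.range_eq_top.1 range_boundary_zero).comp (reduce_surjective 0)
    have e1 : (TwChains F P m 0 ⧸ (range (C.twBoundary F 0)).restrictScalars F) ≃ₗ[F]
        Chains F P 0 :=
      (Submodule.quotEquivOfEq _ _ hker).trans (Φ.quotKerEquivOfSurjective hsurj)
    have : Unique (Fin 0 ↪o P) := ⟨⟨RelEmbedding.ofIsEmpty _ _⟩, fun _ => fin_zero_embedding_eq _ _⟩
    rw [NullHomotopic.hrank, Submodule.map_top, Submodule.range_mkQ]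
    have e2 : (⊤ : Submodule (Laurent F m) (TwChains F P m 0 ⧸ range (C.twBoundary F 0))) ≃ₗ[F]
        (TwChains F P m 0 ⧸ (range (C.twBoundary F 0))) := Submodule.topEquiv.restrictScalars F
    have e3 : Chains F P 0 ≃ₗ[F] F := Finsupp.uniqueLinearEquiv F F default
    have h1 := (e2.trans (e1.trans e3)).lift_rank_eq
    rw [Module.rank_self, Cardinal.lift_one, Cardinal.lift_eq_one] at h1
    exact h1
  have hk : ∀ k, NullHomotopic.hrank F (range (C.twBoundary F (k + 1))) (ker (C.twBoundary F k)) =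
      (Nat.choose 0 (k + 1) : ℕ) := by
    intro k
    rw [NullHomotopic.hrank, LinearMap.le_ker_iff_map.1, Nat.choose_zero_succ, Nat.cast_zero]
    · exact rank_subsingleton' _ _
    · rw [Submodule.ker_mkQ]
      exact fun z hz => C.exists_of_twBoundary_eq_zero hQ k z hz
  -- The induction starts at `j = 0`: before any quotient is taken there is no homology in positive
  -- degrees.
  have key := NullHomotopic.hrank_quotient (gens F m) (fun i => TwChains F P m i) (C.twBoundary F)
    C.twBoundary_twBoundary 0 h0 hk (fun i => isWeaklyRegular_finsupp _) hnull
    (fun i => Chains F P (i + 1)) (fun i => boundary F P (i + 1)) (fun i => reduce F m i)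
    reduce_surjective (C.reduce_twBoundary F) (fun i x => mapRange_aug_eq_zero_iff x) k
  rw [key, zero_add]
  simp [gens]

-- A reduced 0-cycle lifts to one of `Q`, where it bounds.
include C in
lemma ker_boundary_zero_le (hQ : Acyclic F (Set.univ : Set Q)) :
    ker (boundary F P 0) ≤ range (boundary F P 1) := by
  intro z hz
  obtain ⟨z, rfl⟩ := reduce_surjective (m := m) 0 z
  obtain ⟨y, rfl⟩ := C.exists_of_bd_eq_zero hQ 0 z ((bd_toLists_zero_eq_zero_iff C z).2 hz)
  exact ⟨_, (C.reduce_twBoundary F 0 y).symm⟩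

section Betti

variable {S : Type*} [PartialOrder S] [OrderBot S] [Nonempty (Nonbot S)]
  (D : PosetCover (Fin m → ℤ) (Nonbot S) Q)

lemma reducedBetti_zero (F : Type*) [Field F] : reducedBetti F S 0 = 0 := by
  rw [reducedBetti, LinearMap.le_ker_iff_map.1]
  · exact finrank_bot _ _
  · rw [Submodule.ker_mkQ, range_boundary_zero]; exact le_top

include D in
omit [Nonempty (Nonbot S)] in
lemma reducedBetti_one (hQ : Acyclic F (Set.univ : Set Q)) : reducedBetti F S 1 = 0 := by
  rw [reducedBetti, LinearMap.le_ker_iff_map.1]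
  · exact finrank_bot _ _
  · rw [Submodule.ker_mkQ]; exact D.ker_boundary_zero_le hQ

include D in
lemma reducedBetti_add_two (hQ : Acyclic F (Set.univ : Set Q)) (k : ℕ) :
    reducedBetti F S (k + 2) = m.choose (k + 1) := by
  have := D.rank_homology hQ k
  exact (Module.finrank_eq_of_rank_eq this)

end Betti

end PosetCover

end

noncomputable section

/-! ### Nearest lattice points -/

namespace Wonderful

variable {n : ℕ}

/-- Up to a factor, the squared distance between a point and a lattice point. -/
def energy (x : Fin n → ℝ) (y : Fin n → ℤ) : ℝ :=
  ∑ i, ∑ j, ((x i - x j) - n * ((y i : ℝ) - y j)) ^ 2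

/-- The vectors representing the nearest lattice points. -/
def near (x : Fin n → ℝ) : Set (Fin n → ℤ) := {y | ∀ z, energy x y ≤ energy x z}

lemma energy_add_intCast (x : Fin n → ℝ) (y : Fin n → ℤ) (c : ℤ) :
    energy x (y + (c : Fin n → ℤ)) = energy x y := by simp [energy]

lemma energy_add_one (x : Fin n → ℝ) (y : Fin n → ℤ) : energy x (y + 1) = energy x y := by
  simp [energy]

/-- If the two pairs are ordered alike, nothing changes. If they cross, passing to infimum and
supremum lowers the sum by 2N²|p - r||q - s|. -/
lemma energy_inf_sup_term {N a : ℝ} {p q r s : ℤ} (hN : 0 < N) :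
    (a - N * (((p ⊓ r : ℤ) : ℝ) - (q ⊓ s : ℤ))) ^ 2 + (a - N * (((p ⊔ r : ℤ) : ℝ) - (q ⊔ s : ℤ))) ^ 2
      ≤ (a - N * ((p : ℝ) - q)) ^ 2 + (a - N * ((r : ℝ) - s)) ^ 2 ∧
    (r < p → q < s →
      (a - N * (((p ⊓ r : ℤ) : ℝ) - (q ⊓ s : ℤ))) ^ 2 +
        (a - N * (((p ⊔ r : ℤ) : ℝ) - (q ⊔ s : ℤ))) ^ 2
      < (a - N * ((p : ℝ) - q)) ^ 2 + (a - N * ((r : ℝ) - s)) ^ 2) := by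
  have hN2 : 0 < N ^ 2 := by positivity
  rcases le_total p r with h1 | h1 <;> rcases le_total q s with h2 | h2
  · rw [inf_eq_left.2 h1, inf_eq_left.2 h2, sup_eq_right.2 h1, sup_eq_right.2 h2]
    exact ⟨le_rfl, fun h => absurd h h1.not_gt⟩
  · rw [inf_eq_left.2 h1, inf_eq_right.2 h2, sup_eq_right.2 h1, sup_eq_left.2 h2]
    refine ⟨?_, fun h => absurd h h1.not_gt⟩
    have h1' : (0 : ℝ) ≤ r - p := by exact_mod_cast sub_nonneg.2 h1
    have h2' : (0 : ℝ) ≤ q - s := by exact_mod_cast sub_nonneg.2 h2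
    have := mul_nonneg hN2.le (mul_nonneg h1' h2')
    nlinarith
  · rw [inf_eq_right.2 h1, inf_eq_left.2 h2, sup_eq_left.2 h1, sup_eq_right.2 h2]
    have h1' : (0 : ℝ) ≤ p - r := by exact_mod_cast sub_nonneg.2 h1
    have h2' : (0 : ℝ) ≤ s - q := by exact_mod_cast sub_nonneg.2 h2
    refine ⟨?_, fun h3 h4 => ?_⟩
    · have := mul_nonneg hN2.le (mul_nonneg h1' h2')
      nlinarith
    · have h3' : (0 : ℝ) < p - r := by exact_mod_cast sub_pos.2 h3
      have h4' : (0 : ℝ) < s - q := by exact_mod_cast sub_pos.2 h4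
      have := mul_pos hN2 (mul_pos h3' h4')
      nlinarith
  · rw [inf_eq_right.2 h1, inf_eq_right.2 h2, sup_eq_left.2 h1, sup_eq_left.2 h2]
    exact ⟨by rw [add_comm], fun _ h => absurd h h2.not_gt⟩

/-- Uncrossing: for incomparable minimizers, the infimum and supremum would have strictly smaller
total energy. -/
lemma le_total_of_mem_near [NeZero n] {x : Fin n → ℝ} {y z : Fin n → ℤ} (hy : y ∈ near x)
    (hz : z ∈ near x) : y ≤ z ∨ z ≤ y := by
  by_contra! h
  obtain ⟨h1, h2⟩ := h
  simp only [Pi.le_def, not_forall, not_le] at h1 h2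
  obtain ⟨i, hi⟩ := h1
  obtain ⟨j, hj⟩ := h2
  have hn : (0 : ℝ) < n := by exact_mod_cast NeZero.pos n
  have hlt : energy x (y ⊓ z) + energy x (y ⊔ z) < energy x y + energy x z := by
    simp only [energy, ← Finset.sum_add_distrib]
    refine Finset.sum_lt_sum (fun k _ => Finset.sum_le_sum fun l _ =>
      (energy_inf_sup_term hn).1) ⟨i, Finset.mem_univ _, ?_⟩
    exact Finset.sum_lt_sum (fun l _ => (energy_inf_sup_term hn).1)
      ⟨j, Finset.mem_univ _, (energy_inf_sup_term hn).2 hi hj⟩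
  linarith [hy (y ⊓ z), hz (y ⊔ z)]

lemma isPeriodicChain_near [NeZero n] {x : Fin n → ℝ} (h : (near x).Nonempty) :
    IsPeriodicChain (near x) :=
  ⟨h, fun _ hy _ hz _ => le_total_of_mem_near hy hz, fun m => by simp [near, energy_add_one]⟩

/-! ### Every periodic chain is a set of nearest lattice points -/

/-- The differences of two coordinates along a periodic chain. -/
def diffs (M : Set (Fin n → ℤ)) (i j : Fin n) : Set ℤ := (fun m => m i - m j) '' M

/-- Otherwise the translate of `m` by `m' j - m j - 1` would be below `m'` at `j` and above it at
`i`, hence incomparable with it. -/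
lemma IsPeriodicChain.sub_le_one {M : Set (Fin n → ℤ)} (hM : IsPeriodicChain M)
    {m m' : Fin n → ℤ} (hm : m ∈ M) (hm' : m' ∈ M) (i j : Fin n) :
    m i - m j ≤ m' i - m' j + 1 := by
  by_contra! h
  set c := m' j - m j with hc
  have h1 : m + ((c : ℤ) : Fin n → ℤ) ∈ M := (hM.mem_add _ _).2 hm
  have h2 : m + ((c - 1 : ℤ) : Fin n → ℤ) ∈ M := (hM.mem_add _ _).2 hm
  rcases hM.le_total h2 hm' with h3 | h3
  · have := h3 i; simp at this; omega
  · have := h3 j; simp at this; omega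

/-- The minimal difference of two coordinates. -/
def lo (M : Set (Fin n → ℤ)) (i j : Fin n) : ℤ := sInf (diffs M i j)

/-- The maximal difference of two coordinates. -/
def hi (M : Set (Fin n → ℤ)) (i j : Fin n) : ℤ := sSup (diffs M i j)

section
variable {M : Set (Fin n → ℤ)} (hM : IsPeriodicChain M)
include hM

lemma diffs_nonempty (i j : Fin n) : (diffs M i j).Nonempty := hM.1.image _

lemma bddBelow_diffs (i j : Fin n) : BddBelow (diffs M i j) := by
  obtain ⟨m, hm⟩ := hM.1
  refine ⟨m i - m j - 1, ?_⟩
  rintro _ ⟨m', hm', rfl⟩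
  have := hM.sub_le_one hm hm' i j
  dsimp only; omega

lemma bddAbove_diffs (i j : Fin n) : BddAbove (diffs M i j) := by
  obtain ⟨m, hm⟩ := hM.1
  refine ⟨m i - m j + 1, ?_⟩
  rintro _ ⟨m', hm', rfl⟩
  exact hM.sub_le_one hm' hm i j

lemma lo_le {m : Fin n → ℤ} (hm : m ∈ M) (i j : Fin n) : lo M i j ≤ m i - m j :=
  csInf_le (bddBelow_diffs hM i j) ⟨m, hm, rfl⟩

lemma le_hi {m : Fin n → ℤ} (hm : m ∈ M) (i j : Fin n) : m i - m j ≤ hi M i j :=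
  le_csSup (bddAbove_diffs hM i j) ⟨m, hm, rfl⟩

lemma exists_lo (i j : Fin n) : ∃ m ∈ M, m i - m j = lo M i j :=
  Int.csInf_mem (diffs_nonempty hM i j) (bddBelow_diffs hM i j)

lemma exists_hi (i j : Fin n) : ∃ m ∈ M, m i - m j = hi M i j :=
  Int.csSup_mem (diffs_nonempty hM i j) (bddAbove_diffs hM i j)

lemma hi_le_lo_add_one (i j : Fin n) : hi M i j ≤ lo M i j + 1 := by
  obtain ⟨m, hm, h⟩ := exists_lo hM i j
  obtain ⟨m', hm', h'⟩ := exists_hi hM i j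
  rw [← h, ← h']
  exact hM.sub_le_one hm' hm i j

lemma lo_le_hi (i j : Fin n) : lo M i j ≤ hi M i j := by
  obtain ⟨m, hm⟩ := hM.1
  exact (lo_le hM hm i j).trans (le_hi hM hm i j)

lemma lo_swap (i j : Fin n) : lo M i j = -hi M j i := by
  obtain ⟨m, hm, h⟩ := exists_lo hM i j
  obtain ⟨m', hm', h'⟩ := exists_hi hM j i
  have h1 := le_hi hM hm j i
  have h2 := lo_le hM hm' i j
  omega

/-- A periodic chain is determined by the extremal differences of coordinates. -/
lemma mem_iff_lo_hi [NeZero n] (y : Fin n → ℤ) :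
    y ∈ M ↔ ∀ i j, lo M i j ≤ y i - y j ∧ y i - y j ≤ hi M i j := by
  refine ⟨fun hy i j => ⟨lo_le hM hy i j, le_hi hM hy i j⟩, fun h => ?_⟩
  have hsum : ∀ {m m' : Fin n → ℤ}, m ≤ m' → ∑ i, m i ≤ ∑ i, m' i := fun h =>
    Finset.sum_le_sum fun i _ => h i
  -- the largest element of the chain below `y`
  obtain ⟨m, ⟨hm, hmy⟩, hmax⟩ : ∃ m, (m ∈ M ∧ m ≤ y) ∧
      ∀ m', m' ∈ M ∧ m' ≤ y → ∑ i, m' i ≤ ∑ i, m i := by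
    have hne : ∃ m, m ∈ M ∧ m ≤ y := by
      obtain ⟨m, hm⟩ := hM.1
      obtain ⟨c, hc⟩ := (Set.finite_range (fun i => y i - m i)).bddBelow
      refine ⟨m + ((c : ℤ) : Fin n → ℤ), (hM.mem_add _ _).2 hm, fun i => ?_⟩
      have : c ≤ y i - m i := hc ⟨i, rfl⟩
      simp; omega
    have hS : (Set.image (fun m : Fin n → ℤ => ∑ i, m i) {m | m ∈ M ∧ m ≤ y}).Nonempty :=
      Set.Nonempty.image _ hne
    have hB : BddAbove (Set.image (fun m : Fin n → ℤ => ∑ i, m i) {m | m ∈ M ∧ m ≤ y}) := by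
      refine ⟨∑ i, y i, ?_⟩
      rintro _ ⟨m, hm, rfl⟩
      exact hsum hm.2
    obtain ⟨m, hm, h1⟩ := Int.csSup_mem hS hB
    exact ⟨m, hm, fun m' hm' => by
      have := le_csSup hB ⟨m', hm', rfl⟩
      dsimp only at h1 this
      rw [h1]; exact this⟩
  -- its successor
  obtain ⟨m', ⟨hm', hlt⟩, hmin⟩ : ∃ m', (m' ∈ M ∧ m < m') ∧
      ∀ m'', m'' ∈ M ∧ m < m'' → ∑ i, m' i ≤ ∑ i, m'' i := by
    have hne : ∃ m', m' ∈ M ∧ m < m' := ⟨m + 1, (hM.2.2 m).2 hm,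
      lt_of_le_of_ne (fun i => by simp) fun h => by
        have := congrFun h 0
        simp at this⟩
    have hS : (Set.image (fun m : Fin n → ℤ => ∑ i, m i) {m' | m' ∈ M ∧ m < m'}).Nonempty :=
      Set.Nonempty.image _ hne
    have hB : BddBelow (Set.image (fun m : Fin n → ℤ => ∑ i, m i) {m' | m' ∈ M ∧ m < m'}) := by
      refine ⟨∑ i, m i, ?_⟩
      rintro _ ⟨m', hm', rfl⟩
      exact hsum hm'.2.le
    obtain ⟨m', hm', h1⟩ := Int.csInf_mem hS hB
    exact ⟨m', hm', fun m'' hm'' => by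
      have := csInf_le hB ⟨m'', hm'', rfl⟩
      dsimp only at h1 this
      rw [h1]; exact this⟩
  have hsumlt : ∀ {m m' : Fin n → ℤ}, m < m' → ∑ i, m i < ∑ i, m' i := fun {m m'} h => by
    obtain ⟨h1, i, hi⟩ := Pi.lt_def.1 h
    exact Finset.sum_lt_sum (fun i _ => h1 i) ⟨i, Finset.mem_univ _, hi⟩
  have hm'y : ¬ m' ≤ y := fun h => by
    have := hmax m' ⟨hm', h⟩
    have := hsumlt hlt
    omega
  rw [Pi.le_def, not_forall] at hm'y
  obtain ⟨i, hi1⟩ := hm'y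
  have hmin' : ∀ r ∈ M, m < r → m' ≤ r := by
    intro r hr hmr
    rcases hM.le_total hm' hr with h | h
    · exact h
    · rcases h.eq_or_lt with h | h
      · exact h.ge
      · have := hmin r ⟨hr, hmr⟩
        have := hsumlt h
        omega
  have hm1 : m < m + 1 := lt_of_le_of_ne (fun i => by simp) fun h => by
    have := congrFun h 0
    simp at this
  have hm'1 : m' ≤ m + 1 := hmin' _ ((hM.2.2 m).2 hm) hm1
  by_cases hym : y = m
  · rw [hym]; exact hm
  exfalso
  obtain ⟨j, hj⟩ : ∃ j, m j < y j := by
    obtain ⟨_, j, hj⟩ := Pi.lt_def.1 (lt_of_le_of_ne hmy (Ne.symm hym))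
    exact ⟨j, hj⟩
  -- Since `y i = m i` and `y j > m j`, the difference `y j - y i` exceeds `m j - m i`. A member
  -- attaining `hi M j i`, translated to have `i`-th coordinate `m i + 1`, must lie below `m + 1`,
  -- so its difference is at most `m j - m i`: a contradiction.
  obtain ⟨r, hr, hrhi⟩ := exists_hi hM j i
  have h1 := (h j i).2
  rw [← hrhi] at h1
  -- translate `r` into the interval between `m'` and `m + 1`
  set c := m i + 1 - r i with hc
  have hr1 : r + (c : Fin n → ℤ) ∈ M := (hM.mem_add _ _).2 hr
  have hm'i : m' i = m i + 1 := by
    have h2 : m' i ≤ m i + 1 := hm'1 i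
    have h3 : m i ≤ y i := hmy i
    omega
  have hr2 : r + (c : Fin n → ℤ) ≤ m + 1 := by
    rcases hM.le_total hr1 ((hM.2.2 m).2 hm) with h | h
    · exact h
    · by_contra hne
      have h2 : r + ((c - 1 : ℤ) : Fin n → ℤ) ∈ M := (hM.mem_add _ _).2 hr
      have h3 : m < r + ((c - 1 : ℤ) : Fin n → ℤ) := by
        refine lt_of_le_of_ne (fun k => ?_) fun h4 => hne fun k => ?_
        · have := h k; simp at this ⊢; omega
        · have := congrFun h4 k; simp at this ⊢; omega
      have h4 := hmin' _ h2 h3 i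
      simp at h4; omega
  have h2 : r j + c ≤ m j + 1 := hr2 j
  have h3 : m i ≤ y i := hmy i
  omega
end

end Wonderful

end

/-! ### Linear dependence of the energy on the point -/

noncomputable section

namespace Wonderful

variable {n : ℕ}

/-- The part of the energy that depends linearly on the point. -/
def lin (y : Fin n → ℤ) : (Fin n → ℝ) →ₗ[ℝ] ℝ :=
  ∑ i, ∑ j, (2 * n * ((y i : ℝ) - y j)) • ((LinearMap.proj i : (Fin n → ℝ) →ₗ[ℝ] ℝ) - LinearMap.proj j)

lemma lin_apply (y : Fin n → ℤ) (x : Fin n → ℝ) :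
    lin y x = ∑ i, ∑ j, 2 * n * ((y i : ℝ) - y j) * (x i - x j) := by
  simp [lin]

lemma energy_eq (x : Fin n → ℝ) (y : Fin n → ℤ) :
    energy x y = ∑ i, ∑ j, (x i - x j) ^ 2 - lin y x +
      ∑ i, ∑ j, ((n : ℝ) * ((y i : ℝ) - y j)) ^ 2 := by
  rw [lin_apply, ← Finset.sum_sub_distrib, ← Finset.sum_add_distrib, energy]
  refine Finset.sum_congr rfl fun i _ => ?_
  rw [← Finset.sum_sub_distrib, ← Finset.sum_add_distrib]
  exact Finset.sum_congr rfl fun j _ => by ring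

lemma energy_combo {a b : ℝ} (hab : a + b = 1) (x z : Fin n → ℝ) (y m : Fin n → ℤ) :
    energy (a • x + b • z) y - energy (a • x + b • z) m =
      a * (energy x y - energy x m) + b * (energy z y - energy z m) := by
  simp only [energy_eq, map_add, map_smul, smul_eq_mul]
  linear_combination (-(∑ i, ∑ j, ((n : ℝ) * ((y i : ℝ) - y j)) ^ 2) +
    ∑ i, ∑ j, ((n : ℝ) * ((m i : ℝ) - m j)) ^ 2) * hab

lemma mem_near_iff_of_mem {x : Fin n → ℝ} {m : Fin n → ℤ} (hm : m ∈ near x) (y : Fin n → ℤ) :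
    y ∈ near x ↔ energy x y = energy x m :=
  ⟨fun hy => le_antisymm (hy m) (hm y), fun h z => h.le.trans (hm z)⟩

/-! ### Centers of faces -/

/-- The midpoint of the range of the difference of two coordinates. -/
def mid (M : Set (Fin n → ℤ)) (i j : Fin n) : ℝ := ((lo M i j : ℝ) + hi M i j) / 2

/-- A point whose nearest lattice points are those represented by `M`. -/
def center (M : Set (Fin n → ℤ)) (i : Fin n) : ℝ := ∑ j, mid M i j

section
variable {M : Set (Fin n → ℤ)} (hM : IsPeriodicChain M)
include hM

lemma mid_swap (i j : Fin n) : mid M i j = -mid M j i := by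
  have h1 : (lo M i j : ℝ) = -hi M j i := by exact_mod_cast lo_swap hM i j
  have h2 : (lo M j i : ℝ) = -hi M i j := by exact_mod_cast lo_swap hM j i
  rw [mid, mid, h1, h2]; ring

lemma sum_center : ∑ i, center M i = 0 := by
  have h : ∑ i, center M i = -∑ i, center M i := by
    conv_lhs => simp only [center]
    rw [Finset.sum_comm, ← Finset.sum_neg_distrib]
    refine Finset.sum_congr rfl fun i _ => ?_
    rw [center, ← Finset.sum_neg_distrib]
    exact Finset.sum_congr rfl fun j _ => mid_swap hM j i
  linarith

/-- Completing the square. For a zero-sum point, pairing all coordinate differences with those of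
`y` gives 2n times the plain inner product; as `center` consists of the row sums of the
antisymmetric matrix `mid`, the linear part is the same as if each `center i - center j` were `n *
mid i j`. -/
lemma energy_center (y : Fin n → ℤ) :
    energy (center M) y = ∑ i, ∑ j, (center M i - center M j) ^ 2 -
      ∑ i, ∑ j, ((n : ℝ) * mid M i j) ^ 2 + ∑ i, ∑ j, (n * ((y i : ℝ) - y j - mid M i j)) ^ 2 := by
  have key : lin y (center M) = ∑ i, ∑ j, 2 * (n : ℝ) ^ 2 * (mid M i j * ((y i : ℝ) - y j)) := by
    have h1 : ∑ i, ∑ j, mid M i j * (y i : ℝ) = ∑ i, center M i * y i :=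
      Finset.sum_congr rfl fun i _ => by rw [center, Finset.sum_mul]
    have h2 : ∑ i, ∑ j, mid M i j * (y j : ℝ) = -∑ i, center M i * y i := by
      rw [Finset.sum_comm, ← h1, ← Finset.sum_neg_distrib]
      refine Finset.sum_congr rfl fun i _ => ?_
      rw [← Finset.sum_neg_distrib]
      exact Finset.sum_congr rfl fun j _ => by rw [mid_swap hM j i]; ring
    have h3 : ∑ i, ∑ j, ((y i : ℝ) - y j) * (center M i - center M j) =
        2 * n * ∑ i, center M i * y i := by
      have e : ∀ i j, ((y i : ℝ) - y j) * (center M i - center M j) =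
          center M i * y i - (y i : ℝ) * center M j - center M i * y j + center M j * y j :=
        fun i j => by ring
      simp only [e, Finset.sum_add_distrib, Finset.sum_sub_distrib, ← Finset.mul_sum,
        ← Finset.sum_mul, sum_center hM, Finset.sum_const, Finset.card_univ, Fintype.card_fin,
        nsmul_eq_mul]
      simp only [mul_left_comm (center M _) (n : ℝ), ← Finset.mul_sum]
      ring
    rw [lin_apply]
    simp only [mul_assoc, ← Finset.mul_sum, mul_sub (mid M _ _), Finset.sum_sub_distrib]
    rw [h1, h2, h3]; ring
  rw [energy_eq, key, sub_add, sub_add]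
  congr 1
  simp only [← Finset.sum_sub_distrib]
  exact Finset.sum_congr rfl fun i _ => Finset.sum_congr rfl fun j _ => by ring

/-- In `energy_center` every summand is minimized separately: since `hi - lo` is 0 or 1, an integer
difference is closest to `mid` exactly when it lies between `lo` and `hi`. The members of `M`
minimize all summands at once, so every minimizer does, and `mem_iff_lo_hi` identifies the
minimizers with `M`. -/
lemma near_center [NeZero n] : near (center M) = M := by
  have hn : (0 : ℝ) < n := by exact_mod_cast NeZero.pos n
  have hM1 : ∀ i j, (hi M i j = lo M i j ∨ hi M i j = lo M i j + 1) := fun i j => by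
    have := hi_le_lo_add_one hM i j
    have := lo_le_hi hM i j
    omega
  have hle : ∀ (y : Fin n → ℤ) i j, (n * (((hi M i j : ℝ) - lo M i j) / 2)) ^ 2 ≤
      (n * ((y i : ℝ) - y j - mid M i j)) ^ 2 := by
    intro y i j
    rw [mul_pow, mul_pow]
    refine mul_le_mul_of_nonneg_left ?_ (by positivity)
    rw [mid]
    rcases hM1 i j with h | h
    · rw [h]; simp; positivity
    -- The midpoint is a half-integer here; twice the deviation from it is odd.
    · have h1 : ((2 * (y i - y j - lo M i j) - 1 : ℤ) : ℝ) ^ 2 ≥ 1 := by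
        have : 0 < (2 * (y i - y j - lo M i j) - 1) ^ 2 := by
          have : 2 * (y i - y j - lo M i j) - 1 ≠ 0 := by omega
          positivity
        exact_mod_cast this
      push_cast at h1
      rw [h]; push_cast
      nlinarith
  have heq : ∀ (y : Fin n → ℤ) i j, (n * ((y i : ℝ) - y j - mid M i j)) ^ 2 =
      (n * (((hi M i j : ℝ) - lo M i j) / 2)) ^ 2 ↔ lo M i j ≤ y i - y j ∧ y i - y j ≤ hi M i j := by
    intro y i j
    rw [mul_pow, mul_pow, mul_right_inj' (by positivity), mid]
    rcases hM1 i j with h | h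
    · rw [h]
      have : ((y i : ℝ) - y j - (lo M i j + lo M i j) / 2) ^ 2 =
          (((lo M i j : ℝ) - lo M i j) / 2) ^ 2 ↔ ((y i - y j - lo M i j : ℤ) : ℝ) = 0 := by
        push_cast
        rw [sub_self, zero_div, zero_pow two_ne_zero, pow_eq_zero_iff two_ne_zero, add_self_div_two]
      rw [this, Int.cast_eq_zero]
      omega
    · rw [h, sq_eq_sq_iff_eq_or_eq_neg]
      have e1 : ((y i : ℝ) - y j - (lo M i j + ((lo M i j + 1 : ℤ) : ℝ)) / 2 =
          (((lo M i j + 1 : ℤ) : ℝ) - lo M i j) / 2) ↔ y i - y j = lo M i j + 1 := by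
        rw [← @Int.cast_inj ℝ]; push_cast
        constructor <;> intro h <;> linarith
      have e2 : ((y i : ℝ) - y j - (lo M i j + ((lo M i j + 1 : ℤ) : ℝ)) / 2 =
          -((((lo M i j + 1 : ℤ) : ℝ) - lo M i j) / 2)) ↔ y i - y j = lo M i j := by
        rw [← @Int.cast_inj ℝ]; push_cast
        constructor <;> intro h <;> linarith
      rw [e1, e2]; omega
  have hmem : ∀ y ∈ M, ∀ i j, (n * ((y i : ℝ) - y j - mid M i j)) ^ 2 =
      (n * (((hi M i j : ℝ) - lo M i j) / 2)) ^ 2 := fun y hy i j =>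
    (heq y i j).2 ((mem_iff_lo_hi hM y).1 hy i j)
  ext y
  constructor
  · intro hy
    obtain ⟨m, hm⟩ := hM.1
    have h1 := hy m
    rw [energy_center hM, energy_center hM, add_le_add_iff_left] at h1
    simp only [hmem m hm] at h1
    rw [mem_iff_lo_hi hM]
    have h2 : ∀ i ∈ Finset.univ, ∑ j, (n * (((hi M i j : ℝ) - lo M i j) / 2)) ^ 2 ≤
        ∑ j, (n * ((y i : ℝ) - y j - mid M i j)) ^ 2 := fun i _ =>
      Finset.sum_le_sum fun j _ => hle y i j
    have h3 := (Finset.sum_eq_sum_iff_of_le h2).1 (le_antisymm (Finset.sum_le_sum h2) h1)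
    intro i j
    exact (heq y i j).1 ((Finset.sum_eq_sum_iff_of_le fun j _ => hle y i j).1
      (h3 i (Finset.mem_univ _)) j (Finset.mem_univ _)).symm
  · intro hy z
    rw [energy_center hM, energy_center hM, add_le_add_iff_left]
    refine Finset.sum_le_sum fun i _ => Finset.sum_le_sum fun j _ => ?_
    rw [hmem y hy]
    exact hle z i j

end

/-! ### A local criterion -/

/-- Only the finitely many vectors between `m` and `m + 1` need testing. Uncrossing `b` with `m +
1`, which has the energy of `m`, shows that `b ⊔ (m + 1) - 1` has energy at most that of `b`; it
still lies above `m` and is closer to it. -/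
lemma mem_near_of_local [NeZero n] {x : Fin n → ℝ} {m : Fin n → ℤ}
    (h : ∀ b, m ≤ b → b ≤ m + 1 → energy x m ≤ energy x b) : m ∈ near x := by
  have hn : (0 : ℝ) < n := by exact_mod_cast NeZero.pos n
  have hsub : ∀ y z, energy x (y ⊓ z) + energy x (y ⊔ z) ≤ energy x y + energy x z := by
    intro y z
    simp only [energy, ← Finset.sum_add_distrib]
    exact Finset.sum_le_sum fun k _ => Finset.sum_le_sum fun l _ => (energy_inf_sup_term hn).1
  have key : ∀ (k : ℕ) (b : Fin n → ℤ), m ≤ b → ∑ i, (b i - m i) = k → energy x m ≤ energy x b := by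
    intro k
    induction k using Nat.strong_induction_on with
    | _ k ih =>
      intro b hb hk
      rcases eq_or_ne m b with rfl | hne
      · exact le_rfl
      obtain ⟨_, i, hi⟩ := Pi.lt_def.1 (lt_of_le_of_ne hb hne)
      have h1 := hsub b (m + 1)
      have h2 := h (b ⊓ (m + 1)) (le_inf hb fun i => by simp) inf_le_right
      rw [energy_add_one] at h1
      set b' : Fin n → ℤ := b ⊔ (m + 1) - 1 with hb'
      have h3 : energy x b' = energy x (b ⊔ (m + 1)) := by
        rw [← energy_add_one, hb', sub_add_cancel]
      have hmb' : m ≤ b' := by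
        intro j
        have : (m + 1) j ≤ (b ⊔ (m + 1)) j := le_sup_right (a := b) (b := m + 1) j
        simp [hb'] at this ⊢
      have hle : ∀ j, b' j - m j ≤ b j - m j := by
        intro j
        have : m j ≤ b j := hb j
        simp only [hb', Pi.add_apply, Pi.sup_apply, Pi.one_apply, Pi.sub_apply]
        rcases le_total (b j) (m j + 1) with h | h
        · rw [sup_eq_right.2 h]; omega
        · rw [sup_eq_left.2 h]; omega
      have hlt : b' i - m i < b i - m i := by
        simp only [hb', Pi.add_apply, Pi.sup_apply, Pi.one_apply, Pi.sub_apply]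
        rw [sup_eq_left.2 (by omega)]; omega
      have hs : ∑ j, (b' j - m j) < k := by
        rw [← hk]
        exact Finset.sum_lt_sum (fun j _ => hle j) ⟨i, Finset.mem_univ _, hlt⟩
      have h0 : 0 ≤ ∑ j, (b' j - m j) := Finset.sum_nonneg fun j _ => sub_nonneg.2 (hmb' j)
      have h4 := ih (∑ j, (b' j - m j)).toNat (by omega) b' hmb' (by omega)
      linarith
  intro z
  obtain ⟨c, hc⟩ := (Set.finite_range (fun i => z i - m i)).bddBelow
  have hle : m ≤ z + ((-c : ℤ) : Fin n → ℤ) := by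
    intro i
    have : c ≤ z i - m i := hc ⟨i, rfl⟩
    simp; omega
  have h0 : 0 ≤ ∑ i, ((z + ((-c : ℤ) : Fin n → ℤ)) i - m i) :=
    Finset.sum_nonneg fun j _ => sub_nonneg.2 (hle j)
  rw [← energy_add_intCast x z (-c)]
  exact key _ _ hle (Int.toNat_of_nonneg h0).symm

end Wonderful

end

noncomputable section

namespace Wonderful

variable {n : ℕ}

/-! ### Points of the lattice -/

/-- The lattice point `n y - (∑ y) (1, …, 1)`. -/
def pt (y : Fin n → ℤ) : E n := WithLp.toLp 2 fun i => (n : ℝ) * y i - ∑ j, (y j : ℝ)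

lemma pt_mem (y : Fin n → ℤ) : pt y ∈ latticeN n := by
  refine ⟨fun i => n * y i - ∑ j, y j, fun i => by simp [pt], ?_, fun i j => ?_⟩
  · simp [Finset.sum_sub_distrib, ← Finset.mul_sum]
  · refine (Int.emod_emod_of_dvd _ dvd_rfl).symm.trans ?_
    rw [Int.emod_emod_of_dvd _ dvd_rfl]
    refine Int.ModEq.sub ?_ rfl
    exact (Int.modEq_zero_iff_dvd.2 ⟨_, rfl⟩).trans (Int.modEq_zero_iff_dvd.2 ⟨_, rfl⟩).symm

/-- The lattice point represented by `y`, in the span of the lattice. -/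
def ptR (y : Fin n → ℤ) : NR n := ⟨pt y, Submodule.subset_span (pt_mem y)⟩

lemma mem_N_iff [NeZero n] (a : NR n) : a ∈ N n ↔ ∃ y, a = ptR y := by
  constructor
  · rintro ⟨b, hb, hb0, hbm⟩
    have hdvd : ∀ i, (n : ℤ) ∣ b i - b 0 := fun i => (hbm 0 i).dvd
    choose y hy using hdvd
    have hn : (n : ℤ) ≠ 0 := by exact_mod_cast NeZero.ne n
    -- Writing `b i = b 0 + n * y i`, the vanishing coordinate sum determines `∑ y`.
    have hs : ∑ j, y j = -b 0 := by
      have : (n : ℤ) * ∑ j, y j = n * (-b 0) := by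
        rw [Finset.mul_sum]
        simp only [← hy, Finset.sum_sub_distrib, hb0]
        simp
      exact mul_left_cancel₀ hn this
    refine ⟨y, Subtype.ext ?_⟩
    ext i
    have h1 : (a : E n) i = b i := hb i
    rw [h1]
    have h2 : (b i : ℝ) = ((n * y i - ∑ j, y j : ℤ) : ℝ) := by rw [hs, ← hy]; push_cast; ring
    rw [h2]
    simp [ptR, pt]
  · rintro ⟨y, rfl⟩
    exact pt_mem y

lemma sum_eq_zero_of_mem_NR {x : E n} (hx : x ∈ NR n) : ∑ i, x i = 0 := by
  induction hx using Submodule.span_induction with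
  | mem x h =>
    obtain ⟨a, ha, h0, _⟩ := h
    simp only [ha]
    exact_mod_cast h0
  | zero => simp
  | add x y _ _ hx hy => simp [Finset.sum_add_distrib, hx, hy]
  | smul c x _ hx => simp [← Finset.mul_sum, hx]

lemma mem_NR_of_sum_eq_zero [NeZero n] {x : E n} (hx : ∑ i, x i = 0) : x ∈ NR n := by
  have hn : (n : ℝ) ≠ 0 := by exact_mod_cast NeZero.ne n
  have : x = ∑ i, (x i / n) • pt (Pi.single i 1) := by
    ext j
    have h1 : ∀ i, pt (Pi.single i 1 : Fin n → ℤ) j = n * (if j = i then 1 else 0) - 1 := by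
      intro i
      simp only [pt, Pi.single_apply]
      split_ifs <;> simp
    simp only [WithLp.ofLp_sum, Finset.sum_apply, PiLp.smul_apply, smul_eq_mul, h1, mul_sub,
      Finset.sum_sub_distrib, mul_one, ← Finset.sum_div, hx, zero_div, sub_zero, mul_ite, mul_zero,
      Finset.sum_ite_eq, Finset.mem_univ, if_true]
    field_simp
  rw [this]
  exact Submodule.sum_mem _ fun i _ => Submodule.smul_mem _ _ (Submodule.subset_span (pt_mem _))

/-- The coordinates of a point. -/
abbrev coord (x : NR n) : Fin n → ℝ := (x : E n).ofLp

/-- For a vector with zero coordinate sum, the squared differences of all ordered pairs of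
coordinates add up to 2n times the squared norm. -/
lemma two_mul_dist_sq (x : NR n) (y : Fin n → ℤ) :
    2 * n * dist x (ptR y) ^ 2 = energy (coord x) y := by
  set v : E n := (x : E n) - pt y with hv
  have hv0 : ∑ i, v i = 0 :=
    sum_eq_zero_of_mem_NR (Submodule.sub_mem _ x.2 (ptR y).2)
  have h1 : dist x (ptR y) ^ 2 = ∑ i, v i ^ 2 := by
    rw [Subtype.dist_eq, dist_eq_norm, EuclideanSpace.real_norm_sq_eq]
    rfl
  have h2 : ∀ i j, ((coord x i - coord x j) - n * ((y i : ℝ) - y j)) ^ 2 =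
      v i ^ 2 + v j ^ 2 - 2 * v i * v j := by
    intro i j
    have : ∀ k, v k = coord x k - (n * y k - ∑ l, (y l : ℝ)) := fun k => rfl
    rw [this, this]; ring
  rw [energy, h1]
  simp only [h2, Finset.sum_add_distrib, Finset.sum_sub_distrib, ← Finset.mul_sum, hv0,
    Finset.sum_const, Finset.card_univ, Fintype.card_fin, nsmul_eq_mul, mul_zero]
  ring

lemma mem_voronoiCell_iff [NeZero n] (x : NR n) (y : Fin n → ℤ) :
    x ∈ voronoiCell n (ptR y) ↔ y ∈ near (coord x) := by
  have hn : (0 : ℝ) < 2 * n := by have := NeZero.pos n; positivity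
  have h : ∀ z, dist x (ptR y) ≤ dist x (ptR z) ↔ energy (coord x) y ≤ energy (coord x) z := by
    intro z
    rw [← two_mul_dist_sq, ← two_mul_dist_sq, mul_le_mul_iff_right₀ hn,
      sq_le_sq₀ dist_nonneg dist_nonneg]
  constructor
  · intro hx z
    exact (h z).1 (hx _ ((mem_N_iff _).2 ⟨z, rfl⟩))
  · intro hx b hb
    obtain ⟨z, rfl⟩ := (mem_N_iff _).1 hb
    exact (h z).2 (hx z)

/-! ### Faces -/

/-- The points whose nearest lattice points include those represented by `M`. -/
def face (M : Set (Fin n → ℤ)) : Set (NR n) := {x | M ⊆ near (coord x)}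

/-- The center of a face, as a point of the span of the lattice. -/
def centerR [NeZero n] (M : PeriodicChain n) : NR n :=
  ⟨WithLp.toLp 2 (center M.1), mem_NR_of_sum_eq_zero (sum_center M.2)⟩

lemma near_centerR [NeZero n] (M : PeriodicChain n) : near (coord (centerR M)) = M.1 :=
  near_center M.2

lemma centerR_mem_face [NeZero n] (M : PeriodicChain n) : centerR M ∈ face M.1 :=
  (near_centerR M).ge

/-- The representatives modulo `(1, …, 1)` of a periodic chain. -/
def verts (M : Set (Fin n → ℤ)) : Set (Fin n → ℤ) := {m ∈ M | 0 ≤ ∑ i, m i ∧ ∑ i, m i < n}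

lemma sum_add_intCast (m : Fin n → ℤ) (c : ℤ) :
    ∑ i, (m + (c : Fin n → ℤ)) i = ∑ i, m i + n * c := by
  simp [Finset.sum_add_distrib]

lemma IsPeriodicChain.eq_of_sum_eq {M : Set (Fin n → ℤ)} (hM : IsPeriodicChain M)
    {m m' : Fin n → ℤ} (hm : m ∈ M) (hm' : m' ∈ M) (h : ∑ i, m i = ∑ i, m' i) : m = m' := by
  rcases hM.le_total hm hm' with h1 | h1
  · exact funext fun i =>
      (Finset.sum_eq_sum_iff_of_le fun i _ => h1 i).1 h i (Finset.mem_univ _)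
  · exact funext fun i =>
      ((Finset.sum_eq_sum_iff_of_le fun i _ => h1 i).1 h.symm i (Finset.mem_univ _)).symm

lemma finite_verts {M : Set (Fin n → ℤ)} (hM : IsPeriodicChain M) : (verts M).Finite := by
  refine Set.Finite.of_finite_image (f := fun m : Fin n → ℤ => ∑ i, m i)
    ((Set.finite_Ico (0 : ℤ) n).subset ?_) fun m hm m' hm' h => hM.eq_of_sum_eq hm.1 hm'.1 h
  rintro _ ⟨m, hm, rfl⟩
  exact hm.2

lemma exists_shift_sum [NeZero n] (m : Fin n → ℤ) :
    ∃ c : ℤ, 0 ≤ ∑ i, (m + (c : Fin n → ℤ)) i ∧ ∑ i, (m + (c : Fin n → ℤ)) i < n := by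
  have hn : (0 : ℤ) < n := by exact_mod_cast NeZero.pos n
  refine ⟨-((∑ i, m i) / n), ?_⟩
  rw [sum_add_intCast]
  have h1 := Int.emod_nonneg (∑ i, m i) hn.ne'
  have h2 := Int.emod_lt_of_pos (∑ i, m i) hn
  rw [Int.emod_def] at h1 h2
  constructor <;> linarith

lemma exists_shift_mem_verts [NeZero n] {M : Set (Fin n → ℤ)} (hM : IsPeriodicChain M)
    {m : Fin n → ℤ} (hm : m ∈ M) : ∃ c : ℤ, m + (c : Fin n → ℤ) ∈ verts M := by
  obtain ⟨c, hc⟩ := exists_shift_sum m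
  exact ⟨c, (hM.mem_add m c).2 hm, hc⟩

lemma subset_iff_verts [NeZero n] {M M' : Set (Fin n → ℤ)} (hM : IsPeriodicChain M)
    (hM' : ∀ m, m + 1 ∈ M' ↔ m ∈ M') : M ⊆ M' ↔ verts M ⊆ verts M' := by
  refine ⟨fun h m hm => ⟨h hm.1, hm.2⟩, fun h m hm => ?_⟩
  obtain ⟨c, hc⟩ := exists_shift_mem_verts hM hm
  exact (mem_add_intCast hM' m c).1 (h hc).1

/-- The exposing functional is, up to a constant, minus the sum of the energy gaps between the
vertices of `M` and `m`. On the Voronoi cell all gaps are nonnegative, and they vanish together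
exactly on the face. -/
lemma isExposed_face [NeZero n] (M : PeriodicChain n) {m : Fin n → ℤ} (hm : m ∈ M.1) :
    IsExposed ℝ (voronoiCell n (ptR m)) (face M.1) := by
  intro _
  set B := (finite_verts M.2).toFinset with hB
  set l : NR n →ₗ[ℝ] ℝ := (∑ b ∈ B, (lin b - lin m)) ∘ₗ
    (WithLp.linearEquiv 2 ℝ (Fin n → ℝ)).toLinearMap ∘ₗ (NR n).subtype with hl
  have hlx : ∀ x : NR n, l x = ∑ b ∈ B, (lin b (coord x) - lin m (coord x)) := by
    intro x
    simp [hl]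
  obtain ⟨k, hk⟩ : ∃ k : ℝ, ∀ x : NR n,
      l x = k - ∑ b ∈ B, (energy (coord x) b - energy (coord x) m) := by
    refine ⟨∑ b ∈ B, (∑ i, ∑ j, ((n : ℝ) * ((b i : ℝ) - b j)) ^ 2 -
      ∑ i, ∑ j, ((n : ℝ) * ((m i : ℝ) - m j)) ^ 2), fun x => ?_⟩
    rw [hlx, ← Finset.sum_sub_distrib]
    refine Finset.sum_congr rfl fun b _ => ?_
    rw [energy_eq, energy_eq]; ring
  have hmem : ∀ x ∈ voronoiCell n (ptR m), x ∈ face M.1 ↔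
      ∑ b ∈ B, (energy (coord x) b - energy (coord x) m) ≤ 0 := by
    intro x hx
    rw [mem_voronoiCell_iff] at hx
    have h0 : ∀ b ∈ B, 0 ≤ energy (coord x) b - energy (coord x) m := fun b _ =>
      sub_nonneg.2 (hx b)
    constructor
    · intro hxM
      refine (Finset.sum_eq_zero fun b hb => ?_).le
      have hbM : b ∈ M.1 := by
        rw [hB, Set.Finite.mem_toFinset] at hb; exact hb.1
      rw [(mem_near_iff_of_mem hx b).1 (hxM hbM), sub_self]
    · intro h
      have h1 := (Finset.sum_eq_zero_iff_of_nonneg h0).1 (le_antisymm h (Finset.sum_nonneg h0))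
      have hper := isPeriodicChain_near ⟨m, hx⟩
      intro y hy
      obtain ⟨c, hc⟩ := exists_shift_mem_verts M.2 hy
      rw [← hper.mem_add y c, mem_near_iff_of_mem hx]
      exact sub_eq_zero.1 (h1 _ (by rw [hB, Set.Finite.mem_toFinset]; exact hc))
  refine ⟨l.toContinuousLinearMap, ?_⟩
  ext x
  simp only [LinearMap.coe_toContinuousLinearMap', Set.mem_ofPred_eq]
  constructor
  · intro hx
    have hxv : x ∈ voronoiCell n (ptR m) := (mem_voronoiCell_iff x m).2 (hx hm)
    refine ⟨hxv, fun y hy => ?_⟩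
    rw [hk, hk]
    have h1 := (hmem x hxv).1 hx
    have h2 : 0 ≤ ∑ b ∈ B, (energy (coord y) b - energy (coord y) m) :=
      Finset.sum_nonneg fun b _ => sub_nonneg.2 ((mem_voronoiCell_iff y m).1 hy b)
    linarith
  · rintro ⟨hxv, hx⟩
    rw [hmem x hxv]
    -- The center shows that total gap zero is attained, so every maximizer has it.
    have hc := centerR_mem_face M
    have hcv : centerR M ∈ voronoiCell n (ptR m) := (mem_voronoiCell_iff _ m).2 (hc hm)
    have h1 := hx _ hcv
    rw [hk, hk] at h1
    have h2 := (hmem _ hcv).1 hc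
    have h3 : 0 ≤ ∑ b ∈ B, (energy (coord (centerR M)) b - energy (coord (centerR M)) m) :=
      Finset.sum_nonneg fun b _ => sub_nonneg.2 ((mem_voronoiCell_iff _ m).1 hcv b)
    linarith

/-- Let `x₀` be a point of `G` with as few nearest vectors as possible. For `z` in `G`, a vector
nearest to the midpoint is nearest to both ends, so minimality gives `near x₀ ⊆ near z`. Conversely,
if `z` satisfies this inclusion, the segment from `z` to `x₀` can be prolonged slightly within the
cell, and maximality of the functional at `x₀` forces it to be maximal at `z`. -/
lemma exists_eq_face [NeZero n] {m : Fin n → ℤ} {G : Set (NR n)} (hG : G.Nonempty)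
    (hexp : IsExposed ℝ (voronoiCell n (ptR m)) G) : ∃ M : PeriodicChain n, G = face M.1 := by
  obtain ⟨l, hl⟩ := hexp hG
  have hGv : ∀ x ∈ G, m ∈ near (coord x) := fun x hx => by
    rw [hl] at hx; exact (mem_voronoiCell_iff x m).1 hx.1
  have hper : ∀ x ∈ G, IsPeriodicChain (near (coord x)) := fun x hx =>
    isPeriodicChain_near ⟨m, hGv x hx⟩
  -- a point with the fewest nearest lattice points
  obtain ⟨x₀, hx₀, hmin⟩ := WellFounded.has_min
    (InvImage.wf (fun x : NR n => (verts (near (coord x))).ncard) Nat.lt_wfRel.wf) G hG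
  have hmin' : ∀ z ∈ G, near (coord z) ⊆ near (coord x₀) → near (coord x₀) ⊆ near (coord z) := by
    intro z hz hsub
    rw [subset_iff_verts (hper x₀ hx₀) (hper z hz).2.2]
    have h1 := (subset_iff_verts (hper z hz) (hper x₀ hx₀).2.2).1 hsub
    have h2 : ¬ (verts (near (coord z))).ncard < (verts (near (coord x₀))).ncard := hmin z hz
    exact (Set.eq_of_subset_of_ncard_le h1 (not_lt.1 h2) (finite_verts (hper x₀ hx₀))).ge
  refine ⟨⟨near (coord x₀), hper x₀ hx₀⟩, Set.Subset.antisymm ?_ ?_⟩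
  · intro z hz
    set w : NR n := (1 / 2 : ℝ) • x₀ + (1 / 2 : ℝ) • z with hw
    have hcw : coord w = (1 / 2 : ℝ) • coord x₀ + (1 / 2 : ℝ) • coord z := rfl
    have hgap : ∀ y, energy (coord w) y - energy (coord w) m =
        1 / 2 * (energy (coord x₀) y - energy (coord x₀) m) +
          1 / 2 * (energy (coord z) y - energy (coord z) m) := fun y => by
      rw [hcw]; exact energy_combo (by norm_num) _ _ _ _
    have hwm : m ∈ near (coord w) := fun y => by
      have h1 := hGv x₀ hx₀ y
      have h2 := hGv z hz y
      have := hgap y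
      linarith
    have hwG : w ∈ G := by
      rw [hl]
      refine ⟨(mem_voronoiCell_iff w m).2 hwm, fun y hy => ?_⟩
      rw [hl] at hx₀ hz
      have h1 := hx₀.2 y hy
      have h2 := hz.2 y hy
      rw [hw, map_add, map_smul, map_smul, smul_eq_mul, smul_eq_mul]
      linarith
    have hsub : ∀ y ∈ near (coord w), y ∈ near (coord x₀) ∧ y ∈ near (coord z) := by
      intro y hy
      rw [mem_near_iff_of_mem hwm] at hy
      rw [mem_near_iff_of_mem (hGv x₀ hx₀), mem_near_iff_of_mem (hGv z hz)]
      have h1 := hGv x₀ hx₀ y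
      have h2 := hGv z hz y
      have := hgap y
      constructor <;> linarith
    exact (hmin' w hwG fun y hy => (hsub y hy).1).trans fun y hy => (hsub y hy).2
  · intro z hz
    have hz : near (coord x₀) ⊆ near (coord z) := hz
    have hzm := hz (hGv x₀ hx₀)
    -- Points just beyond `x₀` on the line from `z`. Gaps vanishing at `x₀` vanish at `z`, hence on
    -- the line; the others stay positive for small `t`, and by `mem_near_of_local` finitely many
    -- matter.
    set w : ℝ → NR n := fun t => (1 + t) • x₀ + (-t) • z with hw
    have hcw : ∀ t, coord (w t) = (1 + t) • coord x₀ + (-t) • coord z := fun t => rfl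
    have hgap : ∀ t y, energy (coord (w t)) y - energy (coord (w t)) m =
        (1 + t) * (energy (coord x₀) y - energy (coord x₀) m) +
          (-t) * (energy (coord z) y - energy (coord z) m) := fun t y => by
      rw [hcw]; exact energy_combo (by ring) _ _ _ _
    have hev : ∀ᶠ t in nhdsWithin (0 : ℝ) (Set.Ioi 0), ∀ b ∈ Finset.Icc m (m + 1),
        energy (coord (w t)) m ≤ energy (coord (w t)) b := by
      rw [Filter.eventually_all_finset]
      intro b _
      by_cases hb : b ∈ near (coord x₀)
      · refine Filter.Eventually.of_forall fun t => ?_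
        have h1 := (mem_near_iff_of_mem (hGv x₀ hx₀) b).1 hb
        have h2 := (mem_near_iff_of_mem hzm b).1 (hz hb)
        have := hgap t b
        rw [h1, h2] at this
        linarith
      · have hpos : 0 < energy (coord x₀) b - energy (coord x₀) m := by
          refine lt_of_le_of_ne (sub_nonneg.2 (hGv x₀ hx₀ b)) fun h => hb ?_
          rw [mem_near_iff_of_mem (hGv x₀ hx₀)]
          exact (sub_eq_zero.1 h.symm)
        have hcont : Continuous fun t : ℝ =>
            (1 + t) * (energy (coord x₀) b - energy (coord x₀) m) +
              (-t) * (energy (coord z) b - energy (coord z) m) := by fun_prop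
        have h0 := (hcont.tendsto 0).eventually (lt_mem_nhds (a := 0) (by simpa using hpos))
        filter_upwards [h0.filter_mono nhdsWithin_le_nhds] with t ht
        have := hgap t b
        linarith
    obtain ⟨t, ht, ht0⟩ := (hev.and self_mem_nhdsWithin).exists
    have ht0 : 0 < t := ht0
    have hwt : w t ∈ voronoiCell n (ptR m) := by
      rw [mem_voronoiCell_iff]
      exact mem_near_of_local fun b h1 h2 => ht b (Finset.mem_Icc.2 ⟨h1, h2⟩)
    rw [hl] at hx₀ ⊢
    have h1 := hx₀.2 _ hwt
    rw [hw] at h1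
    simp only [map_add, map_smul, smul_eq_mul] at h1
    have h2 : l x₀ ≤ l z := by
      have : t * l x₀ ≤ t * l z := by linarith
      exact le_of_mul_le_mul_left this ht0
    exact ⟨(mem_voronoiCell_iff z m).2 hzm, fun y hy => (hx₀.2 y hy).trans h2⟩

/-- The cells of the wonderful decomposition are the images of the faces of periodic chains. -/
lemma isCell_iff [NeZero n] (A : Set (Torus n)) :
    IsCell n A ↔ ∃ M : PeriodicChain n,
      A = (fun x : NR n => (QuotientAddGroup.mk x : Torus n)) '' face M.1 := by
  constructor
  · rintro ⟨a, ha, G, hG, hexp, rfl⟩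
    obtain ⟨m, rfl⟩ := (mem_N_iff a).1 ha
    obtain ⟨M, rfl⟩ := exists_eq_face hG hexp
    exact ⟨M, rfl⟩
  · rintro ⟨M, rfl⟩
    obtain ⟨m, hm⟩ := M.2.1
    exact ⟨ptR m, (mem_N_iff _).2 ⟨m, rfl⟩, face M.1, ⟨_, centerR_mem_face M⟩,
      isExposed_face M hm, rfl⟩

end Wonderful

end

noncomputable section

namespace Wonderful

variable {n : ℕ}

/-! ### Translations -/

/-- The translate of a set of integer vectors. -/
def translate (v : Fin n → ℤ) (M : Set (Fin n → ℤ)) : Set (Fin n → ℤ) := {m | m - v ∈ M}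

lemma translate_zero (M : Set (Fin n → ℤ)) : translate 0 M = M := by
  ext m; simp [translate]

lemma translate_add (v w : Fin n → ℤ) (M : Set (Fin n → ℤ)) :
    translate (v + w) M = translate v (translate w M) := by
  ext m; simp [translate, sub_sub]

lemma translate_mono (v : Fin n → ℤ) {M M' : Set (Fin n → ℤ)} (h : M ⊆ M') :
    translate v M ⊆ translate v M' := fun _ hm => h hm

lemma IsPeriodicChain.translate {M : Set (Fin n → ℤ)} (hM : IsPeriodicChain M) (v : Fin n → ℤ) :
    IsPeriodicChain (translate v M) := by
  refine ⟨?_, ?_, fun m => ?_⟩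
  · obtain ⟨m, hm⟩ := hM.1
    exact ⟨m + v, by simpa [Wonderful.translate] using hm⟩
  · intro x hx y hy _
    exact (hM.le_total hx hy).imp (fun h => by simpa using h) fun h => by simpa using h
  · have : m + 1 - v = m - v + 1 := by abel
    simp only [Wonderful.translate, Set.mem_ofPred_eq, this]
    exact hM.2.2 _

/-- A chain has at most one member with a given coordinate sum, and zero-sum translations preserve
sums. This rigidity supplies the uniqueness axiom of `PosetCover`. -/
lemma IsPeriodicChain.eq_of_subset_translate {M M' : Set (Fin n → ℤ)} (hM : M.Nonempty)
    (hM' : IsPeriodicChain M') {v w : Fin n → ℤ} (hv : ∑ i, v i = 0) (hw : ∑ i, w i = 0)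
    (h : M ⊆ Wonderful.translate v M') (h' : M ⊆ Wonderful.translate w M') : v = w := by
  obtain ⟨m, hm⟩ := hM
  have := hM'.eq_of_sum_eq (h hm) (h' hm) (by simp [Finset.sum_sub_distrib, hv, hw])
  simpa using this

lemma ptR_add (v w : Fin n → ℤ) : ptR (v + w) = ptR v + ptR w := by
  ext i
  simp only [ptR, pt, Pi.add_apply, Int.cast_add, Finset.sum_add_distrib, Submodule.coe_add,
    PiLp.add_apply]
  ring

lemma ptR_zero : ptR (0 : Fin n → ℤ) = 0 := by
  ext i; simp [ptR, pt]

lemma ptR_neg (v : Fin n → ℤ) : ptR (-v) = -ptR v := by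
  have := ptR_add v (-v)
  rw [add_neg_cancel, ptR_zero] at this
  exact (neg_eq_of_add_eq_zero_right this.symm).symm

lemma near_add_ptR (x : NR n) {v : Fin n → ℤ} (hv : ∑ i, v i = 0) :
    near (coord (x + ptR v)) = translate v (near (coord x)) := by
  have hv' : ∑ i, (v i : ℝ) = 0 := by exact_mod_cast hv
  have h : ∀ y, energy (coord (x + ptR v)) y = energy (coord x) (y - v) := by
    intro y
    refine Finset.sum_congr rfl fun i _ => Finset.sum_congr rfl fun j _ => ?_
    have hc : ∀ i, coord (x + ptR v) i = coord x i + n * v i := by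
      intro i
      change coord x i + (n * v i - ∑ j, (v j : ℝ)) = _
      rw [hv', sub_zero]
    rw [hc, hc]
    simp only [Pi.sub_apply, Int.cast_sub]
    ring
  ext y
  simp only [near, translate, Set.mem_ofPred_eq, h]
  exact ⟨fun hy z => by simpa using hy (z + v), fun hy z => hy _⟩

/-! ### The sublattice -/

lemma alpha_sub_alpha (i j : Fin n) :
    alpha n i - alpha n j = pt (Pi.single i 1 - Pi.single j 1) := by
  ext k
  simp only [alpha, pt, PiLp.sub_apply, Pi.sub_apply, Int.cast_sub, Finset.sum_sub_distrib,
    Pi.single_apply]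
  split_ifs <;> (simp; try ring)

lemma pt_add (v w : Fin n → ℤ) : pt (v + w) = pt v + pt w := congrArg Subtype.val (ptR_add v w)

lemma pt_neg (v : Fin n → ℤ) : pt (-v) = -pt v := congrArg Subtype.val (ptR_neg v)

lemma mem_N'_iff [NeZero n] (x : NR n) :
    x ∈ N' n ↔ ∃ v : Fin n → ℤ, ∑ i, v i = 0 ∧ x = ptR v := by
  set A := AddSubgroup.closure
    {b : E n | ∃ i j : Fin n, (i : ℕ) + 1 = (j : ℕ) ∧ b = alpha n i - alpha n j} with hA
  have hmem : x ∈ N' n ↔ (x : E n) ∈ A := Iff.rfl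
  rw [hmem]
  constructor
  · intro hx
    have : ∃ v : Fin n → ℤ, ∑ i, v i = 0 ∧ (x : E n) = pt v := by
      rw [hA] at hx
      generalize (x : E n) = z at hx
      induction hx using AddSubgroup.closure_induction with
      | mem z hz =>
        obtain ⟨i, j, _, rfl⟩ := hz
        exact ⟨_, by simp [Finset.sum_sub_distrib], alpha_sub_alpha i j⟩
      | zero => exact ⟨0, by simp, (congrArg Subtype.val ptR_zero).symm⟩
      | add x y _ _ hx hy =>
        obtain ⟨v, hv, rfl⟩ := hx
        obtain ⟨w, hw, rfl⟩ := hy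
        exact ⟨v + w, by simp [Finset.sum_add_distrib, hv, hw], (pt_add v w).symm⟩
      | neg x _ hx =>
        obtain ⟨v, hv, rfl⟩ := hx
        exact ⟨-v, by simp [hv], (pt_neg v).symm⟩
    obtain ⟨v, hv, h⟩ := this
    exact ⟨v, hv, Subtype.ext h⟩
  · rintro ⟨v, hv, rfl⟩
    have hk : ∀ k (hk : k < n), alpha n 0 - alpha n ⟨k, hk⟩ ∈ A := by
      intro k
      induction k with
      | zero =>
        intro hk
        have : (⟨0, hk⟩ : Fin n) = 0 := Fin.ext (by simp)
        rw [this, sub_self]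
        exact A.zero_mem
      | succ k ih =>
        intro hk
        have h1 := A.add_mem (ih (by omega)) (AddSubgroup.subset_closure
          ⟨⟨k, by omega⟩, ⟨k + 1, hk⟩, rfl, rfl⟩)
        rwa [sub_add_sub_cancel] at h1
    -- Each `α_0 - α_j` telescopes into generators; the coefficient of coordinate 0 comes out right
    -- because `v` has sum zero.
    have hsum : pt v = ∑ j, (-v j) • (alpha n 0 - alpha n j) := by
      have hP : ∀ (s : Finset (Fin n)) (g : Fin n → Fin n → ℤ),
          pt (∑ j ∈ s, g j) = ∑ j ∈ s, pt (g j) := fun s g =>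
        map_sum (AddMonoidHom.mk' (pt (n := n)) pt_add) g s
      have hZ : ∀ (c : ℤ) (g : Fin n → ℤ), pt (c • g) = c • pt g := fun c g =>
        map_zsmul (AddMonoidHom.mk' (pt (n := n)) pt_add) c g
      simp only [alpha_sub_alpha, ← hZ, ← hP]
      congr 1
      ext i
      simp only [Finset.sum_apply, Pi.smul_apply, Pi.sub_apply, smul_eq_mul, mul_sub,
        Finset.sum_sub_distrib, ← Finset.sum_mul, Finset.sum_neg_distrib, hv]
      simp [Pi.single_apply]
    change pt v ∈ A
    rw [hsum]
    exact A.sum_mem fun j _ => A.zsmul_mem (hk j j.2) _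

/-! ### Cells -/

/-- The cell of the torus given by a periodic chain. -/
def cellOf [NeZero n] (M : PeriodicChain n) : Cell n := ⟨_, (isCell_iff _).2 ⟨M, rfl⟩⟩

lemma cellOf_surjective [NeZero n] : Function.Surjective (cellOf (n := n)) := by
  rintro ⟨A, hA⟩
  obtain ⟨M, rfl⟩ := (isCell_iff A).1 hA
  exact ⟨M, rfl⟩

/-- The inclusion of cells is tested at the center of `M'`, whose nearest vectors are exactly `M'`:
a point of `face M` in the same class differs from it by a zero-sum translation. -/
lemma cellOf_le_iff [NeZero n] (M M' : PeriodicChain n) :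
    cellOf M' ≤ cellOf M ↔ ∃ v : Fin n → ℤ, ∑ i, v i = 0 ∧ M.1 ⊆ translate v M'.1 := by
  have hle : cellOf M' ≤ cellOf M ↔ (fun x : NR n => (QuotientAddGroup.mk x : Torus n)) '' face M'.1 ⊆
    (fun x : NR n => (QuotientAddGroup.mk x : Torus n)) '' face M.1 := Iff.rfl
  rw [hle, Set.image_subset_iff]
  constructor
  · intro h
    obtain ⟨x, hx, hxe⟩ := h (centerR_mem_face M')
    have := QuotientAddGroup.eq.1 hxe.symm
    obtain ⟨v, hv, hxv⟩ := (mem_N'_iff _).1 this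
    refine ⟨v, hv, ?_⟩
    have hx' : x = centerR M' + ptR v := by rw [← hxv]; abel
    rw [← near_centerR M', ← near_add_ptR _ hv, ← hx']
    exact hx
  · rintro ⟨v, hv, h⟩ x hx
    refine ⟨x + ptR v, ?_, QuotientAddGroup.eq.2 ((mem_N'_iff _).2 ⟨-v, by simp [hv], ?_⟩)⟩
    · rw [face, Set.mem_ofPred_eq, near_add_ptR _ hv]
      exact h.trans (translate_mono v hx)
    · rw [ptR_neg]; abel

/-- The simplex of the dual poset given by a periodic chain. -/
def simplexOf [NeZero n] (M : PeriodicChain n) : SimplicialPoset.Nonbot (K n) :=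
  ⟨((OrderDual.toDual (cellOf M) : (Cell n)ᵒᵈ) : WithBot (Cell n)ᵒᵈ), WithBot.coe_ne_bot⟩

lemma simplexOf_surjective [NeZero n] : Function.Surjective (simplexOf (n := n)) := by
  rintro ⟨I, hI⟩
  obtain ⟨c, rfl⟩ := WithBot.ne_bot_iff_exists.1 hI
  obtain ⟨M, hM⟩ := cellOf_surjective (OrderDual.ofDual c)
  exact ⟨M, Subtype.ext (congrArg (fun c => ((OrderDual.toDual c : (Cell n)ᵒᵈ) : WithBot (Cell n)ᵒᵈ)) hM)⟩

lemma simplexOf_le_iff [NeZero n] (M M' : PeriodicChain n) :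
    simplexOf M ≤ simplexOf M' ↔ ∃ v : Fin n → ℤ, ∑ i, v i = 0 ∧ M.1 ⊆ translate v M'.1 :=
  WithBot.coe_le_coe.trans (cellOf_le_iff M M')

lemma simplexOf_eq_iff [NeZero n] (M M' : PeriodicChain n) :
    simplexOf M = simplexOf M' ↔ ∃ v : Fin n → ℤ, ∑ i, v i = 0 ∧ M.1 = translate v M'.1 := by
  constructor
  · intro h
    obtain ⟨v, hv, h1⟩ := (simplexOf_le_iff M M').1 h.le
    obtain ⟨w, hw, h2⟩ := (simplexOf_le_iff M' M).1 h.ge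
    refine ⟨v, hv, h1.antisymm ?_⟩
    have h3 := translate_mono v h2
    rw [← translate_add] at h3
    have h4 : M.1 ⊆ translate 0 M.1 := (translate_zero _).ge
    have h5 := IsPeriodicChain.eq_of_subset_translate M.2.1 M.2
      (by simp [Finset.sum_add_distrib, hv, hw]) (by simp) (h1.trans h3) h4
    rwa [h5, translate_zero] at h3
  · rintro ⟨v, hv, h⟩
    refine le_antisymm ((simplexOf_le_iff M M').2 ⟨v, hv, h.le⟩)
      ((simplexOf_le_iff M' M).2 ⟨-v, by simp [hv], ?_⟩)
    rw [h, ← translate_add, neg_add_cancel, translate_zero]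

/-- The vector with vanishing coordinate sum and given coordinates except for the first one. -/
def balanced {m : ℕ} (g : Fin m → ℤ) : Fin (m + 1) → ℤ := Fin.cons (-∑ i, g i) g

lemma sum_balanced {m : ℕ} (g : Fin m → ℤ) : ∑ i, balanced g i = 0 := by
  simp [balanced, Fin.sum_univ_succ]

lemma exists_balanced {m : ℕ} {v : Fin (m + 1) → ℤ} (hv : ∑ i, v i = 0) :
    ∃ g, balanced g = v := by
  refine ⟨Fin.tail v, ?_⟩
  rw [Fin.sum_univ_succ] at hv
  refine (congrArg (Fin.cons · (Fin.tail v)) ?_).trans (Fin.cons_self_tail v)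
  simp only [Fin.tail]
  linarith

lemma balanced_add {m : ℕ} (g g' : Fin m → ℤ) : balanced (g + g') = balanced g + balanced g' := by
  ext i
  refine Fin.cases ?_ (fun i => ?_) i
  · simp [balanced, Finset.sum_add_distrib]; ring
  · simp [balanced]

lemma balanced_injective {m : ℕ} : Function.Injective (balanced (m := m)) := fun _ _ h =>
  (Fin.cons_inj.1 h).2

/-- The poset of periodic chains covers the poset of nonempty simplices. -/
def periodicCover (m : ℕ) :
    PosetCover (Fin m → ℤ) (SimplicialPoset.Nonbot (K (m + 1))) (PeriodicChain (m + 1)) where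
  act g M := ⟨translate (balanced g) M.1, M.2.translate _⟩
  act_add g g' M := Subtype.ext (by rw [balanced_add]; exact translate_add _ _ _)
  act_zero M := Subtype.ext (by
    have : balanced (0 : Fin m → ℤ) = 0 := by
      have := balanced_add (0 : Fin m → ℤ) 0
      simpa using this
    rw [this]; exact translate_zero _)
  act_mono g M M' h := translate_mono _ h
  sec := Function.surjInv simplexOf_surjective
  exists_eq M := by
    obtain ⟨v, hv, h⟩ := (simplexOf_eq_iff M (Function.surjInv simplexOf_surjective (simplexOf M))).1
      (Function.surjInv_eq simplexOf_surjective _).symm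
    obtain ⟨g, rfl⟩ := exists_balanced hv
    exact ⟨g, simplexOf M, Subtype.ext h⟩
  le_iff p p' := by
    conv_lhs => rw [← Function.surjInv_eq simplexOf_surjective p,
      ← Function.surjInv_eq simplexOf_surjective p']
    rw [simplexOf_le_iff]
    constructor
    · rintro ⟨v, hv, h⟩
      obtain ⟨g, rfl⟩ := exists_balanced hv
      exact ⟨g, h⟩
    · rintro ⟨g, h⟩
      exact ⟨_, sum_balanced g, h⟩
  uniq p p' g g' h h' := balanced_injective (IsPeriodicChain.eq_of_subset_translate
    (Function.surjInv simplexOf_surjective p).2.1 (Function.surjInv simplexOf_surjective p').2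
    (sum_balanced g) (sum_balanced g') h h')

instance (m : ℕ) : Nonempty (SimplicialPoset.Nonbot (K (m + 1))) :=
  ⟨simplexOf ⟨orbit 0, isPeriodicChain_orbit 0⟩⟩

end Wonderful

end

noncomputable section

namespace Wonderful

open SimplicialPoset

variable {n k : ℕ}

/-! ### Normal forms of periodic chains -/

/-- The steps from `s • e₀` to `s • e₀ + (1, …, 1)` that raise the coordinates in the order
prescribed by `b`. -/
def step (s : ℤ) (b : Fin (n + 1) → Fin (k + 1)) (j : Fin (k + 1)) (i : Fin (n + 1)) : ℤ :=
  (Pi.single 0 s : Fin (n + 1) → ℤ) i + if b i < j then 1 else 0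

section step

variable {s : ℤ} {b : Fin (n + 1) → Fin (k + 1)}

lemma step_mono : Monotone (step s b) := by
  intro j j' h i
  simp only [step]
  split_ifs with h1 h2 <;> first | exact absurd (h1.trans_le h) h2 | omega

lemma step_strictMono (hb : Function.Surjective b) : StrictMono (step s b) := by
  intro j j' h
  refine lt_of_le_of_ne (step_mono h.le) fun he => ?_
  obtain ⟨i, rfl⟩ := hb j
  have := congrFun he i
  simp [step, h] at this

lemma step_zero : step s b 0 = Pi.single 0 s := by
  ext i; simp [step]

/-- Raising coordinate 0 last keeps all steps in one slice, which meets every orbit of (1, …, 1)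
once. -/
lemma step_apply_zero (h0 : b 0 = Fin.last k) (j : Fin (k + 1)) : step s b j 0 = s := by
  simp [step, h0, Fin.le_last]

lemma step_le_add_one (j j' : Fin (k + 1)) : step s b j ≤ step s b j' + 1 := by
  intro i
  simp only [step, Pi.add_apply, Pi.one_apply]
  split_ifs <;> omega

lemma step_add_le_total (j j' : Fin (k + 1)) (c c' : ℤ) :
    step s b j + (c : Fin (n + 1) → ℤ) ≤ step s b j' + (c' : Fin (n + 1) → ℤ) ∨
      step s b j' + (c' : Fin (n + 1) → ℤ) ≤ step s b j + (c : Fin (n + 1) → ℤ) := by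
  have key : ∀ j j' : Fin (k + 1), ∀ c c' : ℤ, c < c' →
      step s b j + (c : Fin (n + 1) → ℤ) ≤ step s b j' + (c' : Fin (n + 1) → ℤ) := by
    intro j j' c c' h i
    have h1 : step s b j i ≤ step s b j' i + 1 := step_le_add_one j j' i
    simp only [Pi.add_apply, Pi.intCast_apply, Int.cast_id]
    omega
  rcases lt_trichotomy c c' with h | rfl | h
  · exact .inl (key _ _ _ _ h)
  · exact (le_total j j').imp (fun h => by gcongr; exact step_mono h)
      fun h => by gcongr; exact step_mono h
  · exact .inr (key _ _ _ _ h)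

variable (s b)

/-- The translates by multiples of `(1, …, 1)` of the steps with index in `S`. -/
def steps (S : Set (Fin (k + 1))) : Set (Fin (n + 1) → ℤ) :=
  {m | ∃ c : ℤ, ∃ j ∈ S, m = step s b j + (c : Fin (n + 1) → ℤ)}

lemma isPeriodicChain_steps {S : Set (Fin (k + 1))} (hS : S.Nonempty) :
    IsPeriodicChain (steps s b S) := by
  refine ⟨?_, ?_, fun m => ⟨?_, ?_⟩⟩
  · obtain ⟨j, hj⟩ := hS
    exact ⟨_, 0, j, hj, rfl⟩
  · rintro _ ⟨c, j, _, rfl⟩ _ ⟨c', j', _, rfl⟩ _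
    exact step_add_le_total j j' c c'
  · rintro ⟨c, j, hj, h⟩
    exact ⟨c - 1, j, hj, by push_cast; rw [← add_sub_assoc, ← h, add_sub_cancel_right]⟩
  · rintro ⟨c, j, hj, rfl⟩
    exact ⟨c + 1, j, hj, by push_cast; rw [add_assoc]⟩

/-- The periodic chain of all steps. -/
def chainOf : PeriodicChain (n + 1) :=
  ⟨steps s b Set.univ, isPeriodicChain_steps s b Set.univ_nonempty⟩

variable {s b}

lemma mem_chainOf {m : Fin (n + 1) → ℤ} :
    m ∈ (chainOf s b).1 ↔ ∃ c : ℤ, ∃ j, m = step s b j + (c : Fin (n + 1) → ℤ) := by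
  simp [chainOf, steps]

lemma steps_subset_chainOf (S : Set (Fin (k + 1))) : steps s b S ⊆ (chainOf s b).1 := by
  rintro _ ⟨c, j, _, rfl⟩
  exact ⟨c, j, trivial, rfl⟩

lemma step_mem_steps_iff (hb : Function.Surjective b) (h0 : b 0 = Fin.last k)
    {S : Set (Fin (k + 1))} {j : Fin (k + 1)} : step s b j ∈ steps s b S ↔ j ∈ S := by
  constructor
  · rintro ⟨c, j', hj', h⟩
    have h1 := congrFun h 0
    rw [Pi.add_apply, step_apply_zero h0, step_apply_zero h0] at h1
    have hc : c = 0 := by simpa using h1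
    rw [hc, Int.cast_zero, add_zero] at h
    rwa [(step_strictMono hb).injective h]
  · exact fun hj => ⟨0, j, hj, by simp⟩

lemma steps_subset_steps_iff (hb : Function.Surjective b) (h0 : b 0 = Fin.last k)
    {S T : Set (Fin (k + 1))} : steps s b S ⊆ steps s b T ↔ S ⊆ T := by
  constructor
  · exact fun h j hj => (step_mem_steps_iff hb h0).1 (h ((step_mem_steps_iff hb h0).2 hj))
  · rintro h _ ⟨c, j, hj, rfl⟩
    exact ⟨c, j, h hj, rfl⟩

lemma eq_steps_of_subset {M : Set (Fin (n + 1) → ℤ)} (hM : IsPeriodicChain M)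
    (h : M ⊆ (chainOf s b).1) : M = steps s b {j | step s b j ∈ M} := by
  ext m
  constructor
  · intro hm
    obtain ⟨c, j, rfl⟩ := mem_chainOf.1 (h hm)
    exact ⟨c, j, (hM.mem_add _ c).1 hm, rfl⟩
  · rintro ⟨c, j, hj, rfl⟩
    exact (hM.mem_add _ c).2 hj

lemma IsPeriodicChain.subset_of_subset_translate {M M' L : Set (Fin n → ℤ)} (hM : M.Nonempty)
    (hL : IsPeriodicChain L) (hML : M ⊆ L) (hML' : M' ⊆ L) {v : Fin n → ℤ} (hv : ∑ i, v i = 0)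
    (h : M ⊆ Wonderful.translate v M') : M ⊆ M' := by
  have := IsPeriodicChain.eq_of_subset_translate hM hL hv (w := 0) (by simp)
    (h.trans (translate_mono v hML')) (by rwa [translate_zero])
  rwa [this, translate_zero] at h

/-- The faces are the subchains, indexed by sets of steps. No two are identified in the quotient,
since subchains of one chain that are zero-sum translates of each other coincide. -/
lemma hasCard_chainOf (hb : Function.Surjective b) (h0 : b 0 = Fin.last k) :
    HasCard (simplexOf (chainOf s b)).1 (k + 1) := by
  classical
  let φ : Finset (Fin (k + 1)) → K (n + 1) := fun S =>
    if hS : S.Nonempty then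
      (simplexOf ⟨steps s b S, isPeriodicChain_steps s b (Finset.coe_nonempty.2 hS)⟩).1
    else ⊥
  have hφ : ∀ (S : Finset (Fin (k + 1))) (hS : S.Nonempty), φ S =
      (simplexOf ⟨steps s b S, isPeriodicChain_steps s b (Finset.coe_nonempty.2 hS)⟩).1 :=
    fun S hS => dif_pos hS
  have hφ0 : φ ∅ = ⊥ := dif_neg (by simp)
  have hle : ∀ S T, φ S ≤ φ T ↔ S ≤ T := by
    intro S T
    rcases S.eq_empty_or_nonempty with rfl | hS
    · simp [hφ0]
    rcases T.eq_empty_or_nonempty with rfl | hT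
    · rw [hφ0, le_bot_iff, hφ S hS]
      simp only [Finset.subset_empty, hS.ne_empty, iff_false]
      exact (simplexOf _).2
    rw [hφ S hS, hφ T hT, Subtype.coe_le_coe, simplexOf_le_iff,
      ← Finset.coe_subset, ← steps_subset_steps_iff (s := s) hb h0]
    constructor
    · rintro ⟨v, hv, h⟩
      exact IsPeriodicChain.subset_of_subset_translate
        (isPeriodicChain_steps s b (Finset.coe_nonempty.2 hS)).1 (chainOf s b).2
        (steps_subset_chainOf _) (steps_subset_chainOf _) hv h
    · exact fun h => ⟨0, by simp, by rwa [translate_zero]⟩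
  have hmem : ∀ S, φ S ∈ Set.Iic (simplexOf (chainOf s b)).1 := by
    intro S
    have : φ Finset.univ = (simplexOf (chainOf s b)).1 := by
      rw [hφ _ Finset.univ_nonempty]
      congr 2
      exact Subtype.ext (by simp [chainOf])
    rw [Set.mem_Iic, ← this, hle]
    exact Finset.subset_univ S
  let ψ : Finset (Fin (k + 1)) ↪o Set.Iic (simplexOf (chainOf s b)).1 :=
    OrderEmbedding.ofMapLEIff (fun S => ⟨φ S, hmem S⟩) fun S T => hle S T
  refine ⟨(RelIso.ofSurjective ψ ?_).symm⟩
  rintro ⟨J, hJ⟩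
  by_cases hJ0 : J = ⊥
  · exact ⟨∅, Subtype.ext (hφ0.trans hJ0.symm)⟩
  obtain ⟨M, hM⟩ := simplexOf_surjective ⟨J, hJ0⟩
  have hMle : simplexOf M ≤ simplexOf (chainOf s b) := by rw [hM]; exact hJ
  obtain ⟨v, hv, h⟩ := (simplexOf_le_iff _ _).1 hMle
  set M' : PeriodicChain (n + 1) := ⟨translate (-v) M.1, M.2.translate _⟩ with hM'
  have hM'M : simplexOf M' = simplexOf M :=
    (simplexOf_eq_iff _ _).2 ⟨-v, by simp [hv], rfl⟩
  have hsub : M'.1 ⊆ (chainOf s b).1 := by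
    have := translate_mono (-v) h
    rwa [← translate_add, neg_add_cancel, translate_zero] at this
  have heq := eq_steps_of_subset M'.2 hsub
  let S : Finset (Fin (k + 1)) := Finset.univ.filter fun j => step s b j ∈ M'.1
  have hS' : (S : Set (Fin (k + 1))) = {j | step s b j ∈ M'.1} := by ext j; simp [S]
  have hS : S.Nonempty := by
    obtain ⟨m, hm⟩ := M'.2.1
    rw [heq] at hm
    obtain ⟨c, j, hj, _⟩ := hm
    exact ⟨j, by rw [← Finset.mem_coe, hS']; exact hj⟩
  refine ⟨S, Subtype.ext ((hφ S hS).trans ?_)⟩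
  have : (⟨steps s b S, isPeriodicChain_steps s b (Finset.coe_nonempty.2 hS)⟩ :
      PeriodicChain (n + 1)) = M' := Subtype.ext ((congrArg (steps s b) hS').trans heq.symm)
  rw [this, hM'M, hM]

end step

/-- In the slice where coordinate 0 equals `s`, both chains are increasing enumerations of the same
finite set and so agree term by term. The coordinate sums of the first terms give `s ≡ s'` modulo `n
+ 1`, and the bounds on both give equality. -/
lemma chainOf_injective {s s' : ℤ} {b b' : Fin (n + 1) → Fin (k + 1)}
    (hb : Function.Surjective b) (hb' : Function.Surjective b') (h0 : b 0 = Fin.last k)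
    (h0' : b' 0 = Fin.last k) (hs : 0 ≤ s) (hs1 : s < n + 1) (hs' : 0 ≤ s') (hs1' : s' < n + 1)
    (h : simplexOf (chainOf s b) = simplexOf (chainOf s' b')) : s = s' ∧ b = b' := by
  obtain ⟨v, hv, h⟩ := (simplexOf_eq_iff _ _).1 h
  -- The multiple of (1, …, 1) that moves the translated chain into that slice.
  set c : ℤ := s - s' - v 0 with hc
  set g : Fin (k + 1) → Fin (n + 1) → ℤ :=
    fun j => step s' b' j + (v + (c : Fin (n + 1) → ℤ)) with hg
  have hgm : StrictMono g := fun j j' hj => add_lt_add_left (step_strictMono hb' hj) _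
  have hr : Set.range (step s b) = Set.range g := by
    have h1 : Set.range (step s b) = {m ∈ (chainOf s b).1 | m 0 = s} := by
      ext m
      constructor
      · rintro ⟨j, rfl⟩
        exact ⟨mem_chainOf.2 ⟨0, j, by simp⟩, step_apply_zero h0 j⟩
      · rintro ⟨hm, hm0⟩
        obtain ⟨c, j, rfl⟩ := mem_chainOf.1 hm
        rw [Pi.add_apply, step_apply_zero h0] at hm0
        have : c = 0 := by simpa using hm0
        exact ⟨j, by simp [this]⟩
    have h2 : Set.range g = {m ∈ translate v (chainOf s' b').1 | m 0 = s} := by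
      ext m
      constructor
      · rintro ⟨j, rfl⟩
        refine ⟨mem_chainOf.2 ⟨c, j, ?_⟩, ?_⟩
        · simp only [hg]; abel
        · simp only [hg, Pi.add_apply, step_apply_zero h0']
          simp [hc]
      · rintro ⟨hm, hm0⟩
        obtain ⟨c', j, hj⟩ := mem_chainOf.1 hm
        have hj0 := congrFun hj 0
        rw [Pi.sub_apply, Pi.add_apply, step_apply_zero h0', hm0] at hj0
        have : c' = c := by
          simp only [Pi.intCast_apply, Int.cast_id] at hj0
          omega
        refine ⟨j, ?_⟩
        rw [sub_eq_iff_eq_add, this] at hj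
        rw [hj]
        simp only [hg]; abel
    rw [h1, h2, h]
  have hfun := (StrictMono.range_inj (step_strictMono hb) hgm).1 hr
  have hz := congrFun hfun 0
  simp only [hg, step_zero] at hz
  have hsum := congrArg (fun x : Fin (n + 1) → ℤ => ∑ i, x i) hz
  simp only [Pi.add_apply, Finset.sum_add_distrib, hv, Finset.sum_pi_single', Finset.mem_univ,
    if_true, Pi.intCast_apply, Int.cast_id, Finset.sum_const, Finset.card_univ, Fintype.card_fin,
    nsmul_eq_mul, zero_add] at hsum
  push_cast at hsum
  have hc0 : c = 0 := by
    rcases lt_trichotomy c 0 with h | h | h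
    · nlinarith
    · exact h
    · nlinarith
  rw [hc0] at hsum hz hg
  have hss : s = s' := by simpa using hsum
  subst hss
  have hv0 : v = 0 := by simpa using hz
  refine ⟨rfl, funext fun i => ?_⟩
  have key : ∀ j, b i < j ↔ b' i < j := by
    intro j
    have : step s b j i = step s b' j i := by
      rw [hfun, hg, hv0]; simp
    simp only [step] at this
    by_cases h1 : b i < j <;> by_cases h2 : b' i < j <;> simp [h1, h2] at this ⊢
  exact eq_of_forall_gt_iff key

/-- Finite sets on which an integer-valued function is injective can be enumerated with increasing
values. -/
lemma exists_enumeration {α : Type*} {R : Set α} (hR : R.Finite) (hR0 : R.Nonempty) (g : α → ℤ)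
    (hg : Set.InjOn g R) : ∃ (k : ℕ) (u : Fin (k + 1) → α), StrictMono (g ∘ u) ∧
      Set.range u = R := by
  classical
  set T := (hR.image g).toFinset with hT
  have hT0 : T.Nonempty := by simpa [hT] using hR0
  obtain ⟨k, hk⟩ := Nat.exists_eq_add_of_lt hT0.card_pos
  have hk : T.card = k + 1 := by omega
  have hmem : ∀ j, ∃ x ∈ R, g x = T.orderEmbOfFin hk j := by
    intro j
    have := T.orderEmbOfFin_mem hk j
    exact (Set.Finite.mem_toFinset (hR.image g)).1 this
  choose u hu hgu using hmem
  refine ⟨k, u, fun i j hij => by simpa [hgu] using hij, Set.Subset.antisymm ?_ fun x hx => ?_⟩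
  · rintro _ ⟨j, rfl⟩; exact hu j
  · have : g x ∈ Set.range (T.orderEmbOfFin hk) := by
      rw [Finset.range_orderEmbOfFin]
      exact (Set.Finite.mem_toFinset (hR.image g)).2 ⟨x, hx, rfl⟩
    obtain ⟨j, hj⟩ := this
    exact ⟨j, hg (hu j) hx (by rw [hgu, hj])⟩

/-- Up to translation, every periodic chain is in normal form. -/
lemma exists_chainOf (M : PeriodicChain (n + 1)) :
    ∃ (k : ℕ) (s : Fin (n + 1)) (b : Fin (n + 1) → Fin (k + 1)), Function.Surjective b ∧
      b 0 = Fin.last k ∧ simplexOf (chainOf (s : ℤ) b) = simplexOf M := by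
  set R : Set (Fin (n + 1) → ℤ) := {m ∈ M.1 | m 0 = 0} with hR
  have hR0 : R.Nonempty := M.2.exists_zero
  have hle : ∀ x ∈ R, ∀ y ∈ R, x ≤ y + 1 := by
    intro x hx y hy
    rcases M.2.le_total hx.1 ((M.2.2.2 y).2 hy.1) with h | h
    · exact h
    · have h1 : (y + 1) 0 ≤ x 0 := h 0
      rw [hx.2, Pi.add_apply, hy.2] at h1
      simp at h1
  have hRf : R.Finite := by
    obtain ⟨r, hr⟩ := hR0
    refine (Set.finite_Icc (r - 1) (r + 1)).subset fun x hx => ⟨?_, hle x hx r hr⟩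
    exact sub_le_iff_le_add.2 (hle r hr x hx)
  have hinj : Set.InjOn (fun m : Fin (n + 1) → ℤ => ∑ i, m i) R := fun x hx y hy h =>
    M.2.eq_of_sum_eq hx.1 hy.1 h
  obtain ⟨k, u, hu, hrange⟩ := exists_enumeration hRf hR0 _ hinj
  have huR : ∀ j, u j ∈ R := fun j => hrange ▸ ⟨j, rfl⟩
  have humono : StrictMono u := by
    intro j j' h
    have h1 : ∑ i, u j i < ∑ i, u j' i := hu h
    rcases M.2.le_total (huR j).1 (huR j').1 with h2 | h2
    · exact lt_of_le_of_ne h2 fun he => h1.ne (by rw [he])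
    · exact absurd (Finset.sum_le_sum fun i _ => h2 i) (not_le.2 h1)
  set p := u 0 with hp
  have hup : ∀ j i, u j i = p i ∨ u j i = p i + 1 := by
    intro j i
    have h1 : p i ≤ u j i := humono.monotone (Fin.zero_le j) i
    have h2 : u j i ≤ p i + 1 := hle _ (huR j) _ (huR 0) i
    omega
  -- Along the slice, coordinate `i` jumps by one at most once; `b i` is the last index before the
  -- jump, or the last index of all if there is none.
  have hex : ∀ i, ∃ t : Fin (k + 1), ∀ j, t < j ↔ u j i = p i + 1 := by
    intro i
    obtain ⟨t, ht, hmax⟩ := Finset.exists_max_image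
      (Finset.univ.filter fun j => u j i = p i) id ⟨0, by simp [hp]⟩
    simp only [Finset.mem_filter, Finset.mem_univ, true_and, id] at ht hmax
    refine ⟨t, fun j => ⟨fun h => (hup j i).resolve_left fun h1 => absurd (hmax j h1) (not_le.2 h),
      fun h => ?_⟩⟩
    by_contra hjt
    have h1 : u j i ≤ u t i := humono.monotone (not_lt.1 hjt) i
    omega
  choose b hb using hex
  have hub : ∀ j i, u j i = p i + if b i < j then 1 else 0 := by
    intro j i
    split_ifs with h
    · exact (hb i j).1 h
    · rw [add_zero]; exact (hup j i).resolve_right fun h1 => h ((hb i j).2 h1)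
  have h0 : b 0 = Fin.last k := by
    by_contra h
    have h1 := (hb 0 (Fin.last k)).1 (lt_of_le_of_ne (Fin.le_last _) h)
    rw [(huR _).2, show p 0 = 0 from (huR 0).2] at h1
    simp at h1
  have hsurj : Function.Surjective b := by
    intro j
    rcases eq_or_ne j (Fin.last k) with rfl | hj
    · exact ⟨0, h0⟩
    have hjk : (j : ℕ) < k := Fin.val_lt_last hj
    obtain ⟨i, hi⟩ := (Pi.lt_def.1 (humono (show j < ⟨j + 1, by omega⟩ from
      Fin.lt_def.2 (Nat.lt_succ_self _)))).2
    refine ⟨i, ?_⟩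
    rw [hub, hub] at hi
    split_ifs at hi with h1 h2 h3
    · omega
    · omega
    · rw [Fin.lt_def] at h1 h3
      simp only at h3
      exact Fin.ext (by omega)
    · omega
  -- The coordinate sum modulo `n + 1` is unchanged by zero-sum translations and by (1, …, 1); its
  -- residue is the parameter `s`.
  set σ := ∑ i, p i with hσ
  have hn : (0 : ℤ) < (n + 1 : ℕ) := by positivity
  obtain ⟨r, hr⟩ : ∃ r : Fin (n + 1), (r : ℤ) = σ % (n + 1 : ℕ) := by
    have h1 := Int.emod_nonneg σ hn.ne'
    have h2 := Int.emod_lt_of_pos σ hn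
    exact ⟨⟨(σ % (n + 1 : ℕ)).toNat, by omega⟩, by simp only; omega⟩
  set q := σ / (n + 1 : ℕ) with hq
  have hdiv : σ = r + (n + 1 : ℕ) * q := by rw [hr]; exact (Int.emod_add_mul_ediv _ _).symm
  set v : Fin (n + 1) → ℤ := p - Pi.single 0 (r : ℤ) - (q : Fin (n + 1) → ℤ) with hv
  have hv0 : ∑ i, v i = 0 := by
    simp only [hv, Pi.sub_apply, Finset.sum_sub_distrib, ← hσ, Finset.sum_pi_single',
      Finset.mem_univ, if_true, Pi.intCast_apply, Int.cast_id, Finset.sum_const, Finset.card_univ,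
      Fintype.card_fin, nsmul_eq_mul]
    rw [hdiv]; simp
  have hstep : ∀ j, u j = step r b j + v + (q : Fin (n + 1) → ℤ) := by
    intro j
    ext i
    simp only [hub, step, hv, Pi.add_apply, Pi.sub_apply]
    ring
  refine ⟨k, r, b, hsurj, h0, Eq.symm ((simplexOf_eq_iff _ _).2 ⟨v, hv0, ?_⟩)⟩
  ext m
  constructor
  · intro hm
    have hmR : m + ((-m 0 : ℤ) : Fin (n + 1) → ℤ) ∈ R :=
      ⟨(M.2.mem_add _ _).2 hm, by simp⟩
    rw [← hrange] at hmR
    obtain ⟨j, hj⟩ := hmR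
    refine mem_chainOf.2 ⟨q + m 0, j, ?_⟩
    rw [hstep, Int.cast_neg] at hj
    have : m - v = m + -((m 0 : ℤ) : Fin (n + 1) → ℤ) + ((m 0 : ℤ) : Fin (n + 1) → ℤ) - v := by abel
    rw [this, ← hj, Int.cast_add]
    abel
  · intro hm
    obtain ⟨c, j, hj⟩ := mem_chainOf.1 hm
    have : m = u j + ((c - q : ℤ) : Fin (n + 1) → ℤ) := by
      rw [sub_eq_iff_eq_add] at hj
      rw [hj, hstep, Int.cast_sub]
      abel
    rw [this]
    exact (M.2.mem_add _ _).2 (huR j).1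

end Wonderful

end

noncomputable section

/-! ### Counting surjections -/

/-- Two cases: the value `x` at 0 is taken again later, or the remaining values cover exactly the
complement of `x`. -/
lemma card_surjective_cons (n k : ℕ) (x : Fin (k + 1)) :
    Nat.card {b : Fin (n + 1) → Fin (k + 1) // Function.Surjective b ∧ b 0 = x} =
      Nat.card {b : Fin n → Fin (k + 1) // Function.Surjective b} +
        Nat.card {b : Fin n → Fin k // Function.Surjective b} := by
  rw [← Nat.card_sum]
  let Φ : {b : Fin n → Fin (k + 1) // Function.Surjective b} ⊕
      {b : Fin n → Fin k // Function.Surjective b} →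
      {b : Fin (n + 1) → Fin (k + 1) // Function.Surjective b ∧ b 0 = x} :=
    Sum.elim
      (fun b => ⟨Fin.cons x b.1, fun y => by
        obtain ⟨i, hi⟩ := b.2 y
        exact ⟨i.succ, by simpa using hi⟩, rfl⟩)
      (fun b => ⟨Fin.cons x (x.succAbove ∘ b.1), fun y => by
        rcases Fin.eq_self_or_eq_succAbove x y with rfl | ⟨z, rfl⟩
        · exact ⟨0, rfl⟩
        · obtain ⟨i, rfl⟩ := b.2 z
          exact ⟨i.succ, by simp⟩, rfl⟩)
  refine (Nat.card_congr (Equiv.ofBijective Φ ⟨?_, ?_⟩)).symm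
  · have hcons : ∀ y z : Fin n → Fin (k + 1),
        (Fin.cons x y : Fin (n + 1) → Fin (k + 1)) = Fin.cons x z → y = z := fun y z h =>
      (Fin.cons_inj.1 h).2
    have key : ∀ (b : {b : Fin n → Fin (k + 1) // Function.Surjective b})
        (c : {b : Fin n → Fin k // Function.Surjective b}), b.1 ≠ x.succAbove ∘ c.1 := by
      intro b c h
      obtain ⟨i, hi⟩ := b.2 x
      rw [h] at hi
      exact Fin.succAbove_ne _ _ hi
    rintro (b | b) (c | c) h
    · have := hcons _ _ (congrArg Subtype.val h)
      rw [Subtype.ext this]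
    · exact absurd (hcons _ _ (congrArg Subtype.val h)) (key b c)
    · exact absurd (hcons _ _ (congrArg Subtype.val h)).symm (key c b)
    · have := hcons _ _ (congrArg Subtype.val h)
      rw [Subtype.ext (funext fun i => Fin.succAbove_right_injective (congrFun this i))]
  · rintro ⟨b, hb, h0⟩
    by_cases hx : ∃ i : Fin n, b i.succ = x
    · refine ⟨.inl ⟨Fin.tail b, fun y => ?_⟩, Subtype.ext ?_⟩
      · obtain ⟨i, rfl⟩ := hb y
        refine Fin.cases ?_ (fun i => ⟨i, rfl⟩) i
        rw [h0]; exact hx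
      · change Fin.cons x (Fin.tail b) = b
        rw [← h0, Fin.cons_self_tail]
    · have hex : ∀ i : Fin n, ∃ z : Fin k, b i.succ = x.succAbove z := fun i =>
        (Fin.eq_self_or_eq_succAbove x (b i.succ)).resolve_left fun h => hx ⟨i, h⟩
      choose c hc using hex
      refine ⟨.inr ⟨c, fun y => ?_⟩, Subtype.ext ?_⟩
      · obtain ⟨i, hi⟩ := hb (x.succAbove y)
        refine Fin.cases (fun h => ?_) (fun i h => ?_) i hi
        · exact absurd (h.symm.trans h0) (Fin.succAbove_ne _ _)
        · exact ⟨i, Fin.succAbove_right_injective ((hc i).symm.trans h)⟩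
      · change Fin.cons x (x.succAbove ∘ c) = b
        have : x.succAbove ∘ c = Fin.tail b := funext fun i => (hc i).symm
        rw [this, ← h0, Fin.cons_self_tail]

lemma card_surjective (n k : ℕ) :
    Nat.card {b : Fin n → Fin k // Function.Surjective b} =
      k.factorial * Nat.stirlingSecond n k := by
  induction n generalizing k with
  | zero =>
    cases k with
    | zero =>
      have : Unique {b : Fin 0 → Fin 0 // Function.Surjective b} :=
        ⟨⟨⟨id, Function.surjective_id⟩⟩, fun b => Subtype.ext (Subsingleton.elim _ _)⟩
      simp
    | succ k =>
      have : IsEmpty {b : Fin 0 → Fin (k + 1) // Function.Surjective b} :=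
        ⟨fun b => (b.2 0).choose.elim0⟩
      simp
  | succ n ih =>
    cases k with
    | zero => simp
    | succ k =>
      let e : (Σ x, {b : Fin (n + 1) → Fin (k + 1) // Function.Surjective b ∧ b 0 = x}) ≃
          {b : Fin (n + 1) → Fin (k + 1) // Function.Surjective b} :=
        { toFun := fun p => ⟨p.2.1, p.2.2.1⟩
          invFun := fun b => ⟨b.1 0, b.1, b.2, rfl⟩
          left_inv := by rintro ⟨_, b, hb, rfl⟩; rfl
          right_inv := fun _ => rfl }
      rw [← Nat.card_congr e, Nat.card_sigma]
      simp only [card_surjective_cons, ih, Finset.sum_const, Finset.card_univ, Fintype.card_fin,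
        smul_eq_mul, Nat.stirlingSecond_succ_succ, Nat.factorial_succ]
      ring

lemma card_surjective_of_apply_zero (n k : ℕ) (x : Fin (k + 1)) :
    Nat.card {b : Fin (n + 1) → Fin (k + 1) // Function.Surjective b ∧ b 0 = x} =
      k.factorial * Nat.stirlingSecond (n + 1) (k + 1) := by
  rw [card_surjective_cons, card_surjective, card_surjective, Nat.stirlingSecond_succ_succ,
    Nat.factorial_succ]
  ring

namespace SimplicialPoset

variable {S : Type*} [PartialOrder S]

lemma HasCard.unique {I : S} {k l : ℕ} (hk : HasCard I k) (hl : HasCard I l) : k = l := by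
  obtain ⟨e⟩ := hk
  obtain ⟨e'⟩ := hl
  have := Fintype.card_congr (e.symm.trans e').toEquiv
  rw [Fintype.card_finset, Fintype.card_finset, Fintype.card_fin, Fintype.card_fin] at this
  exact Nat.pow_right_injective le_rfl this

lemma hasCard_bot [OrderBot S] : HasCard (⊥ : S) 0 := by
  have : Unique (Set.Iic (⊥ : S)) := ⟨⟨⟨⊥, le_rfl⟩⟩, fun x => Subtype.ext (le_bot_iff.1 x.2)⟩
  exact ⟨OrderIso.ofUnique _ _⟩

end SimplicialPoset

/-! ### Counting the simplices; purity -/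

namespace Wonderful

open SimplicialPoset

variable {n : ℕ}

lemma exists_nonbot_eq {I : K (n + 1)} (hI : I ≠ ⊥) : ∃ (k : ℕ) (s : Fin (n + 1))
    (b : Fin (n + 1) → Fin (k + 1)), Function.Surjective b ∧ b 0 = Fin.last k ∧
      (simplexOf (chainOf (s : ℤ) b)).1 = I := by
  obtain ⟨M, hM⟩ := simplexOf_surjective ⟨I, hI⟩
  obtain ⟨k, s, b, hb, h0, h⟩ := exists_chainOf M
  exact ⟨k, s, b, hb, h0, by rw [h, hM]⟩

/-- The simplices with `k + 1` vertices in terms of their normal forms. -/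
def normalForm (n k : ℕ) (p : Fin (n + 1) × {b : Fin (n + 1) → Fin (k + 1) //
    Function.Surjective b ∧ b 0 = Fin.last k}) : {I : K (n + 1) // HasCard I (k + 1)} :=
  ⟨(simplexOf (chainOf (p.1 : ℤ) p.2.1)).1, hasCard_chainOf p.2.2.1 p.2.2.2⟩

lemma normalForm_bijective (n k : ℕ) : Function.Bijective (normalForm n k) := by
  constructor
  · rintro ⟨s, b, hb, h0⟩ ⟨s', b', hb', h0'⟩ h
    have hval : (simplexOf (chainOf (s : ℤ) b)).1 = (simplexOf (chainOf (s' : ℤ) b')).1 := by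
      have hval := congrArg Subtype.val h
      exact hval
    obtain ⟨h1, rfl⟩ := chainOf_injective hb hb' h0 h0' (Int.natCast_nonneg _)
      (by exact_mod_cast s.2) (Int.natCast_nonneg _) (by exact_mod_cast s'.2)
      (Subtype.ext hval)
    rw [Fin.ext (Nat.cast_injective h1)]
  · rintro ⟨I, hI⟩
    have hI0 : I ≠ ⊥ := by
      rintro rfl
      exact Nat.succ_ne_zero k (hI.unique hasCard_bot)
    obtain ⟨l, s, b, hb, h0, rfl⟩ := exists_nonbot_eq hI0
    obtain rfl : l = k := Nat.succ_injective ((hasCard_chainOf hb h0).unique hI)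
    exact ⟨⟨s, b, hb, h0⟩, rfl⟩

lemma f_succ (n k : ℕ) :
    f (K (n + 1)) (k + 1) = (n + 1) * k.factorial * Nat.stirlingSecond (n + 1) (k + 1) := by
  rw [f, ← Nat.card_congr (Equiv.ofBijective _ (normalForm_bijective n k)), Nat.card_prod,
    card_surjective_of_apply_zero, Nat.card_eq_fintype_card, Fintype.card_fin, mul_assoc]

lemma f_zero (n : ℕ) : f (K (n + 1)) 0 = 1 := by
  have : Unique {I : K (n + 1) // HasCard I 0} := by
    refine ⟨⟨⟨⊥, hasCard_bot⟩⟩, ?_⟩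
    rintro ⟨I, hI⟩
    by_contra h
    obtain ⟨k, s, b, hb, h0, rfl⟩ := exists_nonbot_eq fun h1 => h (Subtype.ext h1)
    exact Nat.succ_ne_zero k ((hasCard_chainOf hb h0).unique hI)
  exact Nat.card_unique

lemma isSimplicial_K (n : ℕ) : IsSimplicial (K (n + 1)) := by
  constructor
  · let g : Option (Σ k : Fin (n + 1), Fin (n + 1) × {b : Fin (n + 1) → Fin ((k : ℕ) + 1) //
        Function.Surjective b ∧ b 0 = Fin.last k}) → K (n + 1) := fun x =>
      x.elim ⊥ fun p => (normalForm n p.1 p.2).1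
    refine Finite.of_surjective g fun I => ?_
    by_cases hI : I = ⊥
    · exact ⟨none, hI.symm⟩
    obtain ⟨k, s, b, hb, h0, rfl⟩ := exists_nonbot_eq hI
    have hk : k < n + 1 := by
      have := Fintype.card_le_of_surjective b hb
      rw [Fintype.card_fin, Fintype.card_fin] at this
      omega
    exact ⟨some ⟨⟨k, hk⟩, s, b, hb, h0⟩, rfl⟩
  · intro I
    by_cases hI : I = ⊥
    · exact ⟨0, hI ▸ hasCard_bot⟩
    obtain ⟨k, s, b, hb, h0, rfl⟩ := exists_nonbot_eq hI
    exact ⟨k + 1, hasCard_chainOf hb h0⟩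

/-- A periodic chain with two coordinates that always increase simultaneously can be refined. -/
lemma exists_refinement {k : ℕ} (s : ℤ) {b : Fin (n + 1) → Fin (k + 1)}
    (hb : ¬ Function.Injective b) :
    ∃ M : PeriodicChain (n + 1), (chainOf s b).1 ⊂ M.1 := by
  obtain ⟨i, i', hbi, hii⟩ : ∃ i i', b i = b i' ∧ i ≠ i' := by
    simpa [Function.Injective] using hb
  -- Raising `i` alone gives a vector between two consecutive members of the chain; it is new
  -- because `i` and `i'` increase together in the chain.
  set p : Fin (n + 1) → ℤ := step s b (b i) + Pi.single i 1 with hp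
  have hpl : ∀ l, step s b (b i) l ≤ p l := by
    intro l
    rw [hp, Pi.add_apply, Pi.single_apply]
    split_ifs <;> omega
  have hpu : ∀ j, b i < j → ∀ l, p l ≤ step s b j l := by
    intro j hj l
    have h1 : step s b (b i) l ≤ step s b j l := step_mono hj.le l
    rw [hp, Pi.add_apply, Pi.single_apply]
    split_ifs with h
    · subst h; simp [step, hj]
    · omega
  have hpa : ∀ j l, p l ≤ step s b j l + 1 := by
    intro j l
    have h1 : step s b (b i) l ≤ step s b j l + 1 := step_le_add_one _ _ l
    rw [hp, Pi.add_apply, Pi.single_apply]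
    split_ifs with h
    · subst h
      simp only [step, lt_irrefl, if_false]
      split_ifs <;> omega
    · omega
  have hcomp : ∀ m ∈ (chainOf s b).1, m ≤ p ∨ p ≤ m := by
    intro m hm
    obtain ⟨c, j, rfl⟩ := mem_chainOf.1 hm
    rcases lt_trichotomy c 0 with hc | rfl | hc
    · refine .inl fun l => ?_
      have h1 : step s b j l ≤ step s b (b i) l + 1 := step_le_add_one _ _ l
      have h2 := hpl l
      simp only [Pi.add_apply, Pi.intCast_apply, Int.cast_id]
      omega
    · rcases le_or_gt j (b i) with hj | hj
      · refine .inl fun l => ?_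
        have h1 : step s b j l ≤ step s b (b i) l := step_mono hj l
        simpa using h1.trans (hpl l)
      · exact .inr fun l => by simpa using hpu j hj l
    · refine .inr fun l => ?_
      have h1 := hpa j l
      simp only [Pi.add_apply, Pi.intCast_apply, Int.cast_id]
      omega
  refine ⟨⟨_, (chainOf s b).2.union_orbit hcomp⟩, Set.subset_union_left, fun h => ?_⟩
  obtain ⟨c, j, hj⟩ := mem_chainOf.1 (h (Set.mem_union_right _ (self_mem_orbit p)))
  have h1 := congrFun hj i
  have h2 := congrFun hj i'
  simp only [hp, step, Pi.add_apply, Pi.single_eq_same, Pi.single_eq_of_ne hii.symm, ← hbi,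
    lt_irrefl, if_false, Pi.intCast_apply, Int.cast_id] at h1 h2
  omega

/-- At a maximal simplex no refinement exists, so `b` is a bijection and `k = n`. -/
lemma isPure_K (n : ℕ) : IsPure (K (n + 1)) (n + 1) := by
  intro I hI
  by_cases hI0 : I = ⊥
  · subst hI0
    obtain ⟨J⟩ : Nonempty (Nonbot (K (n + 1))) := inferInstance
    exact absurd (le_bot_iff.1 (hI bot_le)) J.2
  obtain ⟨k, s, b, hb, h0, rfl⟩ := exists_nonbot_eq hI0
  have hinj : Function.Injective b := by
    by_contra h
    obtain ⟨M, hM, hM'⟩ := exists_refinement (s : ℤ) h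
    have h1 : simplexOf (chainOf (s : ℤ) b) ≤ simplexOf M :=
      (simplexOf_le_iff _ _).2 ⟨0, by simp, by rwa [translate_zero]⟩
    have h2 : simplexOf M ≤ simplexOf (chainOf (s : ℤ) b) := hI h1
    obtain ⟨v, hv, h3⟩ := (simplexOf_le_iff _ _).1 h2
    exact hM' (IsPeriodicChain.subset_of_subset_translate M.2.1 M.2 le_rfl hM hv h3)
  have hk := Fintype.card_of_bijective ⟨hinj, hb⟩
  rw [Fintype.card_fin, Fintype.card_fin] at hk
  exact Eq.subst (motive := fun l => HasCard (simplexOf (chainOf (s : ℤ) b)).1 l) hk.symm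
    (hasCard_chainOf hb h0)

end Wonderful

end

noncomputable section

/-! ### The enumerative invariants -/

namespace SimplicialPoset

lemma h_eq (S : Type*) [PartialOrder S] {n l : ℕ} (hl : l ≤ n) :
    h S n l = (-1 : ℤ) ^ l * (n.choose (n - l) : ℤ) * f S 0 +
      ∑ k ∈ Finset.Icc 1 l, (-1 : ℤ) ^ (l - k) * ((n - k).choose (n - l) : ℤ) * f S k := by
  have hterm : ∀ j, (Polynomial.C (f S j : ℤ) * (Polynomial.X - 1) ^ (n - j)).coeff (n - l) =
      (-1 : ℤ) ^ (n - j - (n - l)) * ((n - j).choose (n - l) : ℤ) * f S j := by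
    intro j
    rw [Polynomial.coeff_C_mul, sub_eq_add_neg, ← Polynomial.C_1, ← Polynomial.C_neg,
      Polynomial.coeff_X_add_C_pow]
    ring
  have hIcc : Finset.range (l + 1) = insert 0 (Finset.Icc 1 l) := by
    ext j; simp only [Finset.mem_range, Finset.mem_insert, Finset.mem_Icc]; omega
  rw [h, Polynomial.finsetSum_coeff, Finset.sum_congr rfl fun j _ => hterm j,
    ← Finset.sum_subset (Finset.range_subset_range.2 (Nat.succ_le_succ hl)), hIcc,
    Finset.sum_insert (by simp)]
  · congr 1
    · rw [Nat.sub_zero, Nat.sub_sub_self hl]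
    · refine Finset.sum_congr rfl fun k hk => ?_
      have : n - k - (n - l) = l - k := by have := Finset.mem_Icc.1 hk; omega
      rw [this]
  · intro j hj hj'
    rw [Finset.mem_range] at hj hj'
    rw [Nat.choose_eq_zero_of_lt (by omega)]
    simp

end SimplicialPoset

/-- The recurrence reads (k-1)! S(m+1,k) = k! S(m,k) + (k-1)! S(m,k-1), so the alternating sum
telescopes; both end terms vanish as `m ≠ 0`. -/
lemma alternating_sum_stirlingSecond {m : ℕ} (hm : m ≠ 0) :
    ∑ k ∈ Finset.Icc 1 (m + 1), (-1 : ℤ) ^ (m + 1 - k) *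
      (((k - 1).factorial : ℤ) * (Nat.stirlingSecond (m + 1) k : ℤ)) = 0 := by
  set t : ℕ → ℤ := fun j => (-1) ^ j * (j.factorial * Nat.stirlingSecond m j) with ht
  have hterm : ∀ j ∈ Finset.range (m + 1), (-1 : ℤ) ^ (m + 1 - (1 + j)) *
      (((1 + j - 1).factorial : ℤ) * (Nat.stirlingSecond (m + 1) (1 + j) : ℤ)) =
      -(-1) ^ m * (t (j + 1) - t j) := by
    intro j hj
    obtain ⟨d, rfl⟩ := Nat.exists_eq_add_of_le (Nat.lt_succ_iff.1 (Finset.mem_range.1 hj))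
    have h1 : j + d + 1 - (1 + j) = d := by omega
    have h2 : ((-1 : ℤ) ^ j) ^ 2 = 1 := by rw [← pow_mul, mul_comm, pow_mul]; simp
    rw [h1, add_comm 1 j, Nat.add_sub_cancel, Nat.stirlingSecond_succ_succ]
    simp only [ht, Nat.factorial_succ]
    push_cast
    rw [pow_add, pow_succ]
    linear_combination (-(-1 : ℤ) ^ d * (j.factorial * ((j + 1) * Nat.stirlingSecond (j + d) (j + 1)
      + Nat.stirlingSecond (j + d) j))) * h2
  rw [← Finset.Ico_add_one_right_eq_Icc, Finset.sum_Ico_eq_sum_range, Nat.add_sub_cancel,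
    Finset.sum_congr rfl hterm, ← Finset.mul_sum, Finset.sum_range_sub]
  obtain ⟨p, rfl⟩ := Nat.exists_eq_succ_of_ne_zero hm
  simp [ht, Nat.stirlingSecond_eq_zero_of_lt, Nat.stirlingSecond_succ_zero]

/-- The full alternating sum of binomial coefficients is zero; the right side accounts for the two
missing ends. -/
lemma alternating_sum_choose_Icc {m : ℕ} (hm : m ≠ 0) :
    ∑ k ∈ Finset.Icc 2 m, (-1 : ℤ) ^ (m + 1 - k + 1) * (m.choose (k - 1) : ℤ) =
      1 + (-1) ^ m := by
  obtain ⟨p, rfl⟩ := Nat.exists_eq_succ_of_ne_zero hm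
  have h := Int.alternating_sum_range_choose_of_ne hm
  rw [Finset.sum_range_succ, Finset.sum_range_succ'] at h
  rw [← Finset.Ico_add_one_right_eq_Icc, Finset.sum_Ico_eq_sum_range]
  have hterm : ∀ i ∈ Finset.range (p + 1 + 1 - 2), (-1 : ℤ) ^ (p + 1 + 1 - (2 + i) + 1) *
      ((p + 1).choose (2 + i - 1) : ℤ) =
      (-1) ^ p * ((-1) ^ (i + 1) * ((p + 1).choose (i + 1) : ℤ)) := by
    intro i hi
    obtain ⟨d, rfl⟩ := Nat.exists_eq_add_of_le (show i ≤ p by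
      have := Finset.mem_range.1 hi; omega)
    have h1 : i + d + 1 + 1 - (2 + i) + 1 = d + 1 := by omega
    have h2 : ((-1 : ℤ) ^ i) ^ 2 = 1 := by rw [← pow_mul, mul_comm, pow_mul]; simp
    have h3 : 2 + i - 1 = i + 1 := by omega
    rw [h1, h3, pow_add, pow_succ, pow_succ]
    linear_combination ((-1 : ℤ) ^ d * ((i + d + 1).choose (i + 1) : ℤ)) * h2
  have hp : ((-1 : ℤ) ^ p) ^ 2 = 1 := by rw [← pow_mul, mul_comm, pow_mul]; simp
  rw [Nat.succ_eq_add_one, Finset.sum_congr rfl hterm, ← Finset.mul_sum]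
  have h4 : p + 1 + 1 - 2 = p := by omega
  simp only [Nat.succ_eq_add_one, pow_zero, Nat.choose_zero_right, Nat.choose_self, Nat.cast_one,
    mul_one] at h
  rw [h4]
  linear_combination (-1 : ℤ) ^ p * h + hp

/-! ### Betti numbers and h-numbers of K -/

namespace Wonderful

open SimplicialPoset

lemma reducedBetti_zero (F : Type*) [Field F] (m : ℕ) : reducedBetti F (K (m + 1)) 0 = 0 :=
  PosetCover.reducedBetti_zero F

lemma reducedBetti_one (F : Type*) [Field F] (m : ℕ) : reducedBetti F (K (m + 1)) 1 = 0 :=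
  PosetCover.reducedBetti_one (periodicCover m) (acyclic_periodicChain F m)

lemma reducedBetti_of_two_le (F : Type*) [Field F] (m : ℕ) {k : ℕ} (hk : 2 ≤ k) :
    reducedBetti F (K (m + 1)) k = m.choose (k - 1) := by
  obtain ⟨k, rfl⟩ := Nat.exists_eq_add_of_le' hk
  exact PosetCover.reducedBetti_add_two (periodicCover m) (acyclic_periodicChain F m) k

lemma h_K (m l : ℕ) (hl : l ≤ m + 1) :
    h (K (m + 1)) (m + 1) l = (-1 : ℤ) ^ l * ((m + 1).choose (m + 1 - l) : ℤ) +
      ∑ k ∈ Finset.Icc 1 l, (-1 : ℤ) ^ (l - k) * ((m + 1 - k).choose (m + 1 - l) : ℤ) *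
        (((m + 1 : ℕ) : ℤ) * ((k - 1).factorial : ℤ) * (Nat.stirlingSecond (m + 1) k : ℤ)) := by
  rw [h_eq _ hl, f_zero, Nat.cast_one, mul_one]
  congr 1
  refine Finset.sum_congr rfl fun k hk => ?_
  obtain ⟨k, rfl⟩ := Nat.exists_eq_add_of_le' (Finset.mem_Icc.1 hk).1
  rw [f_succ]
  push_cast
  simp

lemma h'_K (F : Type*) [Field F] (m l : ℕ) :
    h' F (K (m + 1)) (m + 1) l = h (K (m + 1)) (m + 1) l + ((m + 1).choose l : ℤ) *
      ∑ k ∈ Finset.Icc 2 (l - 1), (-1 : ℤ) ^ (l - k + 1) * (m.choose (k - 1) : ℤ) := by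
  rw [h', ← Finset.sum_subset (Finset.Icc_subset_Icc_left one_le_two)]
  · congr 2
    refine Finset.sum_congr rfl fun k hk => ?_
    rw [reducedBetti_of_two_le F m (Finset.mem_Icc.1 hk).1]
  · intro k hk hk'
    have : k = 1 := by
      rw [Finset.mem_Icc] at hk hk'; omega
    rw [this, reducedBetti_one, Nat.cast_zero, mul_zero]

lemma h''_K (F : Type*) [Field F] (m l : ℕ) (hl : l ≤ m) :
    h'' F (K (m + 1)) (m + 1) l = h (K (m + 1)) (m + 1) l + ((m + 1).choose l : ℤ) *
      ∑ k ∈ Finset.Icc 2 l, (-1 : ℤ) ^ (l - k + 1) * (m.choose (k - 1) : ℤ) := by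
  rw [h'', if_pos (Nat.lt_succ_of_le hl), h'_K]
  -- For `l ≥ 2` the subtracted Betti number is the missing top term of the sum; for `l < 2` both it
  -- and the sums vanish.
  rcases lt_or_ge l 2 with h | h
  · rw [Finset.Icc_eq_empty (by omega), Finset.Icc_eq_empty (by omega)]
    have : reducedBetti F (K (m + 1)) l = 0 := by
      obtain rfl | rfl : l = 0 ∨ l = 1 := by omega
      · exact reducedBetti_zero F m
      · exact reducedBetti_one F m
    simp [this]
  · obtain ⟨l, rfl⟩ := Nat.exists_eq_add_of_le' h
    rw [show l + 2 - 1 = l + 1 by omega, Finset.sum_Icc_succ_top (by omega : 2 ≤ l + 1 + 1),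
      reducedBetti_of_two_le F m h, show l + 1 + 1 - (l + 1 + 1) + 1 = 1 by omega]
    ring

/-- The Stirling part is zero, leaving (-1)^(m+1) + 1 + (-1)^m. -/
lemma h''_K_top (F : Type*) [Field F] {m : ℕ} (hm : m ≠ 0) :
    h'' F (K (m + 1)) (m + 1) (m + 1) = 1 := by
  rw [h'', if_neg (lt_irrefl _), h'_K, h_K _ _ le_rfl, Nat.add_sub_cancel,
    alternating_sum_choose_Icc hm]
  have h0 := alternating_sum_stirlingSecond hm
  have h1 : ∑ k ∈ Finset.Icc 1 (m + 1), (-1 : ℤ) ^ (m + 1 - k) *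
      ((m + 1 - k).choose (m + 1 - (m + 1)) : ℤ) *
        (((m + 1 : ℕ) : ℤ) * ((k - 1).factorial : ℤ) * (Nat.stirlingSecond (m + 1) k : ℤ)) =
      ((m + 1 : ℕ) : ℤ) * ∑ k ∈ Finset.Icc 1 (m + 1), (-1 : ℤ) ^ (m + 1 - k) *
      (((k - 1).factorial : ℤ) * (Nat.stirlingSecond (m + 1) k : ℤ)) := by
    rw [Finset.mul_sum]
    refine Finset.sum_congr rfl fun k _ => ?_
    rw [Nat.sub_self, Nat.choose_zero_right]
    push_cast
    ring
  rw [h1, h0, Nat.sub_self, Nat.choose_zero_right, Nat.choose_self]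
  push_cast
  ring

end Wonderful

end

/-! ### The proposition -/

theorem mainTheorem12 (n : ℕ) (hn : 2 ≤ n) (F : Type*) [Field F] :
    SimplicialPoset.IsSimplicial (Wonderful.K n) ∧
    SimplicialPoset.IsPure (Wonderful.K n) n ∧
    (∀ k : ℕ, 1 ≤ k → k ≤ n →
      SimplicialPoset.f (Wonderful.K n) k = n * (k - 1).factorial * Nat.stirlingSecond n k) ∧
    SimplicialPoset.f (Wonderful.K n) 0 = 1 ∧
    (∀ l : ℕ, l ≤ n →
      SimplicialPoset.h (Wonderful.K n) n l =
        (-1 : ℤ) ^ l * (n.choose (n - l) : ℤ) +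
        ∑ k ∈ Finset.Icc 1 l, (-1 : ℤ) ^ (l - k) * ((n - k).choose (n - l) : ℤ) *
          ((n : ℤ) * ((k - 1).factorial : ℤ) * (Nat.stirlingSecond n k : ℤ))) ∧
    (∀ l : ℕ, l ≤ n →
      SimplicialPoset.h' F (Wonderful.K n) n l =
        (-1 : ℤ) ^ l * (n.choose (n - l) : ℤ) +
        ∑ k ∈ Finset.Icc 1 l, (-1 : ℤ) ^ (l - k) * ((n - k).choose (n - l) : ℤ) *
          ((n : ℤ) * ((k - 1).factorial : ℤ) * (Nat.stirlingSecond n k : ℤ)) +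
        (n.choose l : ℤ) *
          ∑ k ∈ Finset.Icc 2 (l - 1), (-1 : ℤ) ^ (l - k + 1) * ((n - 1).choose (k - 1) : ℤ)) ∧
    (∀ l : ℕ, l ≤ n - 1 →
      SimplicialPoset.h'' F (Wonderful.K n) n l =
        (-1 : ℤ) ^ l * (n.choose (n - l) : ℤ) +
        ∑ k ∈ Finset.Icc 1 l, (-1 : ℤ) ^ (l - k) * ((n - k).choose (n - l) : ℤ) *
          ((n : ℤ) * ((k - 1).factorial : ℤ) * (Nat.stirlingSecond n k : ℤ)) +
        (n.choose l : ℤ) *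
          ∑ k ∈ Finset.Icc 2 l, (-1 : ℤ) ^ (l - k + 1) * ((n - 1).choose (k - 1) : ℤ)) ∧
    SimplicialPoset.h'' F (Wonderful.K n) n n = 1 := by
  obtain ⟨m, rfl⟩ := Nat.exists_eq_add_of_le' (one_le_two.trans hn)
  refine ⟨Wonderful.isSimplicial_K m, Wonderful.isPure_K m, fun k hk _ => ?_, Wonderful.f_zero m,
    Wonderful.h_K m, fun l hl => ?_, fun l hl => ?_, Wonderful.h''_K_top F (by omega)⟩
  · obtain ⟨k, rfl⟩ := Nat.exists_eq_add_of_le' hk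
    exact Wonderful.f_succ m k
  · rw [Wonderful.h'_K, Wonderful.h_K m l hl, Nat.add_sub_cancel]
  · rw [Nat.add_sub_cancel] at hl ⊢
    rw [Wonderful.h''_K F m l hl, Wonderful.h_K m l (hl.trans m.le_succ)]
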